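/- Let $\rho$ be an $n$-qubit state of rank $r$, let $M=\sum_{\alpha=1}^{N_M}a_\alpha P_\alpha$ with $a_\alpha\in\mathbb R$, $P_\alpha$ tensor products of $n$ Pauli matrices (identity included) and $\sum_\alpha|a_\alpha|\le c$. Let $\|M\|_\infty=\sup_{x\ne0}\|Mx\|_\infty/\|x\|_\infty$, $k\in\mathbb N$, $0<\varepsilon\le\|M\|_\infty$, $\delta\in(0,1)$, $\Lambda=\ln(2k\|M\|_\infty/\varepsilon)$, and let $t=\tilde r_M=\min\{r,\lfloor\Lambda\rfloor\}$ be the effective rank. Assume that $r\le\lfloor\Lambda\rfloor$ or $\Lambda\ge5$. Given numbers $Q_1,\dots,Q_t$ and $Q_{1,M},\dots,Q_{t,M}$, put $b_0=1$, $b_m=\frac1m\sum_{l=1}^m(-1)^{l-1}b_{m-l}Q_l$ for $1\le m\le t$, and $Q_{i,M}=\sum_{l=1}^t(-1)^{l-1}b_lQ_{i-l,M}$ for $i>t$. (1) Sufficiency. If $Q_1=1\ (=\mathrm{Tr}\,\rho)$, $|Q_{j,M}-\mathrm{Tr}(M\rho^j)|<\varepsilon/4$ for $1\le j\le t$ and $|Q_j-\mathrm{Tr}(\rho^j)|<\frac{\varepsilon}{2\|M\|_\infty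 kt\ln t}$ for $2\le j\le t$, then $|Q_{i,M}-\mathrm{Tr}(M\rho^i)|\le\varepsilon$ for all $1\le i\le k$. (2) Resources. There are absolute constants $C,p$ such that suitable estimates are obtained as follows. Circuits consist of layers of operations on disjoint wires, acting on ancilla qubits prepared in $|0\rangle$ and on $j$ registers of $n$ qubits, each holding a copy of $\rho$. The operations are one-qubit gates and CNOTs on ancillas, swaps of two registers controlled by an ancilla (CSWAP), Pauli strings on a register controlled by an ancilla, and measurements of ancillas; later layers may depend on earlier measurement outcomes (classical computation is not counted in the depth). For each $1\le j\le t$ and each $\alpha$ a circuit on $j$ registers is run repeatedly, each run gives a readout $\pm1$, $\hat W_{\alpha,j}$ is the empirical mean of the readouts, and $Q_{j,M}=\sum_\alpha a_\alpha\hat W_{\alpha,j}$. For each $2\le j\le t$ a circuit on $j$ registers is run repeatedly and $Q_j$ is the empirical mean of its readouts; $Q_1=1$. All runs are independent. Each circuit has depth at most $C$, at most $Cj$ ancillas (hence $O(j)$ qubits for fixed $n$) and at most $Cj$ CSWAPs. Circuits, readouts and numbers of runs do not depend on the unknown state $\rho$ of rank $r$. (2a) For each $j$ one can use in total (over all $\alpha$)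 at most $C\frac{c^2N_M}{\varepsilon^2}\max\{1,\ln\frac1\delta\}$ runs for $\mathrm{Tr}(M\rho^j)$ and at most $C\frac{k^2\|M\|_\infty^2}{\varepsilon^2}\Lambda^p\max\{1,\ln\frac1\delta\}$ runs for $\mathrm{Tr}(\rho^j)$ such that each single inequality in the hypothesis of (1) holds with probability at least $1-\delta$, and for each $1\le i\le k$ the estimate satisfies $|Q_{i,M}-\mathrm{Tr}(M\rho^i)|\le\varepsilon$ with probability at least $1-\delta$. (2b) If $\ln\frac1\delta$ is replaced by $\ln\frac t\delta$ in the number of runs for $\mathrm{Tr}(M\rho^j)$ (the other number of runs being as in (2a)), then with probability at least $1-\delta$ all inequalities in the hypothesis of (1) and $|Q_{i,M}-\mathrm{Tr}(M\rho^i)|\le\varepsilon$ for all $1\le i\le k$ hold simultaneously. -/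

import Mathlib

/-! ### Pauli strings, states, norms -/

/-- The four single-qubit Pauli labels. -/
inductive Pauli
  | I
  | X
  | Y
  | Z

/-- The Pauli matrices in the computational basis; `false` is `|0⟩` and `true` is `|1⟩`. -/
noncomputable def Pauli.mat : Pauli → Matrix Bool Bool ℂ
  | .I => fun x y => if x = y then 1 else 0
  | .X => fun x y => if x = y then 0 else 1
  | .Y => fun x y => if x = y then 0 else if x then Complex.I else -Complex.I
  | .Z => fun x y => if x = y then (if x then -1 else 1) else 0

/-- The tensor product `σ_{P 0} ⊗ ⋯ ⊗ σ_{P (n-1)}` acting on `n` qubits. -/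
noncomputable def pauliString {n : ℕ} (P : Fin n → Pauli) :
    Matrix (Fin n → Bool) (Fin n → Bool) ℂ :=
  fun x y => ∏ i, (P i).mat (x i) (y i)

/-- The observable `∑ α, a α • P α`. -/
noncomputable def pauliSum {n N : ℕ} (a : Fin N → ℝ) (P : Fin N → Fin n → Pauli) :
    Matrix (Fin n → Bool) (Fin n → Bool) ℂ :=
  ∑ α, (a α : ℂ) • pauliString (P α)

open scoped ComplexOrder in
/-- `n`-qubit quantum states (density matrices). -/
def IsState {n : ℕ} (ρ : Matrix (Fin n → Bool) (Fin n → Bool) ℂ) : Prop :=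
  ρ.PosSemidef ∧ ρ.trace = 1

/-- `‖M‖_∞ = sup_{x ≠ 0} ‖M x‖_∞ / ‖x‖_∞`, the operator norm with respect to the maximum norm
(which is the norm of the function type `ι → ℂ`). -/
noncomputable def opNormInf {ι : Type*} [Fintype ι] [DecidableEq ι] (M : Matrix ι ι ℂ) : ℝ :=
  ‖LinearMap.toContinuousLinearMap (Matrix.toLin' M)‖

/-- The effective rank for an observable of norm `m`:
`min {r, ⌊ln (2 k m / ε)⌋}`. -/
noncomputable def effRank (r k : ℕ) (m ε : ℝ) : ℕ :=
  min r ⌊Real.log (2 * k * m / ε)⌋₊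

/-! ### Adaptive quantum circuits

A circuit acts on `a` ancilla qubits and on `m` registers of `n` qubits each. -/

/-- Labels of the computational basis of the ancillas and the registers. -/
abbrev Basis (n a m : ℕ) : Type := (Fin a → Bool) × (Fin m → Fin n → Bool)

/-- The elementary operations. -/
inductive Gate (n a m : ℕ)
  /-- an arbitrary one-qubit unitary on an ancilla -/
  | one (q : Fin a) (U : Matrix.unitaryGroup Bool ℂ)
  /-- controlled-NOT between two ancillas -/
  | cnot (c q : Fin a) (h : c ≠ q)
  /-- swap of two registers, controlled by an ancilla -/
  | cswap (c : Fin a) (x y : Fin m) (h : x ≠ y)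
  /-- Pauli string on a register, controlled by an ancilla -/
  | cpauli (c : Fin a) (x : Fin m) (P : Fin n → Pauli)
  /-- measurement of an ancilla in the computational basis -/
  | meas (q : Fin a)

/-- The wires (ancillas and registers) that an operation touches. -/
def Gate.support {n a m : ℕ} : Gate n a m → Finset (Fin a ⊕ Fin m)
  | .one q _ => {.inl q}
  | .cnot c q _ => {.inl c, .inl q}
  | .cswap c x y _ => {.inl c, .inr x, .inr y}
  | .cpauli c x _ => {.inl c, .inr x}
  | .meas q => {.inl q}

/-- The operator of an operation; for a measurement, the projector onto the outcome that `o`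
prescribes for the measured ancilla. -/
noncomputable def Gate.op {n a m : ℕ} (o : Fin a → Bool) :
    Gate n a m → Matrix (Basis n a m) (Basis n a m) ℂ
  | .one q U => fun s s' =>
      if (∀ q', q' ≠ q → s.1 q' = s'.1 q') ∧ s.2 = s'.2 then
        (U : Matrix Bool Bool ℂ) (s.1 q) (s'.1 q) else 0
  | .cnot c q _ => fun s s' =>
      if s = (Function.update s'.1 q (xor (s'.1 q) (s'.1 c)), s'.2) then 1 else 0
  | .cswap c x y _ => fun s s' =>
      if s = (s'.1, if s'.1 c then s'.2 ∘ Equiv.swap x y else s'.2) then 1 else 0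
  | .cpauli c x P => fun s s' =>
      if s.1 = s'.1 ∧ ∀ y, y ≠ x → s.2 y = s'.2 y then
        (if s.1 c then pauliString P (s.2 x) (s'.2 x) else if s.2 x = s'.2 x then 1 else 0)
      else 0
  | .meas q => fun s s' => if s = s' ∧ s.1 q = o q then 1 else 0

/-- Does the operation measure the ancilla `q`? -/
def Gate.Measures {n a m : ℕ} (q : Fin a) : Gate n a m → Prop
  | .meas q' => q' = q
  | _ => False

/-- `1` for a controlled swap and `0` for everything else. -/
def Gate.cswaps {n a m : ℕ} : Gate n a m → ℕ
  | .cswap _ _ _ _ => 1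
  | _ => 0

/-- One time step: operations on pairwise disjoint sets of wires. -/
structure Layer (n a m : ℕ) where
  gates : List (Gate n a m)
  disj : gates.Pairwise fun g h => Disjoint g.support h.support

open Classical in
/-- The Kraus operator of a layer for the outcome record `o`; ancillas which the layer does not
measure are recorded as `false`. -/
noncomputable def Layer.kraus {n a m : ℕ} (L : Layer n a m) (o : Fin a → Bool) :
    Matrix (Basis n a m) (Basis n a m) ℂ :=
  if ∀ q, o q = true → ∃ g ∈ L.gates, g.Measures q then (L.gates.map (Gate.op o)).prod else 0

/-- Circuits of depth `d` with mid-circuit measurements and classical feedback: after each layer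
the rest of the circuit may depend on the outcome record of that layer. -/
inductive Circuit (n a m : ℕ) : ℕ → Type
  | done : Circuit n a m 0
  | step {d : ℕ} (L : Layer n a m) (next : (Fin a → Bool) → Circuit n a m d) :
      Circuit n a m (d + 1)

/-- The Kraus operator of a circuit for a sequence of outcome records. -/
noncomputable def Circuit.kraus {n a m : ℕ} : {d : ℕ} → Circuit n a m d →
    (Fin d → Fin a → Bool) → Matrix (Basis n a m) (Basis n a m) ℂ
  | _, .done, _ => 1
  | _, .step L next, o => (next (o 0)).kraus (Fin.tail o) * L.kraus (o 0)

/-- The largest number of controlled swaps on a branch of the circuit. -/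
def Circuit.cswaps {n a m : ℕ} : {d : ℕ} → Circuit n a m d → ℕ
  | _, .done => 0
  | _, .step L next =>
      (L.gates.map Gate.cswaps).sum + Finset.univ.sup fun o => (next o).cswaps

/-- All ancillas in `|0⟩` and one copy of `ρ` in each register. -/
noncomputable def initState {n : ℕ} (a m : ℕ) (ρ : Matrix (Fin n → Bool) (Fin n → Bool) ℂ) :
    Matrix (Basis n a m) (Basis n a m) ℂ :=
  fun s s' => if (∀ q, s.1 q = false) ∧ (∀ q, s'.1 q = false) then
    ∏ x, ρ (s.2 x) (s'.2 x) else 0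

/-- Born rule: the probability that a run on copies of `ρ` produces the records `o`. -/
noncomputable def Circuit.prob {n a m d : ℕ} (c : Circuit n a m d)
    (ρ : Matrix (Fin n → Bool) (Fin n → Bool) ℂ) (o : Fin d → Fin a → Bool) : ℝ :=
  (c.kraus o * initState a m ρ * (c.kraus o).conjTranspose).trace.re

/-! ### Experiments and the estimation procedure -/

/-- Repeated runs of one circuit on `j` registers, each run with a `±1`-valued readout
(`true` stands for `-1`) and on fresh copies of the state. -/
structure Experiment (n j : ℕ) where
  ancillas : ℕ
  depth : ℕ
  circuit : Circuit n ancillas j depth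
  readout : (Fin depth → Fin ancillas → Bool) → Bool
  runs : ℕ

/-- The outcome records of all the runs. -/
abbrev Experiment.Data {n j : ℕ} (E : Experiment n j) : Type :=
  Fin E.runs → Fin E.depth → Fin E.ancillas → Bool

/-- The probability of the outcome records; the runs are independent. -/
noncomputable def Experiment.prob {n j : ℕ} (E : Experiment n j)
    (ρ : Matrix (Fin n → Bool) (Fin n → Bool) ℂ) (d : E.Data) : ℝ :=
  ∏ s, E.circuit.prob ρ (d s)

/-- The empirical mean of the readouts. -/
noncomputable def Experiment.mean {n j : ℕ} (E : Experiment n j) (d : E.Data) : ℝ :=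
  (∑ s, if E.readout (d s) then (-1 : ℝ) else 1) / E.runs

/-- Constant depth, linearly many ancillas and linearly many controlled swaps. (There are `j`
registers of `n` qubits in addition to the ancillas.) -/
def Experiment.Cheap {n j : ℕ} (E : Experiment n j) (C : ℕ) : Prop :=
  E.depth ≤ C ∧ E.ancillas ≤ C * j ∧ E.circuit.cswaps ≤ C * j

/-- The experiments of an estimation procedure: `obs α j` is run on `j + 1` copies, for the
`α`-th Pauli string and the power `j + 1`; `pow j` is run on `j + 1` copies, for the trace of the
power `j + 1`. -/
structure Procedure (n N t : ℕ) where
  obs : Fin N → (j : Fin t) → Experiment n (j + 1)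
  pow : (j : Fin t) → Experiment n (j + 1)

/-- All outcome records of a procedure. -/
abbrev Procedure.Data {n N t : ℕ} (A : Procedure n N t) : Type :=
  ((α : Fin N) → (j : Fin t) → (A.obs α j).Data) × ((j : Fin t) → (A.pow j).Data)

open Classical in
/-- The probability that the outcome records satisfy `good`; all runs are independent. -/
noncomputable def Procedure.pr {n N t : ℕ} (A : Procedure n N t)
    (ρ : Matrix (Fin n → Bool) (Fin n → Bool) ℂ) (good : A.Data → Prop) : ℝ :=
  ∑ d : A.Data, if good d then
    (∏ α, ∏ j, (A.obs α j).prob ρ (d.1 α j)) * ∏ j, (A.pow j).prob ρ (d.2 j) else 0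

/-- The estimates `Q_{i,M} = ∑ α, a α * W α` of `Tr (M ρ ^ i)` for `1 ≤ i ≤ t`, where `W α` is the
empirical mean for the `α`-th Pauli string. -/
noncomputable def Procedure.estObs {n N t : ℕ} (A : Procedure n N t) (a : Fin N → ℝ)
    (d : A.Data) (i : ℕ) : ℝ :=
  if h : 1 ≤ i ∧ i ≤ t then
    ∑ α, a α * (A.obs α ⟨i - 1, by omega⟩).mean (d.1 α ⟨i - 1, by omega⟩) else 0

/-- The estimates `Q_i` of `Tr (ρ ^ i)` for `1 ≤ i ≤ t`; `Tr ρ = 1` is known. -/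
noncomputable def Procedure.estPow {n N t : ℕ} (A : Procedure n N t)
    (d : A.Data) (i : ℕ) : ℝ :=
  if i = 1 then 1 else
  if h : 1 ≤ i ∧ i ≤ t then (A.pow ⟨i - 1, by omega⟩).mean (d.2 ⟨i - 1, by omega⟩) else 0

/-- The resources: cheap circuits, at most `B` runs for each `Tr (M ρ ^ j)` (counting all the
Pauli strings), and at most `B'` runs for each `Tr (ρ ^ j)`. -/
def Procedure.Resources {n N t : ℕ} (A : Procedure n N t) (C : ℕ) (B B' : ℝ) : Prop :=
  (∀ α j, (A.obs α j).Cheap C) ∧ (∀ j, (A.pow j).Cheap C) ∧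
  (∀ j, ((∑ α, (A.obs α j).runs : ℕ) : ℝ) ≤ B) ∧ (∀ j, ((A.pow j).runs : ℝ) ≤ B')

/-! ### The classical post-processing -/

/-- Newton-Girard: `b 0 = 1` and `b k = (1 / k) ∑_{l = 1}^{k} (-1)^(l-1) b (k - l) Q l`. -/
noncomputable def newtonGirard (Q : ℕ → ℝ) : ℕ → ℝ
  | 0 => 1
  | k + 1 => (1 / ((k : ℝ) + 1)) *
      ∑ l : Fin (k + 1), (-1) ^ (l : ℕ) * newtonGirard Q (k - l) * Q (l + 1)
  decreasing_by omega

/-- The estimates of `Tr (M ρ ^ i)` for all `i ≥ 1`: the given ones `QM i` for `i ≤ t`, and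
`∑_{l = 1}^{t} (-1)^(l-1) b l * (estimate for i - l)` for `i > t`, with `b` obtained from the
estimates `Q` of the traces of powers. -/
noncomputable def extendEst (t : ℕ) (Q QM : ℕ → ℝ) (i : ℕ) : ℝ :=
  if i ≤ t then QM i else
    ∑ l : Fin t, (-1) ^ (l : ℕ) * newtonGirard Q (l + 1) * extendEst t Q QM (i - (l + 1))
  termination_by i
  decreasing_by omega

/-- `q` is within `η` of `Tr (M ρ ^ j)`, strictly. -/
def CloseObs {n : ℕ} (M ρ : Matrix (Fin n → Bool) (Fin n → Bool) ℂ) (j : ℕ) (η q : ℝ) : Prop :=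
  ‖(q : ℂ) - (M * ρ ^ j).trace‖ < η

/-- `q` is within `η` of `Tr (ρ ^ j)`, strictly. -/
def ClosePow {n : ℕ} (ρ : Matrix (Fin n → Bool) (Fin n → Bool) ℂ) (j : ℕ) (η q : ℝ) : Prop :=
  ‖(q : ℂ) - (ρ ^ j).trace‖ < η

/-- The tolerance `ε / (2 ‖M‖_∞ k t ln t)` for the estimates of the traces of powers. -/
noncomputable def powTol (k t : ℕ) (m ε : ℝ) : ℝ := ε / (2 * m * k * t * Real.log t)

/-! Sufficiency. Write Tr(M ρ^i) = ∑ μ_a λ_a^i with λ the eigenvalues of ρ and |μ_a| ≤ ‖M‖_∞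
(`exists_spectral_data`). With B(X) = ∏ (1 - λ_a X) = ∑ (-1)^l e_l X^l, these traces obey the linear
recursion with coefficients ±e_l. The estimates obey it cut off at order t, with the Newton-Girard
numbers b_l in place of e_l. So three errors have to be followed: the initial errors, the errors b_l
- e_l, and the residual of the cut-off. The naive propagation bound would be exponential in the
number of steps. Instead the recursion is solved by multiplying with 1/B = ∑ h_n X^n, and positivity
is used: since λ ≥ 0 and ∑ λ_a = 1, one has 0 ≤ h_n ≤ 1 and e_l ≤ 1/l!. An initial error is
transported by a Schur function of a hook, which lies between 0 and some e_l, so all initial errors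
together are amplified by at most ∑ 1/l! ≤ e - 1. Sources are transported with weight at most 1, and
the missing tail of B feeds back with weight at most e_(t+1) (`abs_coeff_le_of_recursion`). The
residuals of the cut-off sum to at most ‖M‖_∞/t! (`sum_truncation_le`). The quotient of the series
of (-1)^l b_l by B solves a first-order differential equation driven by the errors of the power
sums, which controls b_l - e_l (`sum_abs_newtonGirard_sub_le`). A Gronwall argument combines these
in `abs_extendEst_sub_le`, and `exists_gain` checks that the constants 1/4 and 1/2 of the tolerances
suffice.

Circuits. A cyclic shift is a product of two reflections, and each reflection is a product of
disjoint transpositions, hence one layer. Each transposition has its own control ancilla; no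
entangled ancilla state is prepared. All ancillas start in the uniform superposition and are
measured in the Hadamard basis. The mean parity of the outcomes is the average over x of the
interference terms between the control patterns x and not x. The two patterns select complementary
sets of transpositions, so every term equals Tr(P ρ^j) (`sum_boolSign_mul_trace`,
`trace_swapTestOp_not`).

Statistics. For fixed estimates of the Tr(ρ^j), the final estimate is affine in the estimates of the
Tr(M ρ^j), with coefficients of absolute sum G ≤ 4 and a bias of at most ε - Gε/4
(`exists_affine_response`). Hoeffding's inequality for this one linear combination avoids a union
bound over j (`weightOf_not_extendEst_le`), which is why no ln t appears in the runs for a single i.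
The union bound over the traces of powers costs a ln t that is absorbed by the power of Λ. -/

/-! ### Power series with the eigenvalues as roots -/

/-- The terms of degree at least `m` of a power series. -/
noncomputable def tailSeries (m : ℕ) (f : PowerSeries ℝ) : PowerSeries ℝ :=
  PowerSeries.mk fun n => if m ≤ n then PowerSeries.coeff n f else 0

/-- The geometric series `∑ x ^ n X ^ n`. -/
noncomputable def geomSeries (x : ℝ) : PowerSeries ℝ := PowerSeries.mk fun n => x ^ n

/-- The linear factor `1 - x X`. -/
noncomputable def linFactor (x : ℝ) : PowerSeries ℝ := 1 - PowerSeries.C x * PowerSeries.X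

/-- `∏ (1 - lam a X)`. -/
noncomputable def charSeries {ι : Type*} (s : Finset ι) (lam : ι → ℝ) : PowerSeries ℝ :=
  ∏ a ∈ s, linFactor (lam a)

/-- The generating series of the complete homogeneous symmetric functions. -/
noncomputable def completeSeries {ι : Type*} (s : Finset ι) (lam : ι → ℝ) : PowerSeries ℝ :=
  ∏ a ∈ s, geomSeries (lam a)

/-- The elementary symmetric functions. -/
noncomputable def elemSymm {ι : Type*} (s : Finset ι) (lam : ι → ℝ) (l : ℕ) : ℝ :=
  (-1) ^ l * PowerSeries.coeff l (charSeries s lam)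

/-- The generating series of the Schur functions of hooks. -/
noncomputable def hookSeries {ι : Type*} (s : Finset ι) (lam : ι → ℝ) (m : ℕ) : PowerSeries ℝ :=
  PowerSeries.C ((-1) ^ m) * tailSeries m (charSeries s lam) * completeSeries s lam

section
open PowerSeries

theorem coeff_tailSeries (m n : ℕ) (f : PowerSeries ℝ) :
    coeff n (tailSeries m f) = if m ≤ n then coeff n f else 0 := by
  simp [tailSeries]

theorem coeff_linFactor_mul_zero (x : ℝ) (f : PowerSeries ℝ) :
    coeff 0 (linFactor x * f) = coeff 0 f := by
  simp [linFactor, sub_mul, mul_assoc]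

theorem coeff_linFactor_mul_succ (x : ℝ) (f : PowerSeries ℝ) (n : ℕ) :
    coeff (n + 1) (linFactor x * f) = coeff (n + 1) f - x * coeff n f := by
  simp [linFactor, sub_mul, mul_assoc, coeff_succ_X_mul]

theorem linFactor_mul_geomSeries (x : ℝ) : linFactor x * geomSeries x = 1 := by
  ext n
  cases n with
  | zero => rw [coeff_linFactor_mul_zero]; simp [geomSeries]
  | succ n => rw [coeff_linFactor_mul_succ]; simp [geomSeries, coeff_one, pow_succ']

theorem charSeries_mul_completeSeries {ι : Type*} (s : Finset ι) (lam : ι → ℝ) :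
    charSeries s lam * completeSeries s lam = 1 := by
  rw [charSeries, completeSeries, ← Finset.prod_mul_distrib]
  exact Finset.prod_eq_one fun a _ => linFactor_mul_geomSeries _

theorem tailSeries_zero (f : PowerSeries ℝ) : tailSeries 0 f = f := by
  ext n; simp [coeff_tailSeries]

theorem tailSeries_linFactor_mul (x : ℝ) (f : PowerSeries ℝ) (m : ℕ) :
    tailSeries (m + 1) (linFactor x * f) =
      tailSeries (m + 1) f - C x * X * tailSeries m f := by
  ext n
  cases n with
  | zero =>
    simp only [coeff_tailSeries, map_sub, mul_assoc, coeff_C_mul, coeff_zero_X_mul]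
    simp
  | succ n =>
    simp only [coeff_tailSeries, map_sub, mul_assoc, coeff_C_mul, coeff_succ_X_mul,
      coeff_linFactor_mul_succ, add_le_add_iff_right]
    split_ifs <;> simp

theorem coeff_charSeries {ι : Type*} (s : Finset ι) (lam : ι → ℝ) (l : ℕ) :
    coeff l (charSeries s lam) = (-1) ^ l * elemSymm s lam l := by
  rw [elemSymm, ← mul_assoc, ← mul_pow]; simp

theorem elemSymm_zero {ι : Type*} (s : Finset ι) (lam : ι → ℝ) : elemSymm s lam 0 = 1 := by
  simp only [elemSymm, pow_zero, one_mul, charSeries, coeff_zero_eq_constantCoeff, map_prod]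
  exact Finset.prod_eq_one fun a _ => by simp [linFactor]

theorem elemSymm_empty {ι : Type*} (lam : ι → ℝ) (l : ℕ) : elemSymm ∅ lam (l + 1) = 0 := by
  simp [elemSymm, charSeries, coeff_one]

theorem elemSymm_insert {ι : Type*} [DecidableEq ι] {s : Finset ι} {a : ι} (ha : a ∉ s)
    (lam : ι → ℝ) (l : ℕ) :
    elemSymm (insert a s) lam (l + 1) = elemSymm s lam (l + 1) + lam a * elemSymm s lam l := by
  have : charSeries (insert a s) lam = linFactor (lam a) * charSeries s lam := by
    rw [charSeries, Finset.prod_insert ha]; rfl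
  rw [elemSymm, this, coeff_linFactor_mul_succ, elemSymm, elemSymm]
  ring

theorem elemSymm_nonneg {ι : Type*} (s : Finset ι) (lam : ι → ℝ) (h : ∀ a ∈ s, 0 ≤ lam a) (l : ℕ) :
    0 ≤ elemSymm s lam l := by
  classical
  induction s using Finset.induction_on generalizing l with
  | empty =>
    cases l with
    | zero => simp [elemSymm_zero]
    | succ l => simp [elemSymm_empty]
  | insert a s ha ih =>
    cases l with
    | zero => simp [elemSymm_zero]
    | succ l =>
      rw [elemSymm_insert ha]
      have h' : ∀ b ∈ s, 0 ≤ lam b := fun b hb => h b (Finset.mem_insert_of_mem hb)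
      exact add_nonneg (ih h' _) (mul_nonneg (h a (Finset.mem_insert_self a s)) (ih h' _))

/-- Two terms of the binomial expansion; exactly what the induction on the set of variables in
`elemSymm_le` consumes. -/
theorem pow_succ_add_le_add_pow {x y : ℝ} (hx : 0 ≤ x) (hy : 0 ≤ y) (l : ℕ) :
    x ^ (l + 1) + (l + 1) * y * x ^ l ≤ (x + y) ^ (l + 1) := by
  induction l with
  | zero => simp
  | succ l ih =>
    have h1 : x ^ l * y ^ 2 ≥ 0 := by positivity
    calc _ ≤ (x ^ (l + 1) + (l + 1) * y * x ^ l) * (x + y) := by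
          push_cast
          have : 0 ≤ (l + 1) * (x ^ l * y ^ 2) := by positivity
          ring_nf at this ⊢
          linarith
      _ ≤ (x + y) ^ (l + 1) * (x + y) := by gcongr
      _ = _ := by ring

theorem elemSymm_le {ι : Type*} (s : Finset ι) (lam : ι → ℝ) (h : ∀ a ∈ s, 0 ≤ lam a) (l : ℕ) :
    elemSymm s lam l ≤ (∑ a ∈ s, lam a) ^ l / l.factorial := by
  classical
  induction s using Finset.induction_on generalizing l with
  | empty =>
    cases l with
    | zero => simp [elemSymm_zero]
    | succ l => simp [elemSymm_empty]
  | insert a s ha ih =>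
    cases l with
    | zero => simp [elemSymm_zero]
    | succ l =>
      have h' : ∀ b ∈ s, 0 ≤ lam b := fun b hb => h b (Finset.mem_insert_of_mem hb)
      have h0 := h a (Finset.mem_insert_self a s)
      have hs : 0 ≤ ∑ b ∈ s, lam b := Finset.sum_nonneg h'
      rw [elemSymm_insert ha, Finset.sum_insert ha]
      calc _ ≤ (∑ b ∈ s, lam b) ^ (l + 1) / (l + 1).factorial
            + lam a * ((∑ b ∈ s, lam b) ^ l / l.factorial) := by
            gcongr
            · exact ih h' _
            · exact ih h' _
        _ = ((∑ b ∈ s, lam b) ^ (l + 1) + (l + 1) * lam a * (∑ b ∈ s, lam b) ^ l)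
              / (l + 1).factorial := by
            rw [Nat.factorial_succ]; push_cast; field_simp
        _ ≤ _ := by
            rw [add_comm (lam a)]
            gcongr
            exact pow_succ_add_le_add_pow hs h0 l

theorem coeff_completeSeries_nonneg {ι : Type*} (s : Finset ι) (lam : ι → ℝ)
    (h : ∀ a ∈ s, 0 ≤ lam a) (n : ℕ) : 0 ≤ coeff n (completeSeries s lam) := by
  classical
  induction s using Finset.induction_on generalizing n with
  | empty => simp only [completeSeries, Finset.prod_empty, coeff_one]; split_ifs <;> simp
  | insert a s ha ih =>
    rw [completeSeries, Finset.prod_insert ha, coeff_mul]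
    refine Finset.sum_nonneg fun p _ => mul_nonneg ?_
      (ih (fun b hb => h b (Finset.mem_insert_of_mem hb)) _)
    simpa [geomSeries] using pow_nonneg (h a (Finset.mem_insert_self a s)) _

/-- Every monomial of h_n occurs in the expansion of (∑ λ)^n. The induction uses h_(n+1)(s ∪ a) =
h_(n+1)(s) + λ_a h_n(s ∪ a). -/
theorem coeff_completeSeries_le {ι : Type*} (s : Finset ι) (lam : ι → ℝ)
    (h : ∀ a ∈ s, 0 ≤ lam a) (n : ℕ) :
    coeff n (completeSeries s lam) ≤ (∑ a ∈ s, lam a) ^ n := by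
  classical
  induction s using Finset.induction_on generalizing n with
  | empty => cases n <;> simp [completeSeries, coeff_one]
  | insert a s ha ih =>
    have h' : ∀ b ∈ s, 0 ≤ lam b := fun b hb => h b (Finset.mem_insert_of_mem hb)
    have h0 := h a (Finset.mem_insert_self a s)
    rw [completeSeries, Finset.prod_insert ha, Finset.sum_insert ha]
    change coeff n (geomSeries (lam a) * completeSeries s lam) ≤ _
    induction n with
    | zero => simpa [coeff_mul, geomSeries] using ih h' 0
    | succ n ihn =>
      have e : geomSeries (lam a) * completeSeries s lam = completeSeries s lam
          + C (lam a) * X * (geomSeries (lam a) * completeSeries s lam) := by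
        have := linFactor_mul_geomSeries (lam a)
        simp only [linFactor] at this
        linear_combination (completeSeries s lam) * this
      rw [e, map_add, mul_assoc, coeff_C_mul, coeff_succ_X_mul]
      have hs : 0 ≤ ∑ b ∈ s, lam b := Finset.sum_nonneg h'
      calc _ ≤ (∑ b ∈ s, lam b) ^ (n + 1) + lam a * (lam a + ∑ b ∈ s, lam b) ^ n := by
            gcongr; exact ih h' _
        _ ≤ (∑ b ∈ s, lam b) * (lam a + ∑ b ∈ s, lam b) ^ n
              + lam a * (lam a + ∑ b ∈ s, lam b) ^ n := by
            rw [pow_succ']; gcongr; linarith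
        _ = _ := by ring

theorem hookSeries_zero {ι : Type*} (s : Finset ι) (lam : ι → ℝ) : hookSeries s lam 0 = 1 := by
  rw [hookSeries, tailSeries_zero]
  simp [charSeries_mul_completeSeries]

/-- Schur positivity of hooks, by adding one variable at a time: the new series is a geometric
series times a combination of old hook series in which no signs are left. -/
theorem coeff_hookSeries_nonneg {ι : Type*} (s : Finset ι) (lam : ι → ℝ)
    (h : ∀ a ∈ s, 0 ≤ lam a) (m n : ℕ) : 0 ≤ coeff n (hookSeries s lam m) := by
  classical
  have h1 : ∀ n, 0 ≤ coeff n (1 : PowerSeries ℝ) := fun n => by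
    rw [coeff_one]; split_ifs <;> simp
  induction s using Finset.induction_on generalizing m n with
  | empty =>
    cases m with
    | zero => rw [hookSeries_zero]; exact h1 n
    | succ m =>
      have : tailSeries (m + 1) (charSeries ∅ lam) = 0 := by
        ext i
        rw [coeff_tailSeries]
        split_ifs with hi
        · simp [charSeries, coeff_one, show i ≠ 0 by omega]
        · simp
      simp [hookSeries, this]
  | insert a s ha ih =>
    have h' : ∀ b ∈ s, 0 ≤ lam b := fun b hb => h b (Finset.mem_insert_of_mem hb)
    have h0 := h a (Finset.mem_insert_self a s)
    cases m with
    | zero => rw [hookSeries_zero]; exact h1 n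
    | succ m =>
      have e : hookSeries (insert a s) lam (m + 1) = geomSeries (lam a) *
          (hookSeries s lam (m + 1) + C (lam a) * (X * hookSeries s lam m)) := by
        have e1 : charSeries (insert a s) lam = linFactor (lam a) * charSeries s lam := by
          rw [charSeries, Finset.prod_insert ha]; rfl
        have e2 : completeSeries (insert a s) lam
            = geomSeries (lam a) * completeSeries s lam := by
          rw [completeSeries, Finset.prod_insert ha]; rfl
        simp only [hookSeries, e1, e2, tailSeries_linFactor_mul, pow_succ, map_mul, map_neg,
          map_one]
        ring
      rw [e, coeff_mul]
      refine Finset.sum_nonneg fun p _ => mul_nonneg ?_ ?_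
      · simpa [geomSeries] using pow_nonneg h0 _
      · rw [map_add, coeff_C_mul]
        refine add_nonneg (ih h' _ _) (mul_nonneg h0 ?_)
        cases p.2 with
        | zero => simp
        | succ i => rw [coeff_succ_X_mul]; exact ih h' _ _

/-- Pieri's rule: e_m h_(n-m) is the sum of two adjacent hook functions. Both are nonnegative, and h
≤ 1 because the variables sum to 1. -/
theorem coeff_hookSeries_le {ι : Type*} (s : Finset ι) (lam : ι → ℝ)
    (h : ∀ a ∈ s, 0 ≤ lam a) (hsum : ∑ a ∈ s, lam a = 1) (m n : ℕ) :
    coeff n (hookSeries s lam m) ≤ elemSymm s lam m := by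
  -- Splitting off the lowest term of the tail is Pieri's rule at the level of generating series.
  have e : tailSeries m (charSeries s lam) = C ((-1) ^ m * elemSymm s lam m) * X ^ m
      + tailSeries (m + 1) (charSeries s lam) := by
    ext i
    rw [map_add, coeff_C_mul, coeff_X_pow, coeff_tailSeries, coeff_tailSeries, coeff_charSeries]
    rcases lt_trichotomy i m with h | h | h
    · simp [show ¬ m ≤ i by omega, show ¬ m + 1 ≤ i by omega, h.ne]
    · subst h; simp
    · simp [h.le, show m + 1 ≤ i by omega, h.ne']
  have e2 : hookSeries s lam m = C (elemSymm s lam m) * (X ^ m * completeSeries s lam)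
      - hookSeries s lam (m + 1) := by
    rw [hookSeries, e, hookSeries]
    have : (C ((-1) ^ m) * C ((-1) ^ m) : PowerSeries ℝ) = 1 := by
      rw [← map_mul, ← mul_pow]; simp
    simp only [map_mul, pow_succ, map_neg, map_one]
    linear_combination (C (elemSymm s lam m) * X ^ m * completeSeries s lam) * this
  rw [e2, map_sub, coeff_C_mul, coeff_X_pow_mul']
  have h1 := coeff_hookSeries_nonneg s lam h (m + 1) n
  have h2 := elemSymm_nonneg s lam h m
  split_ifs
  · have := coeff_completeSeries_le s lam h (n - m)
    rw [hsum, one_pow] at this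
    nlinarith
  · linarith

end

/-! ### Propagation of errors by the recursion -/

section
open PowerSeries Finset

theorem sum_Icc_one_eq_sum_range (f : ℕ → ℝ) (t : ℕ) :
    ∑ l ∈ Icc 1 t, f l = ∑ x ∈ range t, f (x + 1) := by
  have : Icc 1 t = (range t).image (· + 1) := by
    ext x; simp only [mem_Icc, mem_image, mem_range]
    exact ⟨fun h => ⟨x - 1, by omega, by omega⟩, by rintro ⟨y, hy, rfl⟩; omega⟩
  rw [this, Finset.sum_image (by simp)]

theorem elemSymm_one {ι : Type*} (s : Finset ι) (lam : ι → ℝ) :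
    elemSymm s lam 1 = ∑ a ∈ s, lam a := by
  classical
  induction s using Finset.induction_on with
  | empty => simp [elemSymm_empty]
  | insert a s ha ih =>
    rw [elemSymm_insert ha, ih, elemSymm_zero, Finset.sum_insert ha]
    ring

/-- The residual of the truncated recursion on one eigenvalue. Multiplication by the geometric
series of λ_a cancels the factor 1 - λ_a X, so the partial sum is a coefficient of the product over
the other eigenvalues. -/
theorem sum_charSeries_mul_pow {ι : Type*} [DecidableEq ι] {s : Finset ι} {a : ι} (ha : a ∈ s)
    (lam : ι → ℝ) (t : ℕ) :
    ∑ l ∈ range (t + 1), coeff l (charSeries s lam) * lam a ^ (t - l)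
      = (-1) ^ t * elemSymm (s.erase a) lam t := by
  have e : charSeries s lam * geomSeries (lam a) = charSeries (s.erase a) lam := by
    have : charSeries s lam = linFactor (lam a) * charSeries (s.erase a) lam := by
      rw [charSeries, ← Finset.mul_prod_erase s _ ha]; rfl
    rw [this]
    linear_combination (charSeries (s.erase a) lam) * linFactor_mul_geomSeries (lam a)
  rw [← coeff_charSeries, ← e, coeff_mul, Finset.Nat.sum_antidiagonal_eq_sum_range_succ
    (fun i j => coeff i (charSeries s lam) * coeff j (geomSeries (lam a)))]
  simp [geomSeries]

theorem mul_elemSymm_erase_le {ι : Type*} [DecidableEq ι] {s : Finset ι} {a : ι} (ha : a ∈ s)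
    (lam : ι → ℝ) (h : ∀ a ∈ s, 0 ≤ lam a) (t : ℕ) :
    lam a * elemSymm (s.erase a) lam t ≤ elemSymm s lam (t + 1) := by
  conv_rhs => rw [← Finset.insert_erase ha]
  rw [elemSymm_insert (Finset.notMem_erase a s)]
  have := elemSymm_nonneg (s.erase a) lam (fun b hb => h b (Finset.mem_of_mem_erase hb)) (t + 1)
  linarith

theorem one_sub_mul_sum_pow_le {x : ℝ} (h0 : 0 ≤ x) (N : ℕ) :
    (1 - x) * ∑ n ∈ range N, x ^ (n + 1) ≤ x := by
  have : (1 - x) * ∑ n ∈ range N, x ^ (n + 1) = x - x ^ (N + 1) := by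
    induction N with
    | zero => simp
    | succ N ih => rw [Finset.sum_range_succ, mul_add, ih]; ring
  rw [this]
  have := pow_nonneg h0 (N + 1)
  linarith

/-- The residuals are summed over all steps rather than bounded one by one, so the number of steps
does not enter. If e_(t+1) = 0 every residual vanishes. Otherwise e_t of the other eigenvalues is at
most (1 - λ_a)^t / t!, and the geometric series in λ_a costs only one factor 1 - λ_a. -/
theorem sum_truncation_le {ι : Type*} [DecidableEq ι] (s : Finset ι) (lam mu : ι → ℝ)
    (h : ∀ a ∈ s, 0 ≤ lam a) (hsum : ∑ a ∈ s, lam a = 1) {m τ : ℝ} (hm : ∀ a ∈ s, |mu a| ≤ m)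
    {t : ℕ} (ht : 1 ≤ t) (hτ : elemSymm s lam (t + 1) = 0 ∧ 0 ≤ τ ∨ 1 / (t.factorial : ℝ) ≤ τ)
    (hm0 : 0 ≤ m) (N : ℕ) :
    ∑ q ∈ range N, |∑ l ∈ range (t + 1), coeff l (charSeries s lam) *
      ∑ a ∈ s, mu a * lam a ^ (t + 1 + q - l)| ≤ τ * m := by
  have e1 : ∀ q, ∑ l ∈ range (t + 1), coeff l (charSeries s lam) *
      ∑ a ∈ s, mu a * lam a ^ (t + 1 + q - l)
      = ∑ a ∈ s, mu a * lam a ^ (q + 1) * ((-1) ^ t * elemSymm (s.erase a) lam t) := by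
    intro q
    simp_rw [Finset.mul_sum]
    rw [Finset.sum_comm]
    refine Finset.sum_congr rfl fun a ha => ?_
    rw [← sum_charSeries_mul_pow ha, Finset.mul_sum]
    refine Finset.sum_congr rfl fun l hl => ?_
    have : t + 1 + q - l = (q + 1) + (t - l) := by
      have := Finset.mem_range.1 hl; omega
    rw [this, pow_add]; ring
  have hes : ∀ a ∈ s, 0 ≤ elemSymm (s.erase a) lam t := fun a _ =>
    elemSymm_nonneg _ _ (fun b hb => h b (Finset.mem_of_mem_erase hb)) _
  have e2 : ∀ q, |∑ l ∈ range (t + 1), coeff l (charSeries s lam) *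
      ∑ a ∈ s, mu a * lam a ^ (t + 1 + q - l)|
      ≤ ∑ a ∈ s, m * (lam a ^ (q + 1) * elemSymm (s.erase a) lam t) := by
    intro q
    rw [e1]
    refine (Finset.abs_sum_le_sum_abs _ _).trans (Finset.sum_le_sum fun a ha => ?_)
    rw [abs_mul, abs_mul, abs_mul, abs_pow, abs_pow, abs_neg, abs_one, one_pow, one_mul,
      abs_of_nonneg (h a ha), abs_of_nonneg (hes a ha), mul_assoc]
    have := pow_nonneg (h a ha) (q + 1)
    have := hes a ha
    gcongr
    exact hm a ha
  refine (Finset.sum_le_sum fun q _ => e2 q).trans ?_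
  rw [Finset.sum_comm]
  have hτ0 : 0 ≤ τ := by
    rcases hτ with h | h
    · exact h.2
    · exact le_trans (by positivity) h
  have e3 : ∀ a ∈ s, ∑ q ∈ range N, m * (lam a ^ (q + 1) * elemSymm (s.erase a) lam t)
      ≤ m * (lam a * τ) := by
    intro a ha
    rw [← Finset.mul_sum, ← Finset.sum_mul]
    refine mul_le_mul_of_nonneg_left ?_ hm0
    have hx := h a ha
    rcases hτ with ⟨h1, _⟩ | h1
    · have h2 : lam a * elemSymm (s.erase a) lam t = 0 :=
        le_antisymm ((mul_elemSymm_erase_le ha lam h t).trans h1.le) (mul_nonneg hx (hes a ha))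
      have : (∑ q ∈ range N, lam a ^ (q + 1)) * elemSymm (s.erase a) lam t = 0 := by
        rw [Finset.sum_mul]
        refine Finset.sum_eq_zero fun q _ => ?_
        rw [pow_succ, mul_assoc, h2, mul_zero]
      rw [this]; exact mul_nonneg hx hτ0
    · have h3 : ∑ b ∈ s.erase a, lam b = 1 - lam a := by
        rw [← hsum, ← Finset.add_sum_erase s lam ha]; ring
      have h4 : 0 ≤ 1 - lam a := by
        rw [← h3]; exact Finset.sum_nonneg fun b hb => h b (Finset.mem_of_mem_erase hb)
      have h5 := elemSymm_le (s.erase a) lam (fun b hb => h b (Finset.mem_of_mem_erase hb)) t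
      rw [h3] at h5
      have hS : 0 ≤ ∑ q ∈ range N, lam a ^ (q + 1) := Finset.sum_nonneg fun q _ => pow_nonneg hx _
      -- One factor 1 - λ_a pays for the geometric series, which needs t ≥ 1; the remaining λ_a is
      -- summed to 1 over the eigenvalues.
      calc _ ≤ (∑ q ∈ range N, lam a ^ (q + 1)) * ((1 - lam a) ^ t / t.factorial) := by gcongr
        _ = ((1 - lam a) * ∑ q ∈ range N, lam a ^ (q + 1))
              * ((1 - lam a) ^ (t - 1) * (1 / t.factorial)) := by
            obtain ⟨t, rfl⟩ : ∃ t', t = t' + 1 := ⟨t - 1, by omega⟩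
            simp only [add_tsub_cancel_right, pow_succ]; ring
        _ ≤ lam a * (1 * τ) := by
            gcongr
            · exact one_sub_mul_sum_pow_le hx N
            · exact pow_le_one₀ h4 (by linarith)
        _ = _ := by ring
  refine (Finset.sum_le_sum e3).trans ?_
  rw [← Finset.mul_sum, ← Finset.sum_mul, hsum]
  linarith

/-- Discrete Duhamel formula for the recursion with characteristic series `charSeries`. -/
theorem abs_coeff_le_of_recursion {ι : Type*} (s : Finset ι) (lam : ι → ℝ)
    (h : ∀ a ∈ s, 0 ≤ lam a) (hsum : ∑ a ∈ s, lam a = 1) {t : ℕ} (E W : PowerSeries ℝ)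
    (hE : coeff 0 E = 0) {e0 : ℝ} (he0 : ∀ j ∈ Icc 1 t, |coeff j E| ≤ e0)
    (hW : ∀ q, t < q → coeff q (charSeries s lam * E)
      = coeff q W + coeff q (tailSeries (t + 1) (charSeries s lam) * E)) {i : ℕ} (hi : t < i) :
    |coeff i E| ≤ (∑ l ∈ Icc 1 t, elemSymm s lam l) * e0
      + ∑ q ∈ range (i - t), |coeff (t + 1 + q) W|
      + elemSymm s lam (t + 1) * ∑ q ∈ range i, |coeff q E| := by
  set B := charSeries s lam with hB
  set H := completeSeries s lam with hH
  have hBH : B * H = 1 := charSeries_mul_completeSeries s lam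
  set T := tailSeries (t + 1) B with hT
  -- In degrees up to t the product B E involves only the given errors E_1, ..., E_t; each E_j meets
  -- the terms of B of degree at most t - j.
  have hlow : B * E - tailSeries (t + 1) (B * E)
      = ∑ j ∈ Icc 1 t, C (coeff j E) * (X ^ j * (B - tailSeries (t + 1 - j) B)) := by
    ext q
    rw [map_sub, coeff_tailSeries, map_sum]
    simp only [coeff_C_mul, coeff_X_pow_mul', map_sub, coeff_tailSeries]
    by_cases hq : t + 1 ≤ q
    · rw [if_pos hq, sub_self]
      symm
      refine Finset.sum_eq_zero fun j hj => ?_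
      have := Finset.mem_Icc.1 hj
      rw [if_pos (by omega), if_pos (by omega)]; simp
    · rw [if_neg hq, sub_zero, mul_comm, coeff_mul,
        Finset.Nat.sum_antidiagonal_eq_sum_range_succ (fun i j => coeff i E * coeff j B),
        Finset.sum_range_succ', hE, zero_mul, add_zero]
      rw [sum_Icc_one_eq_sum_range]
      refine Finset.sum_subset_zero_on_sdiff (fun x hx => ?_) (fun x hx => ?_) (fun x hx => ?_)
      · simp only [mem_range] at hx ⊢; omega
      · simp only [mem_sdiff, mem_range] at hx
        rw [if_neg (by omega), mul_zero]
      · have := Finset.mem_range.1 hx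
        rw [if_pos (by omega), if_neg (by omega), sub_zero]
  have htail : tailSeries (t + 1) (B * E) = tailSeries (t + 1) W + T * E := by
    ext q
    rw [map_add, coeff_tailSeries, coeff_tailSeries]
    split_ifs with hq
    · exact hW q (by omega)
    · symm
      rw [zero_add, coeff_mul]
      refine Finset.sum_eq_zero fun p hp => ?_
      have := Finset.HasAntidiagonal.mem_antidiagonal.1 hp
      rw [hT, coeff_tailSeries, if_neg (by omega), zero_mul]
  -- Multiplication by H = 1/B. The truncated B becomes 1 minus a tail of B times H, and such a tail
  -- times H is a hook series up to sign.
  have hmain : E = ∑ j ∈ Icc 1 t, C (coeff j E) * (X ^ j *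
        (1 - C ((-1) ^ (t + 1 - j)) * hookSeries s lam (t + 1 - j)))
      + H * tailSeries (t + 1) W + C ((-1) ^ (t + 1)) * (hookSeries s lam (t + 1) * E) := by
    have hsq : ∀ m, (C ((-1) ^ m) * C ((-1) ^ m) : PowerSeries ℝ) = 1 := fun m => by
      rw [← map_mul, ← mul_pow]; simp
    have e1 : ∀ m, C ((-1) ^ m) * hookSeries s lam m = tailSeries m B * H := fun m => by
      rw [hookSeries]
      linear_combination (tailSeries m B * H) * hsq m
    have e2 : E = H * (B * E - tailSeries (t + 1) (B * E)) + H * tailSeries (t + 1) (B * E) := by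
      linear_combination (-E) * hBH
    rw [hlow, htail] at e2
    conv_lhs => rw [e2]
    rw [← mul_assoc, e1, mul_add, ← add_assoc, Finset.mul_sum]
    congr 1
    · congr 1
      refine Finset.sum_congr rfl fun j _ => ?_
      rw [e1]
      linear_combination (C (coeff j E) * X ^ j) * hBH
    · ring
  -- As i > t ≥ j, the constant 1 does not contribute in degree i - j, and only the hook function
  -- remains.
  have h1 : coeff i E = (∑ j ∈ Icc 1 t, coeff j E *
        -((-1) ^ (t + 1 - j) * coeff (i - j) (hookSeries s lam (t + 1 - j))))
      + coeff i (H * tailSeries (t + 1) W)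
      + (-1) ^ (t + 1) * coeff i (hookSeries s lam (t + 1) * E) := by
    conv_lhs => rw [hmain]
    rw [map_add, map_add, map_sum, coeff_C_mul]
    congr 2
    refine Finset.sum_congr rfl fun j hj => ?_
    have := Finset.mem_Icc.1 hj
    rw [coeff_C_mul, coeff_X_pow_mul', if_pos (by omega), map_sub, coeff_C_mul, coeff_one,
      if_neg (by omega), zero_sub]
  rw [h1]
  refine (abs_add_le _ _).trans (add_le_add ((abs_add_le _ _).trans (add_le_add ?_ ?_)) ?_)
  · refine (Finset.abs_sum_le_sum_abs _ _).trans ?_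
    have : ∑ l ∈ Icc 1 t, elemSymm s lam l = ∑ j ∈ Icc 1 t, elemSymm s lam (t + 1 - j) := by
      refine Finset.sum_bij' (fun l _ => t + 1 - l) (fun l _ => t + 1 - l) ?_ ?_ ?_ ?_ ?_ <;>
        simp only [mem_Icc] <;> intros <;> first | omega | (congr 1; omega)
    rw [this, Finset.sum_mul]
    refine Finset.sum_le_sum fun j hj => ?_
    rw [abs_mul, abs_neg, abs_mul, abs_pow, abs_neg, abs_one, one_pow, one_mul,
      abs_of_nonneg (coeff_hookSeries_nonneg s lam h _ _), mul_comm]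
    exact mul_le_mul (coeff_hookSeries_le s lam h hsum _ _) (he0 j hj) (abs_nonneg _)
      (elemSymm_nonneg s lam h _)
  · rw [coeff_mul, Finset.Nat.sum_antidiagonal_eq_sum_range_succ
      (fun p q => coeff p H * coeff q (tailSeries (t + 1) W))]
    refine (Finset.abs_sum_le_sum_abs _ _).trans ?_
    rw [← Finset.sum_range_reflect]
    have : ∀ j ∈ range (i + 1), |coeff (i + 1 - 1 - j) H *
        coeff (i - (i + 1 - 1 - j)) (tailSeries (t + 1) W)| ≤
        if t + 1 ≤ j then |coeff j W| else 0 := by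
      intro j hj
      have := Finset.mem_range.1 hj
      rw [show i - (i + 1 - 1 - j) = j by omega, coeff_tailSeries]
      split_ifs
      · rw [abs_mul, abs_of_nonneg (coeff_completeSeries_nonneg s lam h _)]
        have h2 := coeff_completeSeries_le s lam h (i + 1 - 1 - j)
        rw [hsum, one_pow] at h2
        exact mul_le_of_le_one_left (abs_nonneg _) h2
      · simp
    refine (Finset.sum_le_sum this).trans ?_
    rw [show i + 1 = (t + 1) + (i - t) by omega, Finset.sum_range_add]
    refine le_of_eq ?_
    rw [Finset.sum_eq_zero, zero_add]
    · exact Finset.sum_congr rfl fun q _ => if_pos (by omega)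
    · intro q hq; have := Finset.mem_range.1 hq; exact if_neg (by omega)
  · rw [abs_mul, abs_pow, abs_neg, abs_one, one_pow, one_mul, coeff_mul, mul_comm,
      Finset.Nat.sum_antidiagonal_eq_sum_range_succ
      (fun p q => coeff p (hookSeries s lam (t + 1)) * coeff q E)]
    refine (Finset.abs_sum_le_sum_abs _ _).trans ?_
    rw [Finset.sum_range_succ', ← Finset.sum_range_reflect]
    -- The hook series starts in positive degree, so the feedback into E_i contains only E_q with q
    -- < i.
    have h0 : coeff 0 (hookSeries s lam (t + 1)) = 0 := by
      simp [hookSeries, coeff_mul, coeff_tailSeries]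
    rw [h0, zero_mul, abs_zero, add_zero, Finset.sum_mul]
    refine Finset.sum_le_sum fun q hq => ?_
    have := Finset.mem_range.1 hq
    rw [abs_mul, abs_of_nonneg (coeff_hookSeries_nonneg s lam h _ _), mul_comm,
      show i - (i - 1 - q + 1) = q by omega]
    exact mul_le_mul_of_nonneg_left (coeff_hookSeries_le s lam h hsum _ _) (abs_nonneg _)

end

/-! ### Gronwall estimate and perturbation of the recursion coefficients. -/

section
open PowerSeries Finset

/-- Discrete Gronwall: the geometric sum of the growth factor 1 + D + e telescopes against its
increment D + e. -/
theorem le_mul_pow_of_recursion {x w : ℕ → ℝ} (hw : ∀ l, 0 ≤ w l)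
    {A D e : ℝ} (hA : 0 ≤ A) (he : 0 ≤ e) {t k : ℕ} (hD : ∑ l ∈ Icc 1 t, w l ≤ D)
    (h : ∀ i ≤ k, x i ≤ A + ∑ q ∈ range (i - t), ∑ l ∈ Icc 1 t, w l * x (t + 1 + q - l)
      + e * ∑ q ∈ range i, x q) :
    ∀ i ≤ k, x i ≤ A * (1 + D + e) ^ i := by
  have hD0 : 0 ≤ D := (Finset.sum_nonneg fun l _ => hw l).trans hD
  have hc : 1 ≤ 1 + D + e := by linarith
  intro i
  induction i using Nat.strong_induction_on with
  | _ i ih =>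
    intro hi
    have h1 : ∑ q ∈ range i, x q ≤ A * ∑ q ∈ range i, (1 + D + e) ^ q := by
      rw [Finset.mul_sum]
      exact Finset.sum_le_sum fun q hq => ih q (Finset.mem_range.1 hq)
        ((Finset.mem_range.1 hq).le.trans hi)
    have h2 : ∑ q ∈ range (i - t), ∑ l ∈ Icc 1 t, w l * x (t + 1 + q - l)
        ≤ D * (A * ∑ q ∈ range i, (1 + D + e) ^ q) := by
      -- Since l ≥ 1, the indices on the left are at most t + q < i. The shift by t makes the sum
      -- over q a part of the geometric sum over all indices below i.
      have : ∀ q ∈ range (i - t), ∑ l ∈ Icc 1 t, w l * x (t + 1 + q - l)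
          ≤ D * (A * (1 + D + e) ^ (t + q)) := by
        intro q hq
        have hq := Finset.mem_range.1 hq
        have : ∀ l ∈ Icc 1 t, w l * x (t + 1 + q - l) ≤ w l * (A * (1 + D + e) ^ (t + q)) := by
          intro l hl
          have hl := Finset.mem_Icc.1 hl
          refine mul_le_mul_of_nonneg_left ((ih _ (by omega) (by omega)).trans ?_) (hw l)
          exact mul_le_mul_of_nonneg_left (pow_le_pow_right₀ hc (by omega)) hA
        refine (Finset.sum_le_sum this).trans ?_
        rw [← Finset.sum_mul]
        gcongr
      refine (Finset.sum_le_sum this).trans ?_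
      rw [← Finset.mul_sum, ← Finset.mul_sum]
      gcongr
      rcases le_total i t with hit | hit
      · rw [Nat.sub_eq_zero_of_le hit]; simp only [range_zero, sum_empty]; positivity
      · conv_rhs => rw [show i = t + (i - t) by omega, Finset.sum_range_add]
        have : 0 ≤ ∑ q ∈ range t, (1 + D + e) ^ q := by positivity
        linarith
    have h3 := geom_sum_mul (1 + D + e) i
    calc x i ≤ A + D * (A * ∑ q ∈ range i, (1 + D + e) ^ q)
          + e * (A * ∑ q ∈ range i, (1 + D + e) ^ q) :=
          (h i hi).trans (add_le_add (add_le_add le_rfl h2) (mul_le_mul_of_nonneg_left h1 he))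
      _ = A + A * ((∑ q ∈ range i, (1 + D + e) ^ q) * ((1 + D + e) - 1)) := by ring
      _ = _ := by rw [h3]; ring

theorem extendEst_of_le {t i : ℕ} (h : i ≤ t) (Q QM : ℕ → ℝ) : extendEst t Q QM i = QM i := by
  rw [extendEst, if_pos h]

theorem extendEst_of_lt {t i : ℕ} (h : t < i) (Q QM : ℕ → ℝ) :
    extendEst t Q QM i = ∑ l ∈ range t,
      (-1) ^ l * newtonGirard Q (l + 1) * extendEst t Q QM (i - (l + 1)) := by
  rw [extendEst, if_neg (by omega), Finset.sum_range]

theorem newtonGirard_zero (Q : ℕ → ℝ) : newtonGirard Q 0 = 1 := by rw [newtonGirard]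

theorem newtonGirard_succ (Q : ℕ → ℝ) (k : ℕ) :
    ((k : ℝ) + 1) * newtonGirard Q (k + 1)
      = ∑ l ∈ range (k + 1), (-1) ^ l * newtonGirard Q (k - l) * Q (l + 1) := by
  rw [newtonGirard, Finset.sum_range, ← mul_assoc, mul_one_div_cancel (by positivity), one_mul]

/-- The errors satisfy the exact recursion up to a source. It consists of the coefficient errors
applied to the estimates, which are split into true value (at most m) plus error, and of the
truncation residual. The first part is bounded per step, hence the factor k; the second is summed
over all steps. -/
theorem abs_extendEst_sub_le {ι : Type*} (s : Finset ι) (lam mu : ι → ℝ)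
    (h : ∀ a ∈ s, 0 ≤ lam a) (hsum : ∑ a ∈ s, lam a = 1) {m : ℝ} (hm0 : 0 ≤ m)
    (hm : ∀ a ∈ s, |mu a| ≤ m) {t : ℕ} (ht : 1 ≤ t) (Q QM : ℕ → ℝ) {e0 : ℝ}
    (he0 : ∀ j, 1 ≤ j → j ≤ t → |QM j - ∑ a ∈ s, mu a * lam a ^ j| ≤ e0)
    {D G τ : ℝ} (hG : ∑ l ∈ Icc 1 t, elemSymm s lam l ≤ G)
    (hD : ∑ l ∈ Icc 1 t, |newtonGirard Q l - elemSymm s lam l| ≤ D)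
    (hτ : elemSymm s lam (t + 1) = 0 ∧ 0 ≤ τ ∨ 1 / (t.factorial : ℝ) ≤ τ)
    {i k : ℕ} (hi : 1 ≤ i) (hik : i ≤ k) :
    |extendEst t Q QM i - ∑ a ∈ s, mu a * lam a ^ i|
      ≤ (G * e0 + (τ + k * D) * m) * (1 + D + elemSymm s lam (t + 1)) ^ k := by
  classical
  set S := extendEst t Q QM with hS
  set T : ℕ → ℝ := fun j => ∑ a ∈ s, mu a * lam a ^ j with hT
  set d : ℕ → ℝ := fun l => (-1) ^ l * (newtonGirard Q l - elemSymm s lam l) with hd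
  -- Degree 0 is set to 0: for q > t the recursion reaches only the indices q - l ≥ 1.
  set E : PowerSeries ℝ := PowerSeries.mk fun j => if j = 0 then 0 else S j - T j with hE
  have cE : ∀ j, 1 ≤ j → coeff j E = S j - T j := fun j hj => by
    rw [hE, coeff_mk, if_neg (by omega)]
  have cE0 : coeff 0 E = 0 := by rw [hE, coeff_mk, if_pos rfl]
  have he00 : 0 ≤ e0 := (abs_nonneg _).trans (he0 1 le_rfl ht)
  have hD0 : 0 ≤ D := (Finset.sum_nonneg fun l _ => abs_nonneg _).trans hD
  have hτ0 : 0 ≤ τ := by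
    rcases hτ with h | h
    · exact h.2
    · exact le_trans (by positivity) h
  have hel := elemSymm_nonneg s lam h
  have hG0 : 1 ≤ G := by
    refine le_trans ?_ hG
    rw [← hsum, ← elemSymm_one s lam]
    exact Finset.single_le_sum (f := fun l => elemSymm s lam l) (fun l _ => hel l)
      (Finset.mem_Icc.2 ⟨le_rfl, ht⟩)
  have hTm : ∀ j, 1 ≤ j → |T j| ≤ m := by
    intro j hj
    refine (Finset.abs_sum_le_sum_abs _ _).trans ?_
    calc _ ≤ ∑ a ∈ s, m * lam a := Finset.sum_le_sum fun a ha => by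
          have h1 : lam a ≤ 1 := hsum ▸ Finset.single_le_sum h ha
          rw [abs_mul, abs_pow, abs_of_nonneg (h a ha)]
          have := pow_le_of_le_one (h a ha) h1 (by omega : j ≠ 0)
          have := h a ha
          gcongr
          exact hm a ha
      _ = m := by rw [← Finset.mul_sum, hsum, mul_one]
  set R : ℕ → ℝ := fun q => ∑ l ∈ range (t + 1), coeff l (charSeries s lam) * T (q - l) with hR
  set W : PowerSeries ℝ := PowerSeries.mk fun q =>
    -(∑ l ∈ Icc 1 t, d l * S (q - l)) - R q with hW
  have hrec : ∀ q, t < q → coeff q (charSeries s lam * E)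
      = coeff q W + coeff q (tailSeries (t + 1) (charSeries s lam) * E) := by
    intro q hq
    rw [coeff_mul, coeff_mul, Finset.Nat.sum_antidiagonal_eq_sum_range_succ
      (fun p q => coeff p (charSeries s lam) * coeff q E),
      Finset.Nat.sum_antidiagonal_eq_sum_range_succ
      (fun p q => coeff p (tailSeries (t + 1) (charSeries s lam)) * coeff q E),
      show q.succ = (t + 1) + (q - t) by omega, Finset.sum_range_add _ (t + 1) (q - t),
      Finset.sum_range_add _ (t + 1) (q - t)]
    have z : ∑ x ∈ range (t + 1), coeff x (tailSeries (t + 1) (charSeries s lam))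
        * coeff (q - x) E = 0 := Finset.sum_eq_zero fun x hx => by
      have := Finset.mem_range.1 hx
      rw [coeff_tailSeries, if_neg (by omega), zero_mul]
    have z2 : ∑ x ∈ range (q - t), coeff (t + 1 + x) (tailSeries (t + 1) (charSeries s lam))
        * coeff (q - (t + 1 + x)) E = ∑ x ∈ range (q - t), coeff (t + 1 + x) (charSeries s lam)
        * coeff (q - (t + 1 + x)) E := Finset.sum_congr rfl fun x _ => by
      rw [coeff_tailSeries, if_pos (by omega)]
    rw [z, z2, zero_add]
    congr 1
    rw [hW, coeff_mk]
    have e1 : ∑ x ∈ range (t + 1), coeff x (charSeries s lam) * coeff (q - x) E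
        = ∑ x ∈ range (t + 1), coeff x (charSeries s lam) * S (q - x) - R q := by
      rw [hR, ← Finset.sum_sub_distrib]
      refine Finset.sum_congr rfl fun x hx => ?_
      have := Finset.mem_range.1 hx
      rw [cE _ (by omega)]; ring
    rw [e1, Finset.sum_range_succ', coeff_charSeries, elemSymm_zero]
    have e2 : ∑ l ∈ Icc 1 t, d l * S (q - l) = ∑ x ∈ range t, d (x + 1) * S (q - (x + 1)) := by
      exact sum_Icc_one_eq_sum_range _ t
    rw [e2, Nat.sub_zero]
    have e3 : S q = ∑ l ∈ range t, (-1) ^ l * newtonGirard Q (l + 1) * S (q - (l + 1)) :=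
      extendEst_of_lt hq Q QM
    rw [e3, ← Finset.sum_neg_distrib, pow_zero, one_mul, one_mul, ← Finset.sum_add_distrib]
    congr 1
    refine Finset.sum_congr rfl fun x _ => ?_
    rw [coeff_charSeries, hd]
    simp only [pow_succ]; ring
  have hWle : ∀ q, t < q → |coeff q W| ≤ (D * m + ∑ l ∈ Icc 1 t,
      |newtonGirard Q l - elemSymm s lam l| * |coeff (q - l) E|) + |R q| := by
    intro q hq
    rw [hW, coeff_mk]
    refine (abs_sub _ _).trans (add_le_add ?_ le_rfl)
    rw [abs_neg]
    refine (Finset.abs_sum_le_sum_abs _ _).trans ?_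
    have : ∀ l ∈ Icc 1 t, |d l * S (q - l)| ≤ |newtonGirard Q l - elemSymm s lam l| * m
        + |newtonGirard Q l - elemSymm s lam l| * |coeff (q - l) E| := by
      intro l hl
      have hl := Finset.mem_Icc.1 hl
      rw [hd, abs_mul, abs_mul, abs_pow, abs_neg, abs_one, one_pow, one_mul, ← mul_add]
      refine mul_le_mul_of_nonneg_left ?_ (abs_nonneg _)
      have h1 := hTm (q - l) (by omega)
      have h2 : S (q - l) = T (q - l) + coeff (q - l) E := by rw [cE _ (by omega)]; ring
      rw [h2]
      exact (abs_add_le _ _).trans (add_le_add h1 le_rfl)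
    refine (Finset.sum_le_sum this).trans ?_
    rw [Finset.sum_add_distrib, ← Finset.sum_mul]
    gcongr
  have hEs : ∀ j ∈ Icc 1 t, |coeff j E| ≤ e0 := by
    intro j hj
    have hj := Finset.mem_Icc.1 hj
    rw [cE j hj.1, hS, extendEst_of_le hj.2]
    exact he0 j hj.1 hj.2
  set A := G * e0 + (τ + k * D) * m with hA
  have hA0 : e0 ≤ A := by
    have : 0 ≤ (τ + k * D) * m := by positivity
    nlinarith
  have hx : ∀ i ≤ k, |coeff i E| ≤ A + ∑ q ∈ range (i - t), ∑ l ∈ Icc 1 t,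
      |newtonGirard Q l - elemSymm s lam l| * |coeff (t + 1 + q - l) E|
      + elemSymm s lam (t + 1) * ∑ q ∈ range i, |coeff q E| := by
    intro i hi
    have hpos : 0 ≤ elemSymm s lam (t + 1) * ∑ q ∈ range i, |coeff q E| :=
      mul_nonneg (hel _) (Finset.sum_nonneg fun _ _ => abs_nonneg _)
    rcases le_or_gt i t with hit | hit
    · rw [Nat.sub_eq_zero_of_le hit]
      simp only [range_zero, sum_empty, add_zero]
      have : |coeff i E| ≤ e0 := by
        rcases Nat.eq_zero_or_pos i with rfl | h0
        · rw [cE0, abs_zero]; exact he00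
        · exact hEs i (Finset.mem_Icc.2 ⟨h0, hit⟩)
      linarith
    · have h1 := abs_coeff_le_of_recursion s lam h hsum E W cE0 hEs hrec hit
      have h2 : ∑ q ∈ range (i - t), |coeff (t + 1 + q) W| ≤ ((i - t : ℕ) : ℝ) * (D * m)
          + ∑ q ∈ range (i - t), ∑ l ∈ Icc 1 t,
            |newtonGirard Q l - elemSymm s lam l| * |coeff (t + 1 + q - l) E| + τ * m := by
        refine (Finset.sum_le_sum fun q _ => hWle (t + 1 + q) (by omega)).trans ?_
        rw [Finset.sum_add_distrib, Finset.sum_add_distrib, Finset.sum_const, Finset.card_range,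
          nsmul_eq_mul]
        exact add_le_add le_rfl (sum_truncation_le s lam mu h hsum hm ht hτ hm0 _)
      have h3 : ((i - t : ℕ) : ℝ) * (D * m) ≤ k * (D * m) := by
        have : ((i - t : ℕ) : ℝ) ≤ k := by exact_mod_cast (by omega : i - t ≤ k)
        gcongr
      have h4 : (∑ l ∈ Icc 1 t, elemSymm s lam l) * e0 ≤ G * e0 := by gcongr
      rw [hA]
      linarith
  have hfin := le_mul_pow_of_recursion (x := fun i => |coeff i E|)
    (w := fun l => |newtonGirard Q l - elemSymm s lam l|) (fun _ => abs_nonneg _) (he00.trans hA0) (hel (t + 1)) hD hx i hik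
  simp only [cE i hi] at hfin
  refine hfin.trans ?_
  have := hel (t + 1)
  have := he00.trans hA0
  gcongr
  linarith

/-- The coefficients of `newtonGirard Q` in terms of the elementary symmetric functions: the
quotient of the generating series. -/
theorem exists_newtonGirard_quotient {ι : Type*} (s : Finset ι) (lam : ι → ℝ) (Q : ℕ → ℝ) :
    ∃ c : ℕ → ℝ, c 0 = 1 ∧
      (∀ j : ℕ, ((j : ℝ) + 1) * c (j + 1)
        = -∑ i ∈ range (j + 1), c (j - i) * (Q (i + 1) - ∑ a ∈ s, lam a ^ (i + 1))) ∧
      ∀ l, (-1) ^ l * newtonGirard Q l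
        = ∑ j ∈ range (l + 1), c j * ((-1) ^ (l - j) * elemSymm s lam (l - j)) := by
  set B := charSeries s lam with hB
  set H := completeSeries s lam with hH
  have hBH : B * H = 1 := charSeries_mul_completeSeries s lam
  set β : PowerSeries ℝ := PowerSeries.mk fun l => (-1) ^ l * newtonGirard Q l with hβ
  set q : PowerSeries ℝ := PowerSeries.mk fun l => Q (l + 1) with hq
  set p : PowerSeries ℝ := PowerSeries.mk fun l => ∑ a ∈ s, lam a ^ (l + 1) with hp
  -- The Newton-Girard recursion, read as a differential equation for the signed generating series.
  have dβ : d⁄dX ℝ β = -(β * q) := by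
    ext k
    rw [coeff_derivative, map_neg, mul_comm β, coeff_mul,
      Finset.Nat.sum_antidiagonal_eq_sum_range_succ (fun i j => coeff i q * coeff j β)]
    simp only [hβ, hq, coeff_mk]
    rw [mul_comm, mul_left_comm, newtonGirard_succ, Finset.mul_sum, ← Finset.sum_neg_distrib]
    refine Finset.sum_congr rfl fun l hl => ?_
    have := Finset.mem_range.1 hl
    have e : (-1 : ℝ) ^ (k + 1) * (-1) ^ l = -(-1) ^ (k - l) := by
      obtain ⟨r, rfl⟩ : ∃ r, k = l + r := ⟨k - l, by omega⟩
      rw [Nat.add_sub_cancel_left, pow_succ, pow_add]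
      have : (-1 : ℝ) ^ l * (-1) ^ l = 1 := by rw [← mul_pow]; simp
      linear_combination (-(-1 : ℝ) ^ r) * this
    linear_combination (newtonGirard Q (k - l) * Q (l + 1)) * e
  -- The logarithmic derivative of ∏ 1/(1 - λ_a X) is the series of the exact power sums.
  have dH : d⁄dX ℝ H = H * p := by
    have hgen : ∀ s' : Finset ι, d⁄dX ℝ (completeSeries s' lam) = completeSeries s' lam *
        PowerSeries.mk fun l => ∑ a ∈ s', lam a ^ (l + 1) := by
      classical
      intro s'
      induction s' using Finset.induction_on with
      | empty =>
        ext n; simp [completeSeries]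
      | insert a s' ha ih =>
        have e2 : completeSeries (insert a s') lam
            = geomSeries (lam a) * completeSeries s' lam := by
          rw [completeSeries, Finset.prod_insert ha]; rfl
        have e3 : d⁄dX ℝ (geomSeries (lam a)) = geomSeries (lam a) * (PowerSeries.mk fun l =>
            lam a ^ (l + 1)) := by
          ext n
          rw [coeff_derivative, coeff_mul, Finset.Nat.sum_antidiagonal_eq_sum_range_succ
            (fun i j => coeff i (geomSeries (lam a)) * coeff j (PowerSeries.mk fun l =>
            lam a ^ (l + 1)))]
          simp only [geomSeries, coeff_mk]
          rw [Finset.sum_congr rfl (g := fun _ => lam a ^ (n + 1))]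
          · simp; ring
          · intro x hx
            have := Finset.mem_range.1 hx
            rw [← pow_add]; congr 1; omega
        have e4 : (PowerSeries.mk fun l => ∑ b ∈ insert a s', lam b ^ (l + 1))
            = (PowerSeries.mk fun l => lam a ^ (l + 1))
              + PowerSeries.mk fun l => ∑ b ∈ s', lam b ^ (l + 1) := by
          ext n; simp [Finset.sum_insert ha]
        rw [e2, Derivation.leibniz, ih, e3, e4, smul_eq_mul, smul_eq_mul]
        ring
    exact hgen s
  refine ⟨fun j => coeff j (β * H), ?_, ?_, ?_⟩
  · have h1 : coeff 0 B * coeff 0 H = 1 := by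
      have := congrArg (coeff 0) hBH
      simpa using this
    rw [hB, coeff_charSeries, elemSymm_zero] at h1
    simp only [pow_zero, one_mul] at h1
    have h2 : constantCoeff H = 1 := by simpa using h1
    simp [hβ, newtonGirard_zero, h2]
  · intro j
    -- Only the errors of the power sums drive the quotient β/B; exact data would give the constant
    -- 1.
    have e : d⁄dX ℝ (β * H) = -((q - p) * (β * H)) := by
      rw [Derivation.leibniz, dβ, dH, smul_eq_mul, smul_eq_mul]; ring
    have := congrArg (coeff j) e
    rw [coeff_derivative, map_neg, coeff_mul (φ := q - p),
      Finset.Nat.sum_antidiagonal_eq_sum_range_succ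
        (fun i j => coeff i (q - p) * coeff j (β * H))] at this
    rw [mul_comm, this]
    congr 1
    refine Finset.sum_congr rfl fun i _ => ?_
    simp [hq, hp, mul_comm]
  · intro l
    have e : β * H * B = β := by linear_combination β * hBH
    have h1 : (-1) ^ l * newtonGirard Q l = coeff l β := by simp [hβ]
    refine h1.trans ?_
    conv_lhs => rw [← e]
    rw [coeff_mul, Finset.Nat.sum_antidiagonal_eq_sum_range_succ
      (fun i j => coeff i (β * H) * coeff j B)]
    simp only [hB, coeff_charSeries]

/-- `∑_{l = 2}^t ∑_{j = 2}^l 1 / (j (l - j)!)`. -/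
noncomputable def newtonSum (t : ℕ) : ℝ :=
  ∑ l ∈ Icc 2 t, ∑ j ∈ Icc 2 l, 1 / ((j : ℝ) * (l - j).factorial)

/-- The quotient series c has c_0 = 1, and c_1 = 0 because Q 1 is exact. Its other coefficients are
of size η/j, and b_l - e_l is, up to sign, the convolution of these with the e's, where e_i ≤ 1/i!.
-/
theorem sum_abs_newtonGirard_sub_le {ι : Type*} (s : Finset ι) (lam : ι → ℝ)
    (h : ∀ a ∈ s, 0 ≤ lam a) (hsum : ∑ a ∈ s, lam a = 1) {t : ℕ} (Q : ℕ → ℝ) (hQ1 : Q 1 = 1)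
    {η : ℝ} (hη0 : 0 ≤ η) (hη : t * η ≤ 1)
    (hQ : ∀ j, 2 ≤ j → j ≤ t → |Q j - ∑ a ∈ s, lam a ^ j| ≤ η) :
    ∑ l ∈ Icc 1 t, |newtonGirard Q l - elemSymm s lam l| ≤ η * (1 + t * η) * newtonSum t := by
  obtain ⟨c, c0, hc, hb⟩ := exists_newtonGirard_quotient s lam Q
  have c1 : c 1 = 0 := by
    have := hc 0
    simpa [hQ1, hsum] using this
  -- The second bound carries the induction. It follows from the first because tη ≤ 1 and j ≥ 2.
  have key : ∀ j, 2 ≤ j → j ≤ t → |c j| ≤ η * (1 + t * η) / j ∧ |c j| ≤ η := by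
    intro j
    induction j using Nat.strong_induction_on with
    | _ j ih =>
      intro h2 hjt
      have hj0 : (2 : ℝ) ≤ j := by exact_mod_cast h2
      have main : j * |c j| ≤ η * (1 + t * η) := by
        obtain ⟨j, rfl⟩ : ∃ j', j = j' + 1 := ⟨j - 1, by omega⟩
        have e := hc j
        rw [← Finset.sum_range_reflect, Finset.sum_range_succ] at e
        have z : Q (j + 1 - 1 - j + 1) - ∑ a ∈ s, lam a ^ (j + 1 - 1 - j + 1) = 0 := by
          simp [hQ1, hsum]
        rw [z, mul_zero, add_zero] at e
        have : (((j + 1 : ℕ) : ℝ)) * |c (j + 1)| = |((j : ℝ) + 1) * c (j + 1)| := by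
          rw [abs_mul, abs_of_nonneg (by positivity : (0 : ℝ) ≤ (j : ℝ) + 1)]; push_cast; ring
        rw [this, e, abs_neg]
        refine (Finset.abs_sum_le_sum_abs _ _).trans ?_
        have b : ∀ x ∈ range j, |c (j - (j + 1 - 1 - x)) * (Q (j + 1 - 1 - x + 1)
            - ∑ a ∈ s, lam a ^ (j + 1 - 1 - x + 1))| ≤ |c x| * η := by
          intro x hx
          have := Finset.mem_range.1 hx
          rw [abs_mul, show j - (j + 1 - 1 - x) = x by omega]
          exact mul_le_mul_of_nonneg_left (hQ _ (by omega) (by omega)) (abs_nonneg _)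
        refine (Finset.sum_le_sum b).trans ?_
        rw [← Finset.sum_mul, mul_comm η]
        refine mul_le_mul_of_nonneg_right ?_ hη0
        obtain ⟨j, rfl⟩ : ∃ j', j = j' + 1 := ⟨j - 1, by omega⟩
        rw [Finset.sum_range_succ', c0, abs_one, add_comm]
        refine add_le_add le_rfl ?_
        calc _ ≤ ∑ x ∈ range j, η := Finset.sum_le_sum fun x hx => by
              have := Finset.mem_range.1 hx
              rcases Nat.eq_zero_or_pos x with rfl | hx0
              · rw [zero_add, c1, abs_zero]; exact hη0
              · exact (ih (x + 1) (by omega) (by omega) (by omega)).2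
          _ = j * η := by simp
          _ ≤ t * η := by
              have : (j : ℝ) ≤ t := by exact_mod_cast (by omega : j ≤ t)
              gcongr
      have h1 : |c j| ≤ η * (1 + t * η) / j := by
        rw [le_div_iff₀ (by linarith), mul_comm]; exact main
      refine ⟨h1, h1.trans ?_⟩
      rw [div_le_iff₀ (by linarith)]
      nlinarith
  have hl : ∀ l ∈ Icc 2 t, |newtonGirard Q l - elemSymm s lam l|
      ≤ η * (1 + t * η) * ∑ j ∈ Icc 2 l, 1 / ((j : ℝ) * (l - j).factorial) := by
    intro l hl
    have hl := Finset.mem_Icc.1 hl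
    have e1 : |newtonGirard Q l - elemSymm s lam l|
        = |(-1) ^ l * newtonGirard Q l - (-1) ^ l * elemSymm s lam l| := by
      rw [← mul_sub, abs_mul, abs_pow, abs_neg, abs_one, one_pow, one_mul]
    have e2 : (-1) ^ l * newtonGirard Q l - (-1) ^ l * elemSymm s lam l
        = ∑ j ∈ Icc 2 l, c j * ((-1) ^ (l - j) * elemSymm s lam (l - j)) := by
      -- The term j = 0 is e_l itself and the term j = 1 vanishes, so the difference starts at j =
      -- 2.
      have e3 : range (l + 1) = insert 0 (insert 1 (Icc 2 l)) := by
        ext x; simp only [mem_range, mem_insert, mem_Icc]; omega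
      rw [hb, e3, Finset.sum_insert (by simp), Finset.sum_insert (by simp), c0, c1]
      simp
    rw [e1, e2, Finset.mul_sum]
    refine (Finset.abs_sum_le_sum_abs _ _).trans (Finset.sum_le_sum fun j hj => ?_)
    have hj := Finset.mem_Icc.1 hj
    rw [abs_mul, abs_mul, abs_pow, abs_neg, abs_one, one_pow, one_mul,
      abs_of_nonneg (elemSymm_nonneg s lam h _)]
    have h3 := elemSymm_le s lam h (l - j)
    rw [hsum, one_pow] at h3
    calc _ ≤ η * (1 + t * η) / j * (1 / (l - j).factorial) :=
          mul_le_mul (key j hj.1 (by omega)).1 h3 (elemSymm_nonneg s lam h _) (by positivity)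
      _ = _ := by rw [div_mul_div_comm, mul_one_div, mul_one]
  rw [newtonSum, Finset.mul_sum]
  rcases Nat.eq_zero_or_pos t with rfl | ht
  · simp
  have e4 : Icc 1 t = insert 1 (Icc 2 t) := by
    ext x; simp only [mem_insert, mem_Icc]; omega
  rw [e4, Finset.sum_insert (by simp)]
  have e5 : newtonGirard Q 1 - elemSymm s lam 1 = 0 := by
    have := newtonGirard_succ Q 0
    simp only [CharP.cast_eq_zero, zero_add, one_mul, range_one, sum_singleton, pow_zero,
      newtonGirard_zero, hQ1, Nat.sub_self] at this
    rw [this, elemSymm_one, hsum, sub_self]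
  rw [e5, abs_zero, zero_add]
  exact Finset.sum_le_sum hl

end

/-! ### Numerical estimates -/

section
open Finset

/-- After exchanging the sums, the inner one is at most e/j, and the harmonic sum without its first
term is at most ln t. This is the origin of ln t in the tolerance. -/
theorem newtonSum_le (t : ℕ) (ht : 1 ≤ t) : newtonSum t ≤ Real.exp 1 * Real.log t := by
  have hswap : newtonSum t = ∑ j ∈ Icc 2 t, ∑ l ∈ Icc j t,
      1 / ((j : ℝ) * (l - j).factorial) := by
    rw [newtonSum]
    refine Finset.sum_comm' fun x y => ?_
    simp only [mem_Icc]; omega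
  have hin : ∀ j ∈ Icc 2 t, ∑ l ∈ Icc j t, 1 / ((j : ℝ) * (l - j).factorial)
      ≤ Real.exp 1 * (1 / j) := by
    intro j hj
    have hj := Finset.mem_Icc.1 hj
    have hj0 : (0 : ℝ) < j := by exact_mod_cast (by omega : 0 < j)
    have e : ∑ l ∈ Icc j t, 1 / ((j : ℝ) * (l - j).factorial)
        = (1 / j) * ∑ i ∈ range (t + 1 - j), (1 : ℝ) ^ i / i.factorial := by
      rw [Finset.mul_sum]
      have : Icc j t = Ico j (t + 1) := by ext; simp
      rw [this, Finset.sum_Ico_eq_sum_range]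
      refine Finset.sum_congr rfl fun i _ => ?_
      rw [Nat.add_sub_cancel_left, one_pow, div_mul_div_comm, one_mul]
    rw [e, mul_comm]
    exact mul_le_mul_of_nonneg_right (Real.sum_le_exp_of_nonneg zero_le_one _) (by positivity)
  rw [hswap]
  refine (Finset.sum_le_sum hin).trans ?_
  rw [← Finset.mul_sum]
  refine mul_le_mul_of_nonneg_left ?_ (Real.exp_pos _).le
  have h1 := harmonic_le_one_add_log t
  rw [harmonic_eq_sum_Icc] at h1
  have e4 : Icc 1 t = insert 1 (Icc 2 t) := by
    ext x; simp only [mem_insert, mem_Icc]; omega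
  rw [e4, Finset.sum_insert (by simp)] at h1
  push_cast at h1
  simp only [one_div]
  linarith

theorem newtonSum_two : newtonSum 2 = 1 / 2 := by
  simp [newtonSum]

theorem newtonSum_three : newtonSum 3 = 4 / 3 := by
  simp [newtonSum, Finset.sum_Icc_succ_top]; norm_num

theorem newtonSum_four : newtonSum 4 = 13 / 6 := by
  simp [newtonSum, Finset.sum_Icc_succ_top]; norm_num

theorem newtonSum_five : newtonSum 5 = 43 / 15 := by
  simp [newtonSum, Finset.sum_Icc_succ_top]; norm_num

theorem one_le_log_three : 1 ≤ Real.log 3 := by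
  rw [Real.le_log_iff_exp_le (by norm_num)]
  have := Real.exp_one_lt_d9
  linarith

theorem log_five_ge : 1.6 ≤ Real.log 5 := by
  have h : (8 : ℝ) ≤ Real.log (5 ^ 5) := by
    rw [Real.le_log_iff_exp_le (by norm_num), show (8 : ℝ) = ((8 : ℕ) : ℝ) * 1 by norm_num,
      Real.exp_nat_mul]
    calc Real.exp 1 ^ 8 ≤ 2.7182818286 ^ 8 := by
          gcongr; exact Real.exp_one_lt_d9.le
      _ ≤ _ := by norm_num
  rw [Real.log_pow] at h
  push_cast at h
  linarith

theorem newtonSum_le_mul_log_of_six_le {t : ℕ} (ht : 6 ≤ t) :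
    newtonSum t ≤ 0.4532 * (t * Real.log t) := by
  have h1 := newtonSum_le t (by omega)
  have h2 := Real.exp_one_lt_d9
  have h3 : (6 : ℝ) ≤ t := by exact_mod_cast ht
  have h4 : 0 ≤ Real.log t := Real.log_nonneg (by linarith)
  nlinarith

/-- The constant is fixed by its use: (1 + 1/4) · 0.48 / 2 = 0.3, the admissible value in
`gain_full_rank`. For t ≤ 5 the bound through the exponential is too weak, hence the explicit
values. -/
theorem newtonSum_le_mul_log {t : ℕ} (ht : 2 ≤ t) : newtonSum t ≤ 0.48 * (t * Real.log t) := by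
  have hl2 := Real.log_two_gt_d9
  have hl3 := one_le_log_three
  have hl5 := log_five_ge
  rcases lt_or_ge t 6 with h | h
  · interval_cases t
    · rw [newtonSum_two]; push_cast; linarith
    · rw [newtonSum_three]; push_cast; linarith
    · rw [newtonSum_four]
      have : Real.log (4 : ℕ) = 2 * Real.log 2 := by
        rw [show ((4 : ℕ) : ℝ) = 2 ^ 2 by norm_num, Real.log_pow]; norm_num
      rw [this]; push_cast; linarith
    · rw [newtonSum_five]; push_cast; linarith
  · have := newtonSum_le_mul_log_of_six_le h
    have : 0 ≤ (t : ℝ) * Real.log t := by positivity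
    linarith

/-- Taylor polynomial of degree 4; the remainder bound is y^5 · 6 / (5! · 5) = y^5 / 100. -/
theorem exp_le_of_le {x y b : ℝ} (hx : x ≤ y) (h0 : 0 ≤ y) (h1 : y ≤ 1)
    (hb : 1 + y + y ^ 2 / 2 + y ^ 3 / 6 + y ^ 4 / 24 + y ^ 5 / 100 ≤ b) : Real.exp x ≤ b := by
  refine (Real.exp_le_exp.2 hx).trans ?_
  have := Real.exp_bound' h0 h1 (n := 5) (by norm_num)
  simp only [Finset.sum_range_succ, Finset.sum_range_zero] at this
  norm_num [Nat.factorial] at this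
  linarith

/-- `e ^ n / (2 n!)` decreases. -/
theorem exp_div_factorial_le {n₀ n : ℕ} (hn : n₀ ≤ n) (h2 : 2 ≤ n₀) :
    Real.exp 1 ^ n / (2 * n.factorial) ≤ Real.exp 1 ^ n₀ / (2 * n₀.factorial) := by
  induction n, hn using Nat.le_induction with
  | base => exact le_rfl
  | succ n hn ih =>
    refine le_trans ?_ ih
    have h3 : (3 : ℝ) ≤ (n : ℝ) + 1 := by exact_mod_cast (by omega : 3 ≤ n + 1)
    have h4 : Real.exp 1 ≤ (n : ℝ) + 1 := by have := Real.exp_one_lt_d9; linarith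
    rw [Nat.factorial_succ, pow_succ, div_le_div_iff₀ (by positivity) (by positivity)]
    push_cast
    have : 0 ≤ Real.exp 1 ^ n * (2 * (n.factorial : ℝ)) := by positivity
    nlinarith

theorem exp_one_pow_six_le : Real.exp 1 ^ 6 / (2 * (Nat.factorial 6 : ℝ)) ≤ 0.281 := by
  rw [div_le_iff₀ (by positivity)]
  calc Real.exp 1 ^ 6 ≤ 2.7182818286 ^ 6 := by gcongr; exact Real.exp_one_lt_d9.le
    _ ≤ _ := by norm_num [Nat.factorial]

theorem exp_one_pow_seven_le : Real.exp 1 ^ 7 / (2 * (Nat.factorial 7 : ℝ)) ≤ 0.109 := by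
  rw [div_le_iff₀ (by positivity)]
  calc Real.exp 1 ^ 7 ≤ 2.7182818286 ^ 7 := by gcongr; exact Real.exp_one_lt_d9.le
    _ ≤ _ := by norm_num [Nat.factorial]

/-- Here u is ε/‖M‖_∞ and v the truncation error relative to ε. The worst cases of v and z exclude
each other: z is large only for u near 1, where v ≤ 1/(5! u) is small. Hence the split into ranges
of u. -/
theorem gain_five {κ v u z : ℝ} (hκ : κ ≤ 0.181) (hv0 : 0 ≤ v)
    (hv : v ≤ 0.281) (hvu : v * u ≤ 1 / 120) (hu1 : u ≤ 1) (hu0 : 0 < u)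
    (hz : z ≤ (0.181 + 0.281) * u) :
    ((Real.exp 1 - 1) / 4 + κ + v) * Real.exp z ≤ 1 := by
  have he := Real.exp_one_lt_d9
  have hp := Real.exp_pos z
  have he1 := Real.exp_one_gt_d9
  rcases le_total u 0.2 with h | h
  · have h1 : Real.exp z ≤ 1.098 :=
      exp_le_of_le (y := 0.0924) (by linarith) (by norm_num) (by norm_num) (by norm_num)
    calc _ ≤ (0.8918 : ℝ) * 1.098 := by gcongr; linarith
      _ ≤ 1 := by norm_num
  rcases le_total u 0.6 with h' | h'
  · have h1 : Real.exp z ≤ 1.33 :=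
      exp_le_of_le (y := 0.2772) (by linarith) (by norm_num) (by norm_num) (by norm_num)
    have h2 : v ≤ 0.0417 := by nlinarith
    calc _ ≤ (0.66 : ℝ) * 1.33 := by gcongr; linarith
      _ ≤ 1 := by norm_num
  · have h1 : Real.exp z ≤ 1.588 :=
      exp_le_of_le (y := 0.462) (by linarith) (by norm_num) (by norm_num) (by norm_num)
    have h2 : v ≤ 0.0139 := by nlinarith
    calc _ ≤ (0.6246 : ℝ) * 1.588 := by gcongr; linarith
      _ ≤ 1 := by norm_num

theorem gain_six {κ v u z : ℝ} (hκ : κ ≤ 0.23) (hv0 : 0 ≤ v)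
    (hv : v ≤ 0.109) (hvu : v * u ≤ 1 / 720) (hu1 : u ≤ 1) (hu0 : 0 < u)
    (hz : z ≤ (0.23 + 0.109) * u) :
    ((Real.exp 1 - 1) / 4 + κ + v) * Real.exp z ≤ 1 := by
  have he := Real.exp_one_lt_d9
  have hp := Real.exp_pos z
  have he1 := Real.exp_one_gt_d9
  rcases le_total u 0.5 with h | h
  · have h1 : Real.exp z ≤ 1.19 :=
      exp_le_of_le (y := 0.1695) (by linarith) (by norm_num) (by norm_num) (by norm_num)
    calc _ ≤ (0.769 : ℝ) * 1.19 := by gcongr; linarith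
      _ ≤ 1 := by norm_num
  · have h1 : Real.exp z ≤ 1.41 :=
      exp_le_of_le (y := 0.339) (by linarith) (by norm_num) (by norm_num) (by norm_num)
    have h2 : v ≤ 0.0028 := by nlinarith
    calc _ ≤ (0.67 : ℝ) * 1.41 := by gcongr; linarith
      _ ≤ 1 := by norm_num

theorem gain_full_rank {κ z : ℝ} (hκ : κ ≤ 0.3) (hz : z ≤ 0.3) :
    ((Real.exp 1 - 1) / 4 + κ) * Real.exp z ≤ 1 := by
  have he := Real.exp_one_lt_d9
  have hp := Real.exp_pos z
  have he1 := Real.exp_one_gt_d9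
  have h1 : Real.exp z ≤ 1.351 :=
    exp_le_of_le (y := 0.3) (by linarith) (by norm_num) (by norm_num) (by norm_num)
  calc _ ≤ (0.7297 : ℝ) * 1.351 := by gcongr; linarith
    _ ≤ 1 := by norm_num

theorem newtonSum_nonneg (t : ℕ) : 0 ≤ newtonSum t :=
  Finset.sum_nonneg fun _ _ => Finset.sum_nonneg fun _ _ => by positivity

theorem powTol_nonneg (k t : ℕ) {m ε : ℝ} (hm : 0 ≤ m) (hε : 0 ≤ ε) : 0 ≤ powTol k t m ε := by
  rw [powTol]
  have : 0 ≤ Real.log t := Real.log_natCast_nonneg t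
  positivity

/-- The accuracies `ε / 4` and `powTol` are sufficient, in terms of the gain of the recursion. -/
theorem exists_gain {ι : Type*} (s : Finset ι) (lam : ι → ℝ)
    (h : ∀ a ∈ s, 0 ≤ lam a) (hsum : ∑ a ∈ s, lam a = 1) {r k t : ℕ} {m ε : ℝ}
    (hε : 0 < ε) (hεm : ε ≤ m) (hr : elemSymm s lam (r + 1) = 0) (hr1 : 1 ≤ r)
    (hΛ : r ≤ ⌊Real.log (2 * k * m / ε)⌋₊ ∨ 5 ≤ Real.log (2 * k * m / ε))
    (ht : t = effRank r k m ε) (htk : t < k) :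
    ∃ τ : ℝ, (elemSymm s lam (t + 1) = 0 ∧ 0 ≤ τ ∨ 1 / (t.factorial : ℝ) ≤ τ) ∧
      t * powTol k t m ε ≤ 1 ∧
      ((Real.exp 1 - 1) * (ε / 4) + (τ + k * (powTol k t m ε *
        (1 + t * powTol k t m ε) * newtonSum t)) * m) *
        (1 + powTol k t m ε * (1 + t * powTol k t m ε) * newtonSum t
          + elemSymm s lam (t + 1)) ^ k ≤ ε := by
  set Λ := Real.log (2 * k * m / ε) with hΛdef
  set η := powTol k t m ε with hη
  have hm : 0 < m := hε.trans_le hεm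
  have hk0 : (0 : ℝ) < k := by exact_mod_cast (by omega : 0 < k)
  have hη0 : 0 ≤ η := powTol_nonneg k t hm.le hε.le
  have hNS := newtonSum_nonneg t
  have het := elemSymm_nonneg s lam h (t + 1)
  set D := η * (1 + t * η) * newtonSum t with hD
  have hD0 : 0 ≤ D := by positivity
  -- In units of ε, the initial errors contribute (e - 1)/4, the coefficient errors κ and the
  -- truncation τ/u; the feedback contributes at most the factor exp(k (D + e_(t+1))). It remains to
  -- keep the product below 1.
  set u := ε / m with hu
  have hu0 : 0 < u := by positivity
  have hu1 : u ≤ 1 := by rw [hu, div_le_one hm]; exact hεm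
  set κ := k * D * m / ε with hκ
  have hκ0 : 0 ≤ κ := by positivity
  have hκu : κ * u = k * D := by rw [hκ, hu]; field_simp
  have ht1 : 1 ≤ t := by
    rw [ht, effRank]
    rcases hΛ with h | h
    · exact le_min hr1 (hr1.trans h)
    · exact le_min hr1 (Nat.le_floor (by push_cast; linarith))
  have hlog : ∀ {τ : ℝ}, ((Real.exp 1 - 1) / 4 + κ + τ / u) *
      Real.exp (k * (D + elemSymm s lam (t + 1))) ≤ 1 → 0 ≤ τ →
      ((Real.exp 1 - 1) * (ε / 4) + (τ + k * D) * m) * (1 + D + elemSymm s lam (t + 1)) ^ k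
        ≤ ε := by
    intro τ h1 hτ
    have h2 : (1 + D + elemSymm s lam (t + 1)) ^ k
        ≤ Real.exp (k * (D + elemSymm s lam (t + 1))) := by
      rw [Real.exp_nat_mul]
      have := Real.add_one_le_exp (D + elemSymm s lam (t + 1))
      gcongr
      linarith
    have h3 : (Real.exp 1 - 1) * (ε / 4) + (τ + k * D) * m
        = ((Real.exp 1 - 1) / 4 + κ + τ / u) * ε := by
      rw [hκ, hu]; field_simp; ring
    have h4 : 0 ≤ (Real.exp 1 - 1) / 4 + κ + τ / u := by
      have := Real.exp_one_gt_d9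
      have : 0 ≤ τ / u := by positivity
      linarith
    rw [h3]
    calc _ ≤ ((Real.exp 1 - 1) / 4 + κ + τ / u) * ε *
          Real.exp (k * (D + elemSymm s lam (t + 1))) := by gcongr
      _ = (((Real.exp 1 - 1) / 4 + κ + τ / u) *
          Real.exp (k * (D + elemSymm s lam (t + 1)))) * ε := by ring
      _ ≤ _ := by nlinarith
  -- The tolerance is designed for this: k, m and ε cancel, except inside the harmless factor 1 +
  -- tη.
  have hκe : 2 ≤ t → κ = (1 + t * η) * newtonSum t / (2 * (t * Real.log t)) := by
    intro h2
    have : 0 < Real.log t := Real.log_pos (by exact_mod_cast h2)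
    have ht0 : (0 : ℝ) < t := by exact_mod_cast ht1
    have e : η * (2 * m * k * t * Real.log t) = ε := by
      rw [hη, powTol]; field_simp
    rw [hκ, hD, eq_div_iff (by positivity), div_mul_eq_mul_div, div_eq_iff hε.ne', ← e]
    ring
  have htη : 2 ≤ t → t * η = u / (2 * k * Real.log t) := by
    intro h2
    have : 0 < Real.log t := Real.log_pos (by exact_mod_cast h2)
    have ht0 : (0 : ℝ) < t := by exact_mod_cast ht1
    rw [hη, powTol, hu]; field_simp
  by_cases hcase : r ≤ ⌊Λ⌋₊
  · have htr : t = r := by rw [ht, effRank, min_eq_left hcase]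
    have he : elemSymm s lam (t + 1) = 0 := htr ▸ hr
    rcases Nat.lt_or_ge t 2 with h2 | h2
    · have ht' : t = 1 := by omega
      -- For t = 1 the tolerance divides by ln 1 = 0 and is 0 by convention; then D = 0 as well.
      have hη' : η = 0 := by rw [hη, powTol, ht']; simp
      refine ⟨0, .inl ⟨he, le_rfl⟩, by rw [hη']; simp, hlog ?_ le_rfl⟩
      rw [zero_div, add_zero, he, add_zero, ← hκu]
      have : κ = 0 := by rw [hκ, hD, hη']; simp
      rw [this]
      exact gain_full_rank (by norm_num) (by norm_num)
    · have hl : Real.log 2 ≤ Real.log t := Real.log_le_log (by norm_num) (by exact_mod_cast h2)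
      have hl2 := Real.log_two_gt_d9
      have hlt : 0 < Real.log t := by linarith
      have hk3 : (3 : ℝ) ≤ k := by exact_mod_cast (by omega : 3 ≤ k)
      have h14 : t * η ≤ 1 / 4 := by
        rw [htη h2, div_le_iff₀ (by positivity)]
        nlinarith
      refine ⟨0, .inl ⟨he, le_rfl⟩, by linarith, hlog ?_ le_rfl⟩
      have hκ3 : κ ≤ 0.3 := by
        have h3 : 0 < t * Real.log t := by positivity
        rw [hκe h2, div_le_iff₀ (by positivity)]
        have := newtonSum_le_mul_log h2
        calc _ ≤ (1 + 1 / 4) * (0.48 * (t * Real.log t)) := by gcongr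
          _ = _ := by ring
      rw [zero_div, add_zero, he, add_zero, ← hκu]
      refine gain_full_rank hκ3 ?_
      nlinarith
  · have hΛ5 : 5 ≤ Λ := by
      rcases hΛ with h | h
      · exact absurd h hcase
      · exact h
    have htΛ : t = ⌊Λ⌋₊ := by rw [ht, effRank, min_eq_right (le_of_not_ge hcase)]
    have ht5 : 5 ≤ t := by rw [htΛ]; exact Nat.le_floor (by exact_mod_cast hΛ5)
    -- The cut-off at ⌊Λ⌋ enters here: 2k = u e^Λ ≤ u e^(t+1), so the factorial beats k.
    have hΛlt : Λ < t + 1 := by rw [htΛ]; exact Nat.lt_floor_add_one Λ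
    have huΛ : u * Real.exp Λ = 2 * k := by
      rw [hΛdef, Real.exp_log (by positivity), hu]; field_simp
    have ht5' : (5 : ℝ) ≤ t := by exact_mod_cast ht5
    have hlog5 : 1.6 ≤ Real.log t :=
      log_five_ge.trans (Real.log_le_log (by norm_num) ht5')
    have hexp5 : 100 ≤ Real.exp Λ := by
      calc (100 : ℝ) ≤ 2.7182818283 ^ 5 := by norm_num
        _ ≤ Real.exp 1 ^ 5 := by gcongr; exact Real.exp_one_gt_d9.le
        _ = Real.exp ((5 : ℕ) * 1) := by rw [Real.exp_nat_mul]
        _ ≤ _ := Real.exp_le_exp.2 (by push_cast; linarith)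
    have hexpt : Real.exp Λ ≤ Real.exp 1 ^ (t + 1) := by
      rw [← Real.exp_nat_mul]
      exact Real.exp_le_exp.2 (by push_cast; linarith)
    have h100 : t * η ≤ 1 / 100 := by
      rw [htη (by omega), ← huΛ, div_le_iff₀ (by positivity)]
      have : 100 * 1 ≤ Real.exp Λ * Real.log t := by gcongr; linarith
      have : u * 100 ≤ u * (Real.exp Λ * Real.log t) := by gcongr; linarith
      linarith
    have hfac : (0 : ℝ) < t.factorial := by positivity
    have hfac1 : (0 : ℝ) < (t + 1).factorial := by positivity
    set θ := Real.exp 1 ^ (t + 1) / (2 * ((t + 1).factorial : ℝ)) with hθ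
    have hel : k * elemSymm s lam (t + 1) ≤ θ * u := by
      have h1 := elemSymm_le s lam h (t + 1)
      rw [hsum, one_pow] at h1
      calc _ ≤ (k : ℝ) * (1 / (t + 1).factorial) := by gcongr
        _ = (2 * k) / (2 * (t + 1).factorial) := by field_simp
        _ = (u * Real.exp Λ) / (2 * (t + 1).factorial) := by rw [huΛ]
        _ ≤ (u * Real.exp 1 ^ (t + 1)) / (2 * (t + 1).factorial) := by gcongr
        _ = _ := by rw [hθ]; ring
    -- Uses t + 1 ≤ k: one factor t + 1 turns t! into (t + 1)! and is paid for by 2k ≤ u e^(t+1).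
    have hvθ : 1 / (t.factorial : ℝ) / u ≤ θ := by
      rw [hθ, div_div, div_le_div_iff₀ (by positivity) (by positivity), Nat.factorial_succ]
      push_cast
      have h1 : ((t : ℝ) + 1) ≤ k := by exact_mod_cast htk
      have h2 : 2 * ((t : ℝ) + 1) ≤ u * Real.exp 1 ^ (t + 1) := by
        calc 2 * ((t : ℝ) + 1) ≤ u * Real.exp Λ := by rw [huΛ]; linarith
          _ ≤ _ := by gcongr
      nlinarith
    have hz : k * (D + elemSymm s lam (t + 1)) ≤ (κ + θ) * u := by
      rw [mul_add, add_mul, hκu]; linarith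
    have hvu : 1 / (t.factorial : ℝ) / u * u = 1 / t.factorial := by
      field_simp
    refine ⟨1 / t.factorial, .inr le_rfl, by linarith, hlog ?_ (by positivity)⟩
    have htl : 0 < t * Real.log t := by positivity
    rcases Nat.lt_or_ge t 6 with h6 | h6
    · obtain rfl : t = 5 := by omega
      have hθ5 : θ ≤ 0.281 := exp_one_pow_six_le
      have hκ5 : κ ≤ 0.181 := by
        rw [hκe (by omega), div_le_iff₀ (by positivity), newtonSum_five]
        have := log_five_ge
        push_cast at h100 ⊢
        calc _ ≤ (1 + 1 / 100 : ℝ) * (43 / 15) := by gcongr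
          _ ≤ _ := by linarith
      refine gain_five (u := u) hκ5 (by positivity) (hvθ.trans hθ5) ?_ hu1 hu0 ?_
      · rw [hvu]; norm_num [Nat.factorial]
      · refine hz.trans ?_; gcongr
    · have hθ6 : θ ≤ 0.109 :=
        (exp_div_factorial_le (by omega : 7 ≤ t + 1) (by norm_num)).trans exp_one_pow_seven_le
      have hκ6 : κ ≤ 0.23 := by
        rw [hκe (by omega), div_le_iff₀ (by positivity)]
        have := newtonSum_le_mul_log_of_six_le h6
        calc _ ≤ (1 + 1 / 100) * (0.4532 * (t * Real.log t)) := by gcongr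
          _ ≤ _ := by linarith
      refine gain_six (u := u) hκ6 (by positivity) (hvθ.trans hθ6) ?_ hu1 hu0 ?_
      · rw [hvu]
        have : (720 : ℝ) ≤ t.factorial := by exact_mod_cast (Nat.factorial_le h6 : _)
        gcongr
      · refine hz.trans ?_; gcongr

end

/-! ### States and observables -/

section
open Finset

theorem Pauli.star_mat (P : Pauli) (x y : Bool) : star (P.mat x y) = P.mat y x := by
  cases P <;> cases x <;> cases y <;> simp [Pauli.mat]

theorem Pauli.sum_norm_mat (P : Pauli) (x : Bool) : ∑ y, ‖P.mat x y‖ = 1 := by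
  cases P <;> cases x <;> simp [Pauli.mat]

theorem star_pauliString {n : ℕ} (P : Fin n → Pauli) (x y : Fin n → Bool) :
    star (pauliString P x y) = pauliString P y x := by
  simp only [pauliString, star_prod, Pauli.star_mat]

theorem isHermitian_pauliString {n : ℕ} (P : Fin n → Pauli) : (pauliString P).IsHermitian := by
  ext x y; exact star_pauliString P y x

theorem sum_norm_pauliString {n : ℕ} (P : Fin n → Pauli) (x : Fin n → Bool) :
    ∑ y, ‖pauliString P x y‖ = 1 := by
  simp only [pauliString, norm_prod]
  have := Finset.prod_univ_sum (fun _ : Fin n => (univ : Finset Bool))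
    (fun i b => ‖(P i).mat (x i) b‖)
  rw [Fintype.piFinset_univ] at this
  exact this.symm.trans (Finset.prod_eq_one fun i _ => (P i).sum_norm_mat (x i))

theorem isHermitian_pauliSum {n N : ℕ} (a : Fin N → ℝ) (P : Fin N → Fin n → Pauli) :
    (pauliSum a P).IsHermitian := by
  ext x y
  simp only [pauliSum, Matrix.conjTranspose_apply, Matrix.sum_apply, Matrix.smul_apply,
    smul_eq_mul, star_sum, star_mul', star_pauliString]
  simp

theorem opNormInf_eq {ι : Type*} [Fintype ι] [DecidableEq ι] (M : Matrix ι ι ℂ) :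
    opNormInf M = ((univ.sup fun i => ∑ j, ‖M i j‖₊ : NNReal) : ℝ) := by
  rw [← Matrix.linfty_opNorm_def, Matrix.linfty_opNorm_eq_opNorm]
  rfl

theorem sum_norm_le_opNormInf {ι : Type*} [Fintype ι] [DecidableEq ι] (M : Matrix ι ι ℂ) (x : ι) :
    ∑ y, ‖M x y‖ ≤ opNormInf M := by
  rw [opNormInf_eq]
  have := Finset.le_sup (f := fun i => ∑ j, ‖M i j‖₊) (mem_univ x)
  have h := NNReal.coe_le_coe.2 this
  push_cast at h
  simpa using h

theorem opNormInf_le {ι : Type*} [Fintype ι] [DecidableEq ι] (M : Matrix ι ι ℂ) {c : ℝ}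
    (hc : 0 ≤ c) (h : ∀ x, ∑ y, ‖M x y‖ ≤ c) : opNormInf M ≤ c := by
  rw [opNormInf_eq]
  lift c to NNReal using hc
  refine NNReal.coe_le_coe.2 (Finset.sup_le fun x _ => ?_)
  rw [← NNReal.coe_le_coe]
  push_cast
  exact h x

theorem opNormInf_nonneg {ι : Type*} [Fintype ι] [DecidableEq ι] (M : Matrix ι ι ℂ) :
    0 ≤ opNormInf M := norm_nonneg _

theorem opNormInf_pauliSum_le {n N : ℕ} (a : Fin N → ℝ) (P : Fin N → Fin n → Pauli) :
    opNormInf (pauliSum a P) ≤ ∑ α, |a α| := by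
  refine opNormInf_le _ (Finset.sum_nonneg fun _ _ => abs_nonneg _) fun x => ?_
  calc ∑ y, ‖pauliSum a P x y‖ ≤ ∑ y, ∑ α, |a α| * ‖pauliString (P α) x y‖ := by
        refine Finset.sum_le_sum fun y _ => ?_
        rw [pauliSum, Matrix.sum_apply]
        refine (norm_sum_le _ _).trans (Finset.sum_le_sum fun α _ => ?_)
        simp
    _ = ∑ α, |a α| * ∑ y, ‖pauliString (P α) x y‖ := by
        rw [Finset.sum_comm]; simp_rw [Finset.mul_sum]
    _ = _ := by simp [sum_norm_pauliString]

/-- Schur test: the numerical range of a Hermitian matrix is bounded by its row sums. -/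
theorem norm_dotProduct_mulVec_le {ι : Type*} [Fintype ι] [DecidableEq ι] {M : Matrix ι ι ℂ}
    (hM : M.IsHermitian) (v : ι → ℂ) :
    ‖∑ x, ∑ y, star (v x) * M x y * v y‖ ≤ opNormInf M * ∑ x, ‖v x‖ ^ 2 := by
  have hs : ∀ x y, ‖M x y‖ = ‖M y x‖ := fun x y => by
    rw [← hM.apply y x, norm_star]
  calc _ ≤ ∑ x, ∑ y, (‖M x y‖ * ‖v x‖ ^ 2 / 2 + ‖M x y‖ * ‖v y‖ ^ 2 / 2) := by
        refine (norm_sum_le _ _).trans (Finset.sum_le_sum fun x _ =>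
          (norm_sum_le _ _).trans (Finset.sum_le_sum fun y _ => ?_))
        rw [norm_mul, norm_mul, norm_star]
        -- The inequality |v_x| |v_y| ≤ (|v_x|² + |v_y|²)/2. Hermitian symmetry then merges the two
        -- halves into row sums.
        nlinarith [mul_nonneg (norm_nonneg (M x y)) (sq_nonneg (‖v x‖ - ‖v y‖))]
    _ = ∑ x, (∑ y, ‖M x y‖) * ‖v x‖ ^ 2 := by
        simp_rw [Finset.sum_add_distrib]
        have : ∑ x, ∑ y, ‖M x y‖ * ‖v y‖ ^ 2 / 2 = ∑ x, ∑ y, ‖M x y‖ * ‖v x‖ ^ 2 / 2 := by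
          rw [Finset.sum_comm]
          simp_rw [hs]
        rw [this, ← Finset.sum_add_distrib]
        refine Finset.sum_congr rfl fun x _ => ?_
        rw [← Finset.sum_add_distrib, Finset.sum_mul]
        exact Finset.sum_congr rfl fun y _ => by ring
    _ ≤ ∑ x, opNormInf M * ‖v x‖ ^ 2 := by
        gcongr with x
        exact sum_norm_le_opNormInf M x
    _ = _ := by rw [Finset.mul_sum]

theorem elemSymm_eq_zero {ι : Type*} [DecidableEq ι] (s : Finset ι) (lam : ι → ℝ) {l : ℕ}
    (h : #{a ∈ s | lam a ≠ 0} < l) : elemSymm s lam l = 0 := by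
  induction s using Finset.induction_on generalizing l with
  | empty =>
    obtain ⟨l, rfl⟩ : ∃ l', l = l' + 1 := ⟨l - 1, by simp at h; omega⟩
    exact elemSymm_empty _ _
  | insert a s ha ih =>
    obtain ⟨l, rfl⟩ : ∃ l', l = l' + 1 := ⟨l - 1, by omega⟩
    rw [elemSymm_insert ha]
    rw [Finset.filter_insert] at h
    split_ifs at h with h0
    · rw [Finset.card_insert_of_notMem (by simp [ha])] at h
      rw [ih (by omega), ih (by omega)]; simp
    · rw [ih h]
      simp only [ne_eq, not_not] at h0
      simp [h0]

open scoped ComplexOrder in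
-- Everything needed from quantum states: λ are the eigenvalues of ρ and μ the diagonal of M in an
-- eigenbasis of ρ, bounded by the Schur test. The rank counts the nonzero eigenvalues, so any
-- product of more than rank-many of them vanishes.
theorem exists_spectral_data {n : ℕ} {M ρ : Matrix (Fin n → Bool) (Fin n → Bool) ℂ}
    (hM : M.IsHermitian) (hρ : IsState ρ) :
    ∃ lam mu : (Fin n → Bool) → ℝ, (∀ a, 0 ≤ lam a) ∧ ∑ a, lam a = 1 ∧
      elemSymm univ lam (ρ.rank + 1) = 0 ∧ (∀ a, |mu a| ≤ opNormInf M) ∧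
      (∀ i : ℕ, (M * ρ ^ i).trace = ((∑ a, mu a * lam a ^ i : ℝ) : ℂ)) ∧
      ∀ i : ℕ, (ρ ^ i).trace = ((∑ a, lam a ^ i : ℝ) : ℂ) := by
  have hH := hρ.1.isHermitian
  set U : Matrix (Fin n → Bool) (Fin n → Bool) ℂ := hH.eigenvectorUnitary.1 with hU
  set lam := hH.eigenvalues with hlam
  set Dg : Matrix (Fin n → Bool) (Fin n → Bool) ℂ :=
    Matrix.diagonal fun a => (lam a : ℂ) with hDg
  have hUU : star U * U = 1 := Unitary.coe_star_mul_self hH.eigenvectorUnitary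
  have hsp : ρ = U * Dg * star U := by
    have := hH.spectral_theorem
    rw [Unitary.conjStarAlgAut_apply] at this
    exact this
  have hpow : ∀ i : ℕ, ρ ^ i = U * Dg ^ i * star U := by
    intro i
    induction i with
    | zero =>
      rw [pow_zero, pow_zero, mul_one]
      exact (Unitary.coe_mul_star_self hH.eigenvectorUnitary).symm
    | succ i ih =>
      rw [pow_succ, ih, hsp, pow_succ]
      simp only [mul_assoc]
      rw [← mul_assoc (star U) U, hUU, one_mul]
  have hDpow : ∀ i : ℕ, Dg ^ i = Matrix.diagonal fun a => (lam a : ℂ) ^ i := fun i => by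
    rw [hDg, Matrix.diagonal_pow]; rfl
  have htr : ∀ (K : Matrix (Fin n → Bool) (Fin n → Bool) ℂ) (i : ℕ),
      (K * ρ ^ i).trace = ∑ a, (star U * K * U) a a * (lam a : ℂ) ^ i := by
    intro K i
    rw [hpow, ← mul_assoc, Matrix.trace_mul_comm, ← mul_assoc, ← mul_assoc, hDpow]
    simp only [Matrix.trace, Matrix.diag, Matrix.mul_diagonal]
  have hHM : (star U * M * U).IsHermitian := by
    have := Matrix.isHermitian_conjTranspose_mul_mul U hM
    exact this
  have hreal : ∀ a, (((star U * M * U) a a).re : ℂ) = (star U * M * U) a a := fun a =>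
    hHM.coe_re_apply_self a
  have htr1 : ∀ i : ℕ, (ρ ^ i).trace = ((∑ a, lam a ^ i : ℝ) : ℂ) := by
    intro i
    have := htr 1 i
    rw [one_mul, mul_one, hUU] at this
    rw [this]; push_cast
    exact Finset.sum_congr rfl fun a _ => by simp
  refine ⟨lam, fun a => ((star U * M * U) a a).re, fun a => hρ.1.eigenvalues_nonneg a, ?_, ?_, ?_,
    ?_, htr1⟩
  · have := htr1 1
    rw [pow_one, hρ.2] at this
    simp only [pow_one] at this
    exact_mod_cast this.symm
  · refine elemSymm_eq_zero _ _ ?_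
    rw [hH.rank_eq_card_non_zero_eigs, Fintype.card_subtype]
    exact Nat.lt_succ_self _
  · intro a
    have e : (star U * M * U) a a = ∑ x, ∑ y, star (U x a) * M x y * U y a := by
      rw [Matrix.mul_apply]
      simp only [Matrix.mul_apply, Matrix.star_apply, Finset.sum_mul]
      rw [Finset.sum_comm]
    have h1 := norm_dotProduct_mulVec_le hM fun x => U x a
    rw [← e] at h1
    have h2 : ∑ x, ‖U x a‖ ^ 2 = 1 := by
      have h3 : (star U * U) a a = 1 := by rw [hUU]; simp
      rw [Matrix.mul_apply] at h3
      have h4 : ∀ x, (star U) a x * U x a = ((‖U x a‖ ^ 2 : ℝ) : ℂ) := fun x => by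
        rw [Matrix.star_apply, ← Complex.normSq_eq_norm_sq, Complex.normSq_eq_conj_mul_self]; rfl
      simp_rw [h4] at h3
      exact_mod_cast h3
    rw [h2, mul_one] at h1
    exact (Complex.abs_re_le_norm _).trans h1
  · intro i
    rw [htr M i]; push_cast
    exact Finset.sum_congr rfl fun a _ => by rw [hreal]

theorem IsState.one_le_rank {n : ℕ} {ρ : Matrix (Fin n → Bool) (Fin n → Bool) ℂ}
    (h : IsState ρ) : 1 ≤ ρ.rank := by
  obtain ⟨lam, _, _, hsum, h0, _⟩ := exists_spectral_data Matrix.isHermitian_zero h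
  by_contra hr
  rw [show ρ.rank = 0 by omega, zero_add, elemSymm_one, hsum] at h0
  exact one_ne_zero h0

end

/-! ### Matrices on registers and ancillas -/

/-- Tensor product of matrices. -/
def tensorMat {m : ℕ} {κ : Type*} (A : Fin m → Matrix κ κ ℂ) :
    Matrix (Fin m → κ) (Fin m → κ) ℂ :=
  fun z w => ∏ i, A i (z i) (w i)

/-- The operator that permutes the tensor factors. -/
def relabelMat {m : ℕ} {κ : Type*} [DecidableEq κ] (f : Fin m → Fin m) :
    Matrix (Fin m → κ) (Fin m → κ) ℂ :=
  fun z w => if z = w ∘ f then 1 else 0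

/-- An operator on the registers controlled by the ancillas. -/
def ctrlMat {ι κ : Type*} [DecidableEq ι] (W : ι → Matrix κ κ ℂ) :
    Matrix (ι × κ) (ι × κ) ℂ :=
  fun s s' => if s.1 = s'.1 then W s.1 s.2 s'.2 else 0

/-- An operator on the ancillas. -/
def ancMat {ι κ : Type*} [DecidableEq κ] (A : Matrix ι ι ℂ) : Matrix (ι × κ) (ι × κ) ℂ :=
  fun s s' => if s.2 = s'.2 then A s.1 s'.1 else 0

section
open Finset

theorem tensorMat_mul {m : ℕ} {κ : Type*} [Fintype κ] [DecidableEq κ] (A B : Fin m → Matrix κ κ ℂ) :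
    tensorMat A * tensorMat B = tensorMat fun i => A i * B i := by
  ext z w
  simp only [Matrix.mul_apply, tensorMat, ← Finset.prod_mul_distrib]
  rw [Finset.prod_univ_sum, Fintype.piFinset_univ]

theorem tensorMat_one {m : ℕ} {κ : Type*} [DecidableEq κ] :
    tensorMat (fun _ : Fin m => (1 : Matrix κ κ ℂ)) = 1 := by
  ext z w
  simp only [tensorMat, Matrix.one_apply]
  split_ifs with h
  · exact Finset.prod_eq_one fun i _ => by simp [h]
  · obtain ⟨i, hi⟩ := Function.ne_iff.1 h
    exact Finset.prod_eq_zero (mem_univ i) (by simp [hi])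

theorem conjTranspose_tensorMat {m : ℕ} {κ : Type*} (A : Fin m → Matrix κ κ ℂ) :
    (tensorMat A).conjTranspose = tensorMat fun i => (A i).conjTranspose := by
  ext z w
  simp [tensorMat, Matrix.conjTranspose_apply]

theorem trace_tensorMat {m : ℕ} {κ : Type*} [Fintype κ] [DecidableEq κ]
    (A : Fin m → Matrix κ κ ℂ) : (tensorMat A).trace = ∏ i, (A i).trace := by
  simp only [Matrix.trace, Matrix.diag, tensorMat]
  rw [Finset.prod_univ_sum, Fintype.piFinset_univ]

open scoped ComplexOrder MatrixOrder in
theorem posSemidef_tensorMat {m : ℕ} {κ : Type*} [Fintype κ] [DecidableEq κ] {A : Matrix κ κ ℂ}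
    (hA : A.PosSemidef) : (tensorMat fun _ : Fin m => A).PosSemidef := by
  obtain ⟨B, hB⟩ := CStarAlgebra.nonneg_iff_eq_star_mul_self.mp hA.nonneg
  rw [Matrix.star_eq_conjTranspose] at hB
  subst hB
  have : (tensorMat fun _ : Fin m => B.conjTranspose * B)
      = (tensorMat fun _ : Fin m => B).conjTranspose * tensorMat fun _ : Fin m => B := by
    rw [conjTranspose_tensorMat, tensorMat_mul]
  rw [this]
  exact Matrix.posSemidef_conjTranspose_mul_self _

theorem relabelMat_id {m : ℕ} {κ : Type*} [DecidableEq κ] :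
    (relabelMat id : Matrix (Fin m → κ) (Fin m → κ) ℂ) = 1 := by
  ext z w
  simp [relabelMat, Matrix.one_apply]

theorem mul_relabelMat_apply {m : ℕ} {κ : Type*} [Fintype κ] [DecidableEq κ]
    (A : Matrix (Fin m → κ) (Fin m → κ) ℂ) (f : Fin m → Fin m) (z w : Fin m → κ) :
    (A * relabelMat f : Matrix (Fin m → κ) (Fin m → κ) ℂ) z w = A z (w ∘ f) := by
  simp [Matrix.mul_apply, relabelMat]

theorem relabelMat_mul {m : ℕ} {κ : Type*} [Fintype κ] [DecidableEq κ] (f g : Fin m → Fin m) :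
    (relabelMat f * relabelMat g : Matrix (Fin m → κ) (Fin m → κ) ℂ) = relabelMat (g ∘ f) := by
  ext z w
  rw [mul_relabelMat_apply]
  rfl

theorem relabelMat_mul_apply {m : ℕ} {κ : Type*} [Fintype κ] [DecidableEq κ]
    (A : Matrix (Fin m → κ) (Fin m → κ) ℂ) (e : Equiv.Perm (Fin m)) (z w : Fin m → κ) :
    (relabelMat e * A : Matrix (Fin m → κ) (Fin m → κ) ℂ) z w = A (z ∘ e.symm) w := by
  have : ∀ v : Fin m → κ, (z = v ∘ e) ↔ v = z ∘ e.symm := fun v => by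
    constructor
    · rintro rfl; ext; simp
    · rintro rfl; ext; simp
  simp [Matrix.mul_apply, relabelMat, this]

theorem relabelMat_mul_apply_of_involutive {m : ℕ} {κ : Type*} [Fintype κ] [DecidableEq κ]
    (A : Matrix (Fin m → κ) (Fin m → κ) ℂ) {f : Fin m → Fin m} (hf : f.Involutive)
    (z w : Fin m → κ) : (relabelMat f * A : Matrix (Fin m → κ) (Fin m → κ) ℂ) z w = A (z ∘ f) w := by
  have := relabelMat_mul_apply A hf.toPerm z w
  rwa [hf.toPerm_symm, hf.coe_toPerm] at this

theorem conjTranspose_relabelMat {m : ℕ} {κ : Type*} [DecidableEq κ] {f : Fin m → Fin m}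
    (hf : f.Involutive) :
    (relabelMat f : Matrix (Fin m → κ) (Fin m → κ) ℂ).conjTranspose = relabelMat f := by
  ext z w
  have : w = z ∘ f ↔ z = w ∘ f := by
    constructor <;> (rintro rfl; ext i; simp [hf i])
  simp only [Matrix.conjTranspose_apply, relabelMat, this]
  split_ifs <;> simp

theorem relabelMat_mul_tensorMat {m : ℕ} {κ : Type*} [Fintype κ] [DecidableEq κ]
    {f : Fin m → Fin m} (hf : f.Involutive) (A : Matrix κ κ ℂ) :
    relabelMat f * (tensorMat fun _ => A) = (tensorMat fun _ => A) * relabelMat f := by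
  ext z w
  rw [relabelMat_mul_apply_of_involutive _ hf, mul_relabelMat_apply]
  simp only [tensorMat]
  exact Fintype.prod_equiv hf.toPerm _ _ fun i => by simp [hf i]

theorem ctrlMat_mul {ι κ : Type*} [Fintype ι] [DecidableEq ι] [Fintype κ]
    (V W : ι → Matrix κ κ ℂ) : ctrlMat V * ctrlMat W = ctrlMat fun x => V x * W x := by
  ext s s'
  simp only [Matrix.mul_apply, ctrlMat, Fintype.sum_prod_type]
  rw [Finset.sum_eq_single s.1 (fun b _ hb => by simp [hb.symm]) (by simp)]
  by_cases h : s.1 = s'.1 <;> simp [h]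

theorem ancMat_mul {ι κ : Type*} [Fintype ι] [DecidableEq κ] [Fintype κ]
    (A B : Matrix ι ι ℂ) : (ancMat A * ancMat B : Matrix (ι × κ) (ι × κ) ℂ) = ancMat (A * B) := by
  ext s s'
  simp only [Matrix.mul_apply, ancMat, Fintype.sum_prod_type_right]
  rw [Finset.sum_eq_single s.2 (fun b _ hb => by simp [hb.symm]) (by simp)]
  by_cases h : s.2 = s'.2 <;> simp [h]

theorem ancMat_one {ι κ : Type*} [DecidableEq ι] [DecidableEq κ] :
    (ancMat 1 : Matrix (ι × κ) (ι × κ) ℂ) = 1 := by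
  ext s s'
  simp only [ancMat, Matrix.one_apply, Prod.ext_iff]
  split_ifs <;> simp_all

theorem ctrlMat_one {ι κ : Type*} [DecidableEq ι] [DecidableEq κ] :
    (ctrlMat fun _ => 1 : Matrix (ι × κ) (ι × κ) ℂ) = 1 := by
  ext s s'
  simp only [ctrlMat, Matrix.one_apply, Prod.ext_iff]
  split_ifs <;> simp_all

/-- An operator on the register `0`. -/
def regMat {m : ℕ} {κ : Type*} [DecidableEq κ] (A : Matrix κ κ ℂ) :
    Matrix (Fin (m + 1) → κ) (Fin (m + 1) → κ) ℂ :=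
  tensorMat fun i => if i = 0 then A else 1

theorem regMat_mul {m : ℕ} {κ : Type*} [Fintype κ] [DecidableEq κ] (A B : Matrix κ κ ℂ) :
    (regMat A * regMat B : Matrix (Fin (m + 1) → κ) _ ℂ) = regMat (A * B) := by
  rw [regMat, regMat, tensorMat_mul, regMat]
  congr 1; ext1 i; split_ifs <;> simp

theorem regMat_one {m : ℕ} {κ : Type*} [DecidableEq κ] :
    (regMat 1 : Matrix (Fin (m + 1) → κ) _ ℂ) = 1 := by
  rw [regMat, ← tensorMat_one]; congr 1; ext1 i; split_ifs <;> rfl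

theorem conjTranspose_regMat {m : ℕ} {κ : Type*} [DecidableEq κ] (A : Matrix κ κ ℂ) :
    (regMat A : Matrix (Fin (m + 1) → κ) _ ℂ).conjTranspose = regMat A.conjTranspose := by
  rw [regMat, conjTranspose_tensorMat, regMat]
  congr 1; ext1 i; split_ifs <;> simp

theorem relabelMat_mul_regMat {m : ℕ} {κ : Type*} [Fintype κ] [DecidableEq κ]
    {f : Fin (m + 1) → Fin (m + 1)} (hf : f.Involutive) (h0 : f 0 = 0) (A : Matrix κ κ ℂ) :
    relabelMat f * regMat A = regMat A * relabelMat f := by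
  ext z w
  rw [relabelMat_mul_apply_of_involutive _ hf, mul_relabelMat_apply]
  simp only [regMat, tensorMat]
  refine Fintype.prod_equiv hf.toPerm _ _ fun i => ?_
  rw [hf.coe_toPerm, Function.comp_apply, Function.comp_apply, hf i]
  rcases eq_or_ne i 0 with rfl | hi
  · rw [h0]
  · have : f i ≠ 0 := fun h => hi (by rw [← hf i, h, h0])
    rw [if_neg hi, if_neg this]

theorem regMat_cons {m : ℕ} {κ : Type*} [DecidableEq κ] (A : Matrix κ κ ℂ) (c d : κ)
    (z w : Fin m → κ) :
    regMat A (Fin.cons c z : Fin (m + 1) → κ) (Fin.cons d w) = if z = w then A c d else 0 := by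
  have h := congrFun (congrFun (tensorMat_one (m := m) (κ := κ)) z) w
  simp only [tensorMat, Matrix.one_apply] at h
  simp only [regMat, tensorMat, Fin.prod_univ_succ, Fin.cons_zero, Fin.cons_succ,
    Fin.succ_ne_zero, if_false, if_true, Matrix.one_apply, h]
  split_ifs <;> simp

theorem sum_fin_succ_fun {m : ℕ} {κ : Type*} [Fintype κ] (F : (Fin (m + 1) → κ) → ℂ) :
    ∑ z, F z = ∑ c, ∑ z : Fin m → κ, F (Fin.cons c z) := by
  rw [← Fintype.sum_prod_type']
  exact (Fintype.sum_equiv (Fin.consEquiv fun _ => κ) _ _ fun _ => rfl).symm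

/-- Powers of a matrix as sums over paths. -/
theorem sum_path {j : ℕ} {κ : Type*} [Fintype κ] [DecidableEq κ] (A : Matrix κ κ ℂ)
    (g h : κ → ℂ) :
    ∑ w : Fin (j + 1) → κ, g (w 0) * ((∏ i : Fin j, A (w i.castSucc) (w i.succ)) * h (w (Fin.last j)))
      = ∑ x, ∑ y, g x * ((A ^ j) x y * h y) := by
  induction j generalizing g with
  | zero =>
    rw [sum_fin_succ_fun]
    refine Finset.sum_congr rfl fun x _ => ?_
    simp [Matrix.one_apply]
  | succ j ih =>
    rw [sum_fin_succ_fun]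
    refine Finset.sum_congr rfl fun x _ => ?_
    -- The first edge of the path is absorbed into the initial weight.
    have := ih (fun y => A x y)
    have e : ∀ w : Fin (j + 1) → κ, g ((Fin.cons x w : Fin (j + 2) → κ) 0) *
        ((∏ i : Fin (j + 1), A ((Fin.cons x w : Fin (j + 2) → κ) i.castSucc)
          ((Fin.cons x w : Fin (j + 2) → κ) i.succ)) * h ((Fin.cons x w : Fin (j + 2) → κ)
            (Fin.last (j + 1))))
        = g x * (A x (w 0) * ((∏ i : Fin j, A (w i.castSucc) (w i.succ)) * h (w (Fin.last j)))) := by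
      intro w
      rw [Fin.prod_univ_succ, ← Fin.succ_last, Fin.cons_succ]
      simp only [Fin.castSucc_zero, Fin.cons_zero, Fin.cons_succ, ← Fin.succ_castSucc]
      ring
    simp_rw [e]
    rw [← Finset.mul_sum, this, ← Finset.mul_sum]
    congr 1
    rw [Finset.sum_comm]
    refine Finset.sum_congr rfl fun y _ => ?_
    rw [pow_succ', Matrix.mul_apply, Finset.sum_mul]
    exact Finset.sum_congr rfl fun _ _ => by ring

/-- The trace of a cyclic shift of the registers. -/
theorem trace_regMat_mul_shift {j : ℕ} {κ : Type*} [Fintype κ] [DecidableEq κ]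
    (A ρ : Matrix κ κ ℂ) :
    (regMat A * (relabelMat (fun i : Fin (j + 1) => i + 1) * tensorMat fun _ => ρ)).trace
      = (A * ρ ^ (j + 1)).trace := by
  -- The shift pairs the row of register i with the column of register i + 1; the last register
  -- closes the cycle at register 0.
  have e : ∀ w z : Fin (j + 1) → κ,
      (relabelMat (fun i : Fin (j + 1) => i + 1) * (tensorMat fun _ => ρ) :
        Matrix (Fin (j + 1) → κ) (Fin (j + 1) → κ) ℂ) w z
        = (∏ i : Fin j, ρ (w i.castSucc) (z i.succ)) * ρ (w (Fin.last j)) (z 0) := by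
    intro w z
    have := relabelMat_mul_apply (tensorMat fun _ => ρ) (Equiv.addRight (1 : Fin (j + 1))) w z
    rw [show (⇑(Equiv.addRight (1 : Fin (j + 1)))) = fun i => i + 1 from rfl] at this
    rw [this]
    simp only [tensorMat]
    rw [← Fintype.prod_equiv (Equiv.addRight (1 : Fin (j + 1)))
      (fun i => ρ (w i) (z (i + 1))) _ (fun i => by simp), Fin.prod_univ_castSucc]
    simp
  have e2 : ∀ c : κ, ∑ w : Fin (j + 1) → κ, A c (w 0) *
      ((∏ i : Fin j, ρ (w i.castSucc) (w i.succ)) * ρ (w (Fin.last j)) c)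
      = (A * ρ ^ (j + 1)) c c := by
    intro c
    rw [sum_path ρ (fun x => A c x) (fun y => ρ y c), Matrix.mul_apply]
    refine Finset.sum_congr rfl fun x _ => ?_
    rw [pow_succ, Matrix.mul_apply, Finset.mul_sum]
  simp only [Matrix.trace, Matrix.diag]
  simp_rw [← e2]
  rw [sum_fin_succ_fun]
  refine Finset.sum_congr rfl fun c _ => ?_
  rw [sum_fin_succ_fun]
  simp only [Matrix.mul_apply (M := regMat A)]
  simp_rw [sum_fin_succ_fun (m := j)]
  rw [Finset.sum_comm]
  refine Finset.sum_congr rfl fun d _ => ?_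
  refine Finset.sum_congr rfl fun z _ => ?_
  rw [Finset.sum_eq_single z (fun b _ hb => by rw [regMat_cons, if_neg hb.symm, zero_mul]) (by simp),
    regMat_cons, if_pos rfl, e]
  simp

end

/-! ### The circuit -/

/-- The Hadamard matrix. -/
noncomputable def hadamardMat : Matrix Bool Bool ℂ :=
  fun x y => (if x && y then -1 else 1) * ((Real.sqrt 2)⁻¹ : ℝ)

theorem hadamardMat_mem : hadamardMat ∈ Matrix.unitaryGroup Bool ℂ := by
  have h : (((Real.sqrt 2)⁻¹ : ℝ) : ℂ) * ((Real.sqrt 2)⁻¹ : ℝ) = 1 / 2 := by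
    rw [← Complex.ofReal_mul, ← mul_inv, Real.mul_self_sqrt (by norm_num)]
    norm_num
  rw [Matrix.mem_unitaryGroup_iff]
  ext x y
  rw [Matrix.mul_apply, Fintype.sum_bool]
  simp only [Matrix.star_apply, hadamardMat, star_mul', Complex.star_def, Complex.conj_ofReal]
  cases x <;> cases y <;> simp only [Bool.and_true, Bool.and_false, Bool.false_eq_true, if_false,
    if_true, map_one, map_neg, Matrix.one_apply, one_mul, neg_mul, mul_neg, h] <;> norm_num

section
open Finset

variable {n a m : ℕ}

theorem op_one (o : Fin a → Bool) (q : Fin a) (U : Matrix.unitaryGroup Bool ℂ) :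
    (Gate.one q U : Gate n a m).op o
      = ancMat (tensorMat (Pi.mulSingle q (U : Matrix Bool Bool ℂ))) := by
  ext s s'
  simp only [Gate.op, ancMat, tensorMat]
  by_cases h2 : s.2 = s'.2
  · simp only [h2, and_true, if_true]
    rw [← Finset.mul_prod_erase univ _ (mem_univ q), Pi.mulSingle_eq_same]
    split_ifs with h
    · rw [Finset.prod_eq_one, mul_one]
      intro i hi
      have hi := (Finset.mem_erase.1 hi).1
      rw [Pi.mulSingle_eq_of_ne hi, h i hi, Matrix.one_apply_eq]
    · push Not at h
      obtain ⟨i, hi, hne⟩ := h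
      rw [Finset.prod_eq_zero (Finset.mem_erase.2 ⟨hi, mem_univ i⟩), mul_zero]
      rw [Pi.mulSingle_eq_of_ne hi, Matrix.one_apply_ne hne]
  · simp [h2]

theorem prod_op_one (o : Fin a → Bool) (U : Matrix.unitaryGroup Bool ℂ) (l : List (Fin a))
    (hl : l.Nodup) :
    ((l.map fun q => (Gate.one q U : Gate n a m)).map (Gate.op o)).prod
      = ancMat (tensorMat fun i => if i ∈ l then (U : Matrix Bool Bool ℂ) else 1) := by
  induction l with
  | nil => simp [tensorMat_one, ancMat_one]
  | cons q l ih =>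
    rw [List.nodup_cons] at hl
    rw [List.map_cons, List.map_cons, List.prod_cons, ih hl.2, op_one, ancMat_mul, tensorMat_mul]
    congr 2
    ext1 i
    rcases eq_or_ne i q with rfl | hi
    · simp [hl.1]
    · simp [hi]

theorem op_cswap (o : Fin a → Bool) (c : Fin a) (x y : Fin m) (h : x ≠ y) :
    (Gate.cswap c x y h : Gate n a m).op o
      = ctrlMat fun b => relabelMat (if b c then ⇑(Equiv.swap x y) else id) := by
  ext s s'
  simp only [Gate.op, ctrlMat, relabelMat, Prod.ext_iff]
  by_cases h1 : s.1 = s'.1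
  · simp only [h1, true_and, if_true]
    split_ifs <;> simp_all
  · simp [h1]

/-- The controlled swap of `i` and `f i`. -/
def swapGate (f : Fin m → Fin m) (i : Fin m) : Option (Gate n m m) :=
  -- The condition lists every 2-cycle once and drops fixed points. The control is the ancilla
  -- numbered by the smaller element of the cycle.
  if h : i < f i then some (.cswap i i (f i) h.ne) else none

theorem prod_op_swapGate (o : Fin m → Bool) {f : Fin m → Fin m} (hf : f.Involutive)
    (l : List (Fin m)) (hl : l.Nodup) :
    ((l.filterMap (swapGate (n := n) f)).map (Gate.op o)).prod
      = ctrlMat fun b => relabelMat fun i =>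
          if min i (f i) ∈ l ∧ b (min i (f i)) then f i else i := by
  induction l with
  | nil =>
    simp only [List.filterMap_nil, List.map_nil, List.prod_nil, List.not_mem_nil, false_and,
      if_false]
    exact (congrArg ctrlMat (funext fun _ => relabelMat_id)).trans ctrlMat_one |>.symm
  | cons q l ih =>
    rw [List.nodup_cons] at hl
    rw [List.filterMap_cons]
    have ih := ih hl.2
    by_cases hq : q < f q
    · rw [swapGate, dif_pos hq]
      simp only [List.map_cons, List.prod_cons, ih, op_cswap, ctrlMat_mul, relabelMat_mul]
      congr 1
      ext1 b
      congr 1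
      ext1 i
      have hmq : min q (f q) = q := min_eq_left hq.le
      have hmq' : min (f q) (f (f q)) = q := by rw [hf q]; exact min_eq_right hq.le
      rcases eq_or_ne i q with rfl | h1
      · by_cases hb : b i <;> simp [hb, hl.1, hmq, hf i, min_comm (f i) i]
      rcases eq_or_ne i (f q) with rfl | h2
      · by_cases hb : b q <;> simp [hb, hl.1, hmq, hf q, min_comm (f q) q]
      · have h3 : min i (f i) ≠ q := by
          intro h
          rcases min_choice i (f i) with h' | h'
          · exact h1 (h'.symm.trans h)
          · exact h2 (by rw [← h, h', hf i])
        by_cases hb : b q <;> simp [hb, h3, Equiv.swap_apply_of_ne_of_ne h1 h2]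
    · rw [swapGate, dif_neg hq]
      rw [ih]
      congr 1
      ext1 b
      congr 1
      ext1 i
      rcases eq_or_ne (f i) i with h | h
      · simp [h]
      · have h3 : min i (f i) ≠ q := by
          intro h'
          apply hq
          rw [← h']
          rcases min_choice i (f i) with h'' | h''
          · rw [h'']; exact lt_of_le_of_ne (min_eq_left_iff.1 h'') h.symm
          · rw [h'', hf i]; exact lt_of_le_of_ne (min_eq_right_iff.1 h'') h
        simp [h3]

theorem op_cpauli (o : Fin (m + 1) → Bool) (P : Fin n → Pauli) :
    (Gate.cpauli 0 0 P : Gate n (m + 1) (m + 1)).op o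
      = ctrlMat fun b => regMat (if b 0 then pauliString P else 1) := by
  ext ⟨b, z⟩ ⟨b', w⟩
  simp only [Gate.op, ctrlMat]
  by_cases h1 : b = b'
  · subst h1
    rw [← Fin.cons_self_tail z, ← Fin.cons_self_tail w, regMat_cons]
    simp only [true_and, if_true, Fin.cons_zero]
    have : (∀ y : Fin (m + 1), y ≠ 0 → (Fin.cons (z 0) (Fin.tail z) : Fin (m + 1) → Fin n → Bool) y
        = (Fin.cons (w 0) (Fin.tail w) : Fin (m + 1) → Fin n → Bool) y) ↔ Fin.tail z = Fin.tail w := by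
      constructor
      · intro h; ext1 i; simpa using h i.succ (Fin.succ_ne_zero i)
      · intro h y hy
        obtain ⟨i, rfl⟩ := Fin.exists_succ_eq.2 hy
        rw [Fin.cons_succ, Fin.cons_succ, h]
    simp only [this]
    split_ifs <;> simp_all [Matrix.one_apply]
  · simp [h1]

theorem prod_op_meas (o : Fin a → Bool) (l : List (Fin a)) :
    ((l.map fun q => (Gate.meas q : Gate n a m)).map (Gate.op o)).prod
      = Matrix.diagonal fun s => if ∀ q ∈ l, s.1 q = o q then 1 else 0 := by
  induction l with
  | nil => simp
  | cons q l ih =>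
    have : (Gate.meas q : Gate n a m).op o
        = Matrix.diagonal fun s => if s.1 q = o q then 1 else 0 := by
      ext s s'
      by_cases h : s = s' <;> simp [Gate.op, h]
    rw [List.map_cons, List.map_cons, List.prod_cons, ih, this, Matrix.diagonal_mul_diagonal]
    congr 1
    ext1 s
    by_cases h : s.1 q = o q <;> simp [h]

/-- One-qubit gates on all the ancillas. -/
def oneLayer (U : Matrix.unitaryGroup Bool ℂ) : Layer n a m where
  gates := (List.finRange a).map fun q => .one q U
  disj := by
    rw [List.pairwise_map]
    refine (List.nodup_finRange a).imp fun h => ?_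
    simpa [Gate.support] using h

/-- The controlled swaps of the pairs of an involution. -/
def swapLayer (f : Fin m → Fin m) (hf : f.Involutive) : Layer n m m where
  gates := (List.finRange m).filterMap (swapGate f)
  disj := by
    rw [List.pairwise_filterMap]
    refine (List.nodup_finRange m).imp fun {i i'} h g hg g' hg' => ?_
    unfold swapGate at hg hg'
    split_ifs at hg with h1
    split_ifs at hg' with h2
    simp only [Option.some.injEq] at hg hg'
    subst hg hg'
    have h3 : i ≠ f i' := fun e => by rw [e, hf i'] at h1; exact absurd h1 h2.not_gt
    have h4 : f i ≠ i' := fun e => by rw [← e, hf i] at h2; exact absurd h1 h2.not_gt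
    have h5 : f i ≠ f i' := fun e => h (hf.injective e)
    have h6 : i ≠ i' := h
    simp [Gate.support, h3.symm, h4.symm, h5.symm, h6.symm]

/-- A controlled Pauli string on the register `0`. -/
def pauliLayer (P : Fin n → Pauli) : Layer n (m + 1) (m + 1) where
  gates := [.cpauli 0 0 P]
  disj := List.pairwise_singleton _ _

/-- Measurement of all the ancillas. -/
def measLayer : Layer n a m where
  gates := (List.finRange a).map .meas
  disj := by
    rw [List.pairwise_map]
    refine (List.nodup_finRange a).imp fun h => ?_
    simpa [Gate.support] using h

/-- Unmeasured ancillas are recorded as `false`, so a unitary layer has a single possible record. -/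
theorem Layer.kraus_of_not_measures (L : Layer n a m) (h : ∀ q, ∀ g ∈ L.gates, ¬ g.Measures q)
    (o : Fin a → Bool) :
    L.kraus o = if o = fun _ => false then (L.gates.map (Gate.op o)).prod else 0 := by
  rw [Layer.kraus]
  congr 1
  refine propext ⟨fun h' => ?_, ?_⟩
  · ext q
    by_contra hq
    obtain ⟨g, hg, hg'⟩ := h' q (by simpa using hq)
    exact h q g hg hg'
  · rintro rfl q hq; simp at hq

theorem kraus_oneLayer (U : Matrix.unitaryGroup Bool ℂ) (o : Fin a → Bool) :
    (oneLayer U : Layer n a m).kraus o = if o = fun _ => false then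
      ancMat (tensorMat fun _ => (U : Matrix Bool Bool ℂ)) else 0 := by
  rw [Layer.kraus_of_not_measures]
  · rw [oneLayer, prod_op_one o U _ (List.nodup_finRange a)]
    simp
  · simp [oneLayer, Gate.Measures]

/-- The partial involution selected by the control bits. -/
def partialInv (f : Fin m → Fin m) (b : Fin m → Bool) (i : Fin m) : Fin m :=
  if b (min i (f i)) then f i else i

theorem kraus_swapLayer (f : Fin m → Fin m) (hf : f.Involutive) (o : Fin m → Bool) :
    (swapLayer f hf : Layer n m m).kraus o = if o = fun _ => false then
      ctrlMat fun b => relabelMat (partialInv f b) else 0 := by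
  rw [Layer.kraus_of_not_measures]
  · rw [swapLayer, prod_op_swapGate o hf _ (List.nodup_finRange m)]
    simp only [List.mem_finRange, true_and]
    rfl
  · intro q g hg
    simp only [swapLayer, List.mem_filterMap] at hg
    obtain ⟨i, _, hi⟩ := hg
    unfold swapGate at hi
    split_ifs at hi
    simp only [Option.some.injEq] at hi
    subst hi
    simp [Gate.Measures]

theorem kraus_pauliLayer (P : Fin n → Pauli) (o : Fin (m + 1) → Bool) :
    (pauliLayer P : Layer n (m + 1) (m + 1)).kraus o = if o = fun _ => false then
      ctrlMat fun b => regMat (if b 0 then pauliString P else 1) else 0 := by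
  rw [Layer.kraus_of_not_measures]
  · simp only [pauliLayer, List.map_cons, List.map_nil, List.prod_cons, List.prod_nil, mul_one,
      op_cpauli]
  · simp [pauliLayer, Gate.Measures]

theorem kraus_measLayer (o : Fin a → Bool) :
    (measLayer : Layer n a m).kraus o
      = Matrix.diagonal fun s => if s.1 = o then 1 else 0 := by
  rw [Layer.kraus, if_pos]
  · rw [measLayer, prod_op_meas]
    simp [funext_iff]
  · intro q _
    exact ⟨.meas q, by simp [measLayer], by simp [Gate.Measures]⟩

theorem partialInv_involutive {f : Fin m → Fin m} (hf : f.Involutive) (b : Fin m → Bool) :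
    (partialInv f b).Involutive := by
  intro i
  by_cases h : b (min i (f i))
  · have h' : b (min (f i) i) := by rwa [min_comm]
    simp [partialInv, h, hf i, h']
  · simp [partialInv, h]

/-- A pattern and its complement split the 2-cycles of f into two disjoint sets, so together they
perform every transposition exactly once. -/
theorem partialInv_comp_not {f : Fin m → Fin m} (hf : f.Involutive) (b : Fin m → Bool) :
    partialInv f b ∘ partialInv f (fun i => !b i) = f := by
  ext1 i
  by_cases h : b (min i (f i))
  · simp [partialInv, h]
  · have h' : ¬ b (min (f i) i) := by rwa [min_comm]
    simp [partialInv, h, hf i, h']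

end

/-! ### Fourier analysis of the ancillas. -/

section
open Finset

/-- The sign `(-1) ^ (b ⬝ x)`. -/
def boolSign {a : ℕ} (b x : Fin a → Bool) : ℝ := ∏ i, if b i && x i then -1 else 1

theorem tensorMat_hadamardMat {a : ℕ} (b x : Fin a → Bool) :
    tensorMat (fun _ => hadamardMat) b x = (boolSign b x : ℂ) * ((Real.sqrt 2)⁻¹ : ℝ) ^ a := by
  simp only [tensorMat, hadamardMat, Finset.prod_mul_distrib, Finset.prod_const, card_univ,
    Fintype.card_fin, boolSign]
  push_cast
  congr 1
  exact Finset.prod_congr rfl fun i _ => by split_ifs <;> simp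

theorem boolSign_false {a : ℕ} (b : Fin a → Bool) : boolSign b (fun _ => false) = 1 := by
  simp [boolSign]

/-- Orthogonality of the characters of (ℤ/2)^a. -/
theorem sum_boolSign {a : ℕ} (x y z : Fin a → Bool) :
    ∑ b, boolSign b z * boolSign b x * boolSign b y
      = if y = fun i => xor (x i) (z i) then (2 : ℝ) ^ a else 0 := by
  have h : ∀ b : Fin a → Bool, boolSign b z * boolSign b x * boolSign b y
      = ∏ i, (if b i && z i then (-1 : ℝ) else 1) * (if b i && x i then -1 else 1) *
        (if b i && y i then -1 else 1) := fun b => by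
    simp only [boolSign, Finset.prod_mul_distrib]
  simp_rw [h]
  have := Finset.prod_univ_sum (fun _ : Fin a => (univ : Finset Bool))
    (fun i β => (if β && z i then (-1 : ℝ) else 1) * (if β && x i then -1 else 1) *
        (if β && y i then -1 else 1))
  rw [Fintype.piFinset_univ] at this
  rw [← this]
  have h2 : ∀ i, ∑ β : Bool, (if β && z i then (-1 : ℝ) else 1) * (if β && x i then -1 else 1) *
        (if β && y i then -1 else 1) = if y i = xor (x i) (z i) then 2 else 0 := fun i => by
    rw [Fintype.sum_bool]
    cases x i <;> cases y i <;> cases z i <;> norm_num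
  simp_rw [h2]
  split_ifs with hxy
  · rw [hxy]; simp
  · obtain ⟨i, hi⟩ := Function.ne_iff.1 hxy
    exact Finset.prod_eq_zero (mem_univ i) (if_neg hi)

/-- The isometry that prepares the ancillas in the state `b`. -/
def prepMat {a : ℕ} (R : Type*) [DecidableEq R] (b : Fin a → Bool) :
    Matrix ((Fin a → Bool) × R) R ℂ :=
  fun s z => if s.1 = b ∧ s.2 = z then 1 else 0

/-- The operation on the registers when the ancillas control `W` and are read out as `b` in the
Hadamard basis. -/
noncomputable def branchMat {a : ℕ} {R : Type*} (W : (Fin a → Bool) → Matrix R R ℂ)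
    (b : Fin a → Bool) : Matrix R R ℂ :=
  ((2 : ℂ) ^ a)⁻¹ • ∑ x, (boolSign b x : ℂ) • W x

theorem mul_prepMat_apply {a : ℕ} {R S : Type*} [DecidableEq R] [Fintype R] (b : Fin a → Bool)
    (K : Matrix S ((Fin a → Bool) × R) ℂ) (s : S) (z : R) :
    (K * prepMat R b : Matrix S R ℂ) s z = K s (b, z) := by
  rw [Matrix.mul_apply, Finset.sum_eq_single (b, z)]
  · simp [prepMat]
  · rintro ⟨x, y⟩ _ h
    simp only [ne_eq, Prod.mk.injEq] at h
    simp [prepMat, h]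
  · simp

theorem conjTranspose_prepMat_mul {a : ℕ} {R : Type*} [DecidableEq R] [Fintype R]
    (b : Fin a → Bool) : (prepMat R b).conjTranspose * prepMat R b
      = 1 := by
  ext z w
  rw [mul_prepMat_apply]
  by_cases h : w = z
  · subst h; simp [prepMat]
  · simp [prepMat, h, Ne.symm h]

/-- Controlled operations between Hadamard matrices on the ancillas, followed by a measurement of
the ancillas. -/
noncomputable def interferometer {a : ℕ} {R : Type*} [DecidableEq R] [Fintype R]
    (W : (Fin a → Bool) → Matrix R R ℂ) (b : Fin a → Bool) :
    Matrix ((Fin a → Bool) × R) ((Fin a → Bool) × R) ℂ :=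
  Matrix.diagonal (fun s => if s.1 = b then (1 : ℂ) else 0) *
    (ancMat (tensorMat fun _ => hadamardMat) * ctrlMat W * ancMat (tensorMat fun _ => hadamardMat))

/-- The first Hadamard layer gives every pattern x the amplitude 2^(-a/2), and the second
contributes the sign of b · x and the same factor. The ancillas are left in the state b, so the run
acts on the registers alone. -/
theorem interferometer_mul_prepMat {a : ℕ} {R : Type*} [DecidableEq R] [Fintype R]
    (W : (Fin a → Bool) → Matrix R R ℂ) (b : Fin a → Bool) :
    (interferometer W b * prepMat R (fun _ : Fin a => false) : Matrix ((Fin a → Bool) × R) R ℂ)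
      = (prepMat R b * branchMat W b : Matrix ((Fin a → Bool) × R) R ℂ) := by
  have h2 : (((Real.sqrt 2)⁻¹ : ℝ) : ℂ) ^ a * (((Real.sqrt 2)⁻¹ : ℝ) : ℂ) ^ a
      = ((2 : ℂ) ^ a)⁻¹ := by
    rw [← mul_pow, ← Complex.ofReal_mul, ← mul_inv, Real.mul_self_sqrt (by norm_num)]
    push_cast
    rw [inv_pow]
  have e1 : ∀ s s' : (Fin a → Bool) × R,
      (ancMat (tensorMat fun _ => hadamardMat) * ctrlMat W :
        Matrix ((Fin a → Bool) × R) ((Fin a → Bool) × R) ℂ) s s'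
      = tensorMat (fun _ => hadamardMat) s.1 s'.1 * W s'.1 s.2 s'.2 := by
    intro s s'
    rw [Matrix.mul_apply, Finset.sum_eq_single (s'.1, s.2)]
    · simp [ancMat, ctrlMat]
    · rintro ⟨x, y⟩ _ h
      simp only [ne_eq, Prod.mk.injEq, not_and_or] at h
      rcases h with h | h
      · simp [ctrlMat, h]
      · simp [ancMat, Ne.symm h]
    · simp
  ext s z
  rw [mul_prepMat_apply, interferometer, Matrix.diagonal_mul, Matrix.mul_apply, Matrix.mul_apply]
  have e2 : ∑ u : (Fin a → Bool) × R,
      (ancMat (tensorMat fun _ => hadamardMat) * ctrlMat W :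
        Matrix ((Fin a → Bool) × R) ((Fin a → Bool) × R) ℂ) s u *
        (ancMat (tensorMat fun _ => hadamardMat) : Matrix ((Fin a → Bool) × R) _ ℂ) u
          (fun _ => false, z) = branchMat W s.1 s.2 z := by
    rw [Fintype.sum_prod_type]
    simp only [e1, ancMat, branchMat, Matrix.smul_apply, Matrix.sum_apply, smul_eq_mul,
      Finset.mul_sum, mul_ite, mul_zero]
    refine Finset.sum_congr rfl fun x _ => ?_
    rw [Finset.sum_ite_eq' univ z, if_pos (mem_univ z)]
    rw [tensorMat_hadamardMat, tensorMat_hadamardMat, boolSign_false, ← h2]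
    push_cast
    ring
  rw [e2, Finset.sum_eq_single s.2]
  · by_cases h : s.1 = b
    · simp [h, prepMat]
    · simp [h, prepMat]
  · intro w _ hw; simp [prepMat, hw.symm]
  · simp

theorem initState_eq {n : ℕ} (a m : ℕ) (ρ : Matrix (Fin n → Bool) (Fin n → Bool) ℂ) :
    initState a m ρ = prepMat (Fin m → Fin n → Bool) (fun _ : Fin a => false) *
      (tensorMat fun _ : Fin m => ρ) *
      (prepMat (Fin m → Fin n → Bool) fun _ : Fin a => false).conjTranspose := by
  ext s s'
  rw [Matrix.mul_apply]
  have : ∀ w, (prepMat (Fin m → Fin n → Bool) (fun _ : Fin a => false) *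
      (tensorMat fun _ : Fin m => ρ) : Matrix (Basis n a m) (Fin m → Fin n → Bool) ℂ) s w
      = if s.1 = fun _ => false then tensorMat (fun _ : Fin m => ρ) s.2 w else 0 := by
    intro w
    rw [Matrix.mul_apply, Finset.sum_eq_single s.2]
    · simp [prepMat]
    · intro v _ hv; simp [prepMat, hv.symm]
    · simp
  simp only [this]
  rw [Finset.sum_eq_single s'.2]
  · simp only [initState, Matrix.conjTranspose_apply, prepMat, and_true]
    have h1 : ∀ x : Fin a → Bool, (∀ q, x q = false) ↔ x = fun _ => false := fun x =>
      funext_iff.symm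
    simp only [h1]
    by_cases h : s.1 = fun _ => false <;> by_cases h' : s'.1 = fun _ => false <;>
      simp [h, h', tensorMat]
  · intro v _ hv; simp [Matrix.conjTranspose_apply, prepMat, hv.symm]
  · simp

/-- A character z of the outcomes picks the interference of the branches x and x + z. It is used
with z = 0 for the normalisation and with z = (1, ..., 1) for the parity readout. -/
theorem sum_boolSign_mul_trace {a : ℕ} {R : Type*} [DecidableEq R] [Fintype R]
    (W : (Fin a → Bool) → Matrix R R ℂ) (σ : Matrix R R ℂ) (z : Fin a → Bool) :
    ∑ b, (boolSign b z : ℂ) * (branchMat W b * σ * (branchMat W b).conjTranspose).trace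
      = ((2 : ℂ) ^ a)⁻¹ * ∑ x, (W x * σ * (W fun i => xor (x i) (z i)).conjTranspose).trace := by
  have e : ∀ b, (branchMat W b * σ * (branchMat W b).conjTranspose).trace
      = ((2 : ℂ) ^ a)⁻¹ * ((2 : ℂ) ^ a)⁻¹ * ∑ x, ∑ y,
        ((boolSign b x : ℂ) * boolSign b y) * (W x * σ * (W y).conjTranspose).trace := by
    intro b
    simp only [branchMat, Matrix.conjTranspose_smul, Matrix.conjTranspose_sum, Matrix.smul_mul,
      Matrix.mul_smul, Matrix.sum_mul, Matrix.trace_smul, Matrix.trace_sum,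
      smul_eq_mul, Complex.star_def, Complex.conj_ofReal, Finset.mul_sum, map_inv₀, map_pow,
      Complex.conj_ofNat]
    rw [Finset.sum_comm]
    exact Finset.sum_congr rfl fun x _ => Finset.sum_congr rfl fun y _ => by ring
  simp_rw [e]
  have e2 : ∀ x y, ∑ b, (boolSign b z : ℂ) * boolSign b x * boolSign b y
      = if y = fun i => xor (x i) (z i) then (2 : ℂ) ^ a else 0 := by
    intro x y
    have := congrArg (fun r : ℝ => (r : ℂ)) (sum_boolSign x y z)
    push_cast at this
    rw [this]
    split_ifs <;> simp
  calc _ = ((2 : ℂ) ^ a)⁻¹ * ((2 : ℂ) ^ a)⁻¹ * ∑ x, ∑ y,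
        (∑ b, (boolSign b z : ℂ) * boolSign b x * boolSign b y) *
          (W x * σ * (W y).conjTranspose).trace := by
        simp_rw [Finset.sum_mul, Finset.mul_sum]
        rw [Finset.sum_comm]
        refine Finset.sum_congr rfl fun x _ => ?_
        rw [Finset.sum_comm]
        exact Finset.sum_congr rfl fun y _ => Finset.sum_congr rfl fun b _ => by ring
    _ = _ := by
        simp_rw [e2, ite_mul, zero_mul, Finset.sum_ite_eq', mem_univ, if_true]
        rw [← Finset.mul_sum]
        have : ((2 : ℂ) ^ a) ≠ 0 := pow_ne_zero _ two_ne_zero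
        field_simp

/-! ### The swap test -/

theorem neg_involutive_fin (j : ℕ) : Function.Involutive fun i : Fin (j + 1) => -i :=
  fun i => neg_neg i

theorem sub_involutive_fin (j : ℕ) : Function.Involutive fun i : Fin (j + 1) => 1 - i :=
  fun i => sub_sub_cancel 1 i

/-- The swap test for a cyclic shift of `j + 1` registers, composed of two reflections, together
with a Pauli string on the register `0`. -/
noncomputable def swapTest {n : ℕ} (j : ℕ) (P : Fin n → Pauli) : Circuit n (j + 1) (j + 1) 6 :=
  .step (oneLayer ⟨hadamardMat, hadamardMat_mem⟩) fun _ =>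
  .step (swapLayer (fun i => 1 - i) (sub_involutive_fin j)) fun _ =>
  .step (swapLayer (fun i => -i) (neg_involutive_fin j)) fun _ =>
  .step (pauliLayer P) fun _ =>
  .step (oneLayer ⟨hadamardMat, hadamardMat_mem⟩) fun _ =>
  .step measLayer fun _ => .done

/-- The controlled operation of the swap test. -/
noncomputable def swapTestOp {n : ℕ} (j : ℕ) (P : Fin n → Pauli) (b : Fin (j + 1) → Bool) :
    Matrix (Fin (j + 1) → Fin n → Bool) (Fin (j + 1) → Fin n → Bool) ℂ :=
  regMat (if b 0 then pauliString P else 1) * relabelMat (partialInv (fun i => -i) b) *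
    relabelMat (partialInv (fun i => 1 - i) b)

theorem prob_swapTest {n : ℕ} (j : ℕ) (P : Fin n → Pauli)
    (ρ : Matrix (Fin n → Bool) (Fin n → Bool) ℂ) (o : Fin 6 → Fin (j + 1) → Bool) :
    (swapTest j P).prob ρ o = if ∀ s, s ≠ 5 → o s = fun _ => false then
      (branchMat (swapTestOp j P) (o 5) * (tensorMat fun _ => ρ) *
        (branchMat (swapTestOp j P) (o 5)).conjTranspose).trace.re else 0 := by
  have hk : (swapTest j P).kraus o = 1 * measLayer.kraus (o 5) *
      (oneLayer ⟨hadamardMat, hadamardMat_mem⟩).kraus (o 4) * (pauliLayer P).kraus (o 3) *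
      (swapLayer (fun i => -i) (neg_involutive_fin j)).kraus (o 2) *
      (swapLayer (fun i => 1 - i) (sub_involutive_fin j)).kraus (o 1) *
      (oneLayer ⟨hadamardMat, hadamardMat_mem⟩).kraus (o 0) := by
    simp only [swapTest, Circuit.kraus]
    rfl
  rw [Circuit.prob, hk, kraus_measLayer, kraus_oneLayer, kraus_pauliLayer, kraus_swapLayer,
    kraus_swapLayer, kraus_oneLayer]
  by_cases h : ∀ s, s ≠ 5 → o s = fun _ => false
  · rw [if_pos h, if_pos (h 4 (by decide)), if_pos (h 3 (by decide)), if_pos (h 2 (by decide)),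
      if_pos (h 1 (by decide)), if_pos (h 0 (by decide))]
    have e : ∀ (D A B C E F : Matrix (Basis n (j + 1) (j + 1)) (Basis n (j + 1) (j + 1)) ℂ),
        1 * D * A * B * C * E * F = D * (A * (B * C * E) * F) := fun D A B C E F => by
      simp only [one_mul, mul_assoc]
    rw [e, ctrlMat_mul, ctrlMat_mul, initState_eq]
    set K := interferometer (swapTestOp j P) (o 5) with hK
    have h1 : K * prepMat (Fin (j + 1) → Fin n → Bool) (fun _ : Fin (j + 1) => false) = prepMat (Fin (j + 1) → Fin n → Bool) (o 5) * branchMat (swapTestOp j P) (o 5) :=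
      interferometer_mul_prepMat _ _
    have h2 : K * (prepMat (Fin (j + 1) → Fin n → Bool) (fun _ : Fin (j + 1) => false) * (tensorMat fun _ : Fin (j + 1) => ρ) *
        (prepMat (Fin (j + 1) → Fin n → Bool) fun _ : Fin (j + 1) => false).conjTranspose) * K.conjTranspose
        = (K * prepMat (Fin (j + 1) → Fin n → Bool) (fun _ : Fin (j + 1) => false)) * (tensorMat fun _ : Fin (j + 1) => ρ) *
          (K * prepMat (Fin (j + 1) → Fin n → Bool) (fun _ : Fin (j + 1) => false)).conjTranspose := by
      rw [Matrix.conjTranspose_mul K]; simp only [Matrix.mul_assoc]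
    have h3 : (K * prepMat (Fin (j + 1) → Fin n → Bool) (fun _ : Fin (j + 1) => false)) * (tensorMat fun _ : Fin (j + 1) => ρ) *
          (K * prepMat (Fin (j + 1) → Fin n → Bool) (fun _ : Fin (j + 1) => false)).conjTranspose
        = prepMat (Fin (j + 1) → Fin n → Bool) (o 5) * ((branchMat (swapTestOp j P) (o 5) * (tensorMat fun _ : Fin (j + 1) => ρ) *
        (branchMat (swapTestOp j P) (o 5)).conjTranspose) * (prepMat (Fin (j + 1) → Fin n → Bool) (o 5)).conjTranspose) := by
      rw [h1, Matrix.conjTranspose_mul]; simp only [Matrix.mul_assoc]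
    change (K * _ * K.conjTranspose).trace.re = _
    rw [h2, h3, Matrix.trace_mul_comm, Matrix.mul_assoc, conjTranspose_prepMat_mul, Matrix.mul_one]
  · rw [if_neg h]
    push Not at h
    obtain ⟨s, hs, hs'⟩ := h
    fin_cases s
    · rw [if_neg hs' (c := o 0 = _)]; simp
    · rw [if_neg hs' (c := o 1 = _)]; simp
    · rw [if_neg hs' (c := o 2 = _)]; simp
    · rw [if_neg hs' (c := o 3 = _)]; simp
    · rw [if_neg hs' (c := o 4 = _)]; simp
    · exact absurd rfl hs

end

/-! ### Expectation and cost of the swap test. -/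

section
open Finset

theorem pauliString_mul_self {n : ℕ} (P : Fin n → Pauli) : pauliString P * pauliString P = 1 := by
  have h : pauliString P = tensorMat fun i => (P i).mat := rfl
  have h1 : ∀ p : Pauli, p.mat * p.mat = 1 := fun p => by
    ext x y
    rw [Matrix.mul_apply, Fintype.sum_bool]
    cases p <;> cases x <;> cases y <;> simp [Pauli.mat]
  rw [h, tensorMat_mul]
  simp_rw [h1]
  exact tensorMat_one

theorem pauliString_I {n : ℕ} : pauliString (fun _ : Fin n => Pauli.I) = 1 := by
  have h1 : Pauli.mat .I = 1 := by ext x y; simp [Pauli.mat, Matrix.one_apply]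
  rw [← tensorMat_one]
  change (tensorMat fun _ => Pauli.mat .I) = _
  rw [h1]

theorem conjTranspose_swapTestOp {n : ℕ} (j : ℕ) (P : Fin n → Pauli) (b : Fin (j + 1) → Bool) :
    (swapTestOp j P b).conjTranspose = relabelMat (partialInv (fun i => 1 - i) b) *
      relabelMat (partialInv (fun i => -i) b) * regMat (if b 0 then pauliString P else 1) := by
  have h : (if b 0 then pauliString P else 1).conjTranspose
      = if b 0 then pauliString P else 1 := by
    split_ifs
    · exact isHermitian_pauliString P
    · exact Matrix.conjTranspose_one
  rw [swapTestOp, Matrix.conjTranspose_mul, Matrix.conjTranspose_mul, conjTranspose_regMat, h,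
    conjTranspose_relabelMat (partialInv_involutive (neg_involutive_fin j) b),
    conjTranspose_relabelMat (partialInv_involutive (sub_involutive_fin j) b), Matrix.mul_assoc]

theorem relabelMat_mul_self {m : ℕ} {κ : Type*} [Fintype κ] [DecidableEq κ] {f : Fin m → Fin m}
    (hf : f.Involutive) : (relabelMat f * relabelMat f : Matrix (Fin m → κ) (Fin m → κ) ℂ) = 1 := by
  rw [relabelMat_mul, hf.comp_self, relabelMat_id]

theorem trace_swapTestOp_same {n : ℕ} (j : ℕ) (P : Fin n → Pauli)
    (ρ : Matrix (Fin n → Bool) (Fin n → Bool) ℂ) (x : Fin (j + 1) → Bool) :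
    (swapTestOp j P x * (tensorMat fun _ => ρ) * (swapTestOp j P x).conjTranspose).trace
      = ρ.trace ^ (j + 1) := by
  have hP : (if x 0 then pauliString P else 1) * (if x 0 then pauliString P else 1) = 1 := by
    split_ifs
    · exact pauliString_mul_self P
    · exact Matrix.mul_one 1
  have hO := partialInv_involutive (neg_involutive_fin j) x
  have hE := partialInv_involutive (sub_involutive_fin j) x
  have h1 : (swapTestOp j P x).conjTranspose * swapTestOp j P x = 1 := by
    rw [conjTranspose_swapTestOp, swapTestOp]
    set A := (relabelMat (partialInv (fun i => 1 - i) x) :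
      Matrix (Fin (j + 1) → Fin n → Bool) (Fin (j + 1) → Fin n → Bool) ℂ)
    set B := (relabelMat (partialInv (fun i => -i) x) :
      Matrix (Fin (j + 1) → Fin n → Bool) (Fin (j + 1) → Fin n → Bool) ℂ)
    set R := (regMat (if x 0 then pauliString P else 1) :
      Matrix (Fin (j + 1) → Fin n → Bool) (Fin (j + 1) → Fin n → Bool) ℂ)
    have hA : A * A = 1 := relabelMat_mul_self hE
    have hB : B * B = 1 := relabelMat_mul_self hO
    have hR : R * R = 1 := by rw [regMat_mul, hP, regMat_one]
    calc A * B * R * (R * B * A) = A * (B * (R * R) * B) * A := by simp only [Matrix.mul_assoc]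
      _ = 1 := by rw [hR, Matrix.mul_one, hB, Matrix.mul_one, hA]
  rw [Matrix.trace_mul_comm, ← Matrix.mul_assoc, h1, Matrix.one_mul, trace_tensorMat]
  simp

/-- Complementary patterns add up to both full reflections and one Pauli string. The factors can be
brought together because identical copies commute with permutations of the registers, the trace is
cyclic, and the reflection next to the Pauli string fixes its register. The result does not depend
on x. -/
theorem trace_swapTestOp_not {n : ℕ} (j : ℕ) (P : Fin n → Pauli)
    (ρ : Matrix (Fin n → Bool) (Fin n → Bool) ℂ) (x : Fin (j + 1) → Bool) :
    (swapTestOp j P x * (tensorMat fun _ => ρ) *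
      (swapTestOp j P fun i => !x i).conjTranspose).trace
      = (pauliString P * ρ ^ (j + 1)).trace := by
  have hO := neg_involutive_fin j
  have hE := sub_involutive_fin j
  have h0 : partialInv (fun i : Fin (j + 1) => -i) (fun i => !x i) 0 = 0 := by
    simp [partialInv]
  rw [conjTranspose_swapTestOp, swapTestOp, ← trace_regMat_mul_shift]
  have hA' := relabelMat_mul_tensorMat (κ := Fin n → Bool)
    (partialInv_involutive hE fun i => !x i) ρ
  have hBR' := relabelMat_mul_regMat (κ := Fin n → Bool)
    (partialInv_involutive hO fun i => !x i) h0 (pauliString P)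
  have hBB : (relabelMat (partialInv (fun i : Fin (j + 1) => -i) fun i => !x i) *
      relabelMat (partialInv (fun i => -i) x) :
      Matrix (Fin (j + 1) → Fin n → Bool) (Fin (j + 1) → Fin n → Bool) ℂ)
      = relabelMat fun i => -i := by
    rw [relabelMat_mul, partialInv_comp_not hO]
  have hAA : (relabelMat (partialInv (fun i : Fin (j + 1) => 1 - i) x) *
      relabelMat (partialInv (fun i => 1 - i) fun i => !x i) :
      Matrix (Fin (j + 1) → Fin n → Bool) (Fin (j + 1) → Fin n → Bool) ℂ)
      = relabelMat fun i => 1 - i := by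
    have := partialInv_comp_not hE fun i => !x i
    simp only [Bool.not_not] at this
    rw [relabelMat_mul, this]
  -- The two reflections compose to the cyclic shift: 1 - (-i) = i + 1.
  have hBA : (relabelMat (fun i : Fin (j + 1) => -i) * relabelMat (fun i => 1 - i) :
      Matrix (Fin (j + 1) → Fin n → Bool) (Fin (j + 1) → Fin n → Bool) ℂ)
      = relabelMat fun i => i + 1 := by
    rw [relabelMat_mul]
    congr 1; ext1 i
    simp [add_comm]
  -- Exactly one of the two patterns applies the Pauli string.
  have hR : (regMat (if (!x 0) = true then pauliString P else 1) *
      regMat (if x 0 then pauliString P else 1) :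
      Matrix (Fin (j + 1) → Fin n → Bool) (Fin (j + 1) → Fin n → Bool) ℂ)
      = regMat (pauliString P) := by
    rw [regMat_mul]
    cases x 0 <;> simp
  rw [← hBA, ← hBB, ← hAA, ← hR]
  rw [← hR] at hBR'
  generalize (relabelMat (partialInv (fun i : Fin (j + 1) => 1 - i) x) :
      Matrix (Fin (j + 1) → Fin n → Bool) (Fin (j + 1) → Fin n → Bool) ℂ) = A at *
  generalize (relabelMat (partialInv (fun i : Fin (j + 1) => -i) x) :
      Matrix (Fin (j + 1) → Fin n → Bool) (Fin (j + 1) → Fin n → Bool) ℂ) = B at *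
  generalize (relabelMat (partialInv (fun i : Fin (j + 1) => 1 - i) fun i => !x i) :
      Matrix (Fin (j + 1) → Fin n → Bool) (Fin (j + 1) → Fin n → Bool) ℂ) = A' at *
  generalize (relabelMat (partialInv (fun i : Fin (j + 1) => -i) fun i => !x i) :
      Matrix (Fin (j + 1) → Fin n → Bool) (Fin (j + 1) → Fin n → Bool) ℂ) = B' at *
  generalize (regMat (if x 0 then pauliString P else 1) :
      Matrix (Fin (j + 1) → Fin n → Bool) (Fin (j + 1) → Fin n → Bool) ℂ) = R at *
  generalize (regMat (if (!x 0) = true then pauliString P else 1) :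
      Matrix (Fin (j + 1) → Fin n → Bool) (Fin (j + 1) → Fin n → Bool) ℂ) = R' at *
  generalize (tensorMat fun _ : Fin (j + 1) => ρ) = σ at *
  calc (R * B * A * σ * (A' * B' * R')).trace
      = (R * B * A * (σ * A') * (B' * R')).trace := by simp only [Matrix.mul_assoc]
    _ = ((R * (B * (A * (A' * σ)))) * (B' * R')).trace := by
        rw [← hA']; simp only [Matrix.mul_assoc]
    _ = ((B' * R') * (R * (B * (A * (A' * σ))))).trace := Matrix.trace_mul_comm _ _
    _ = ((B' * (R' * R)) * (B * (A * (A' * σ)))).trace := by simp only [Matrix.mul_assoc]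
    _ = _ := by rw [hBR']; simp only [Matrix.mul_assoc]

/-- The outcome records of a run of the swap test. -/
def swapTestRecord {j : ℕ} (b : Fin (j + 1) → Bool) : Fin 6 → Fin (j + 1) → Bool :=
  fun s => if s = 5 then b else fun _ => false

theorem sum_mul_prob_swapTest {n : ℕ} (j : ℕ) (P : Fin n → Pauli)
    (ρ : Matrix (Fin n → Bool) (Fin n → Bool) ℂ) (f : (Fin (j + 1) → Bool) → ℝ) :
    ∑ o, f (o 5) * (swapTest j P).prob ρ o = ∑ b, f b *
      (branchMat (swapTestOp j P) b * (tensorMat fun _ => ρ) *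
        (branchMat (swapTestOp j P) b).conjTranspose).trace.re := by
  symm
  refine Fintype.sum_of_injective (swapTestRecord (j := j)) ?_ _ _ ?_ ?_
  · intro b b' h
    have := congrFun h 5
    simpa [swapTestRecord] using this
  · intro o ho
    rw [prob_swapTest, if_neg, mul_zero]
    intro h
    refine ho ⟨o 5, ?_⟩
    ext1 s
    by_cases hs : s = 5
    · subst hs; simp [swapTestRecord]
    · rw [swapTestRecord, if_neg hs, h s hs]
  · intro b
    rw [prob_swapTest, if_pos (fun s hs => by simp [swapTestRecord, hs])]
    simp [swapTestRecord]

open scoped ComplexOrder in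
theorem prob_swapTest_nonneg {n : ℕ} (j : ℕ) (P : Fin n → Pauli)
    {ρ : Matrix (Fin n → Bool) (Fin n → Bool) ℂ} (hρ : IsState ρ)
    (o : Fin 6 → Fin (j + 1) → Bool) : 0 ≤ (swapTest j P).prob ρ o := by
  rw [prob_swapTest]
  split_ifs
  · have h := (posSemidef_tensorMat (m := j + 1) hρ.1).mul_mul_conjTranspose_same
      (branchMat (swapTestOp j P) (o 5))
    exact (Complex.le_def.1 h.trace_nonneg).1
  · exact le_rfl

theorem sum_boolSign_mul_prob_swapTest {n : ℕ} (j : ℕ) (P : Fin n → Pauli)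
    (ρ : Matrix (Fin n → Bool) (Fin n → Bool) ℂ) (z : Fin (j + 1) → Bool) (w : ℂ)
    (hw : ∀ x, (swapTestOp j P x * (tensorMat fun _ => ρ) *
      (swapTestOp j P fun i => xor (x i) (z i)).conjTranspose).trace = w) :
    ∑ o, boolSign (o 5) z * (swapTest j P).prob ρ o = w.re := by
  rw [sum_mul_prob_swapTest j P ρ fun b => boolSign b z]
  have := congrArg Complex.re (sum_boolSign_mul_trace (swapTestOp j P) (tensorMat fun _ => ρ) z)
  simp_rw [hw] at this
  rw [Complex.re_sum] at this
  simp_rw [Complex.re_ofReal_mul] at this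
  rw [this, Finset.sum_const, card_univ]
  simp

theorem sum_prob_swapTest {n : ℕ} (j : ℕ) (P : Fin n → Pauli)
    {ρ : Matrix (Fin n → Bool) (Fin n → Bool) ℂ} (hρ : IsState ρ) :
    ∑ o, (swapTest j P).prob ρ o = 1 := by
  have := sum_boolSign_mul_prob_swapTest j P ρ (fun _ => false) 1 fun x => by
    simp only [Bool.xor_false]
    rw [trace_swapTestOp_same, hρ.2, one_pow]
  simpa [boolSign_false] using this

/-- Repeated swap tests. -/
noncomputable def swapTestExperiment {n : ℕ} (j : ℕ) (P : Fin n → Pauli) (runs : ℕ) :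
    Experiment n (j + 1) where
  ancillas := j + 1
  depth := 6
  circuit := swapTest j P
  -- Parity of the final measurement, written over the integers so that equality is decidable.
  readout o := decide ((∏ q, if o 5 q then (-1 : ℤ) else 1) = -1)
  runs := runs

theorem readout_swapTestExperiment {n : ℕ} (j : ℕ) (P : Fin n → Pauli) (runs : ℕ)
    (o : Fin 6 → Fin (j + 1) → Bool) :
    (if (swapTestExperiment j P runs).readout o then (-1 : ℝ) else 1)
      = boolSign (o 5) fun _ => true := by
  have h1 : ∀ s : Finset (Fin (j + 1)), (∏ q ∈ s, if o 5 q then (-1 : ℤ) else 1) = 1 ∨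
      (∏ q ∈ s, if o 5 q then (-1 : ℤ) else 1) = -1 := by
    intro s
    induction s using Finset.induction_on with
    | empty => simp
    | insert q s hq ih =>
      rw [Finset.prod_insert hq]
      rcases ih with h | h <;> rw [h] <;> split_ifs <;> simp
  have h2 : boolSign (o 5) (fun _ => true)
      = ((∏ q, if o 5 q then (-1 : ℤ) else 1 : ℤ) : ℝ) := by
    rw [boolSign]; push_cast; simp
  rw [h2]
  simp only [swapTestExperiment, decide_eq_true_eq]
  rcases h1 univ with h | h <;> rw [h] <;> norm_num

theorem sum_readout_mul_prob_swapTest {n : ℕ} (j : ℕ) (P : Fin n → Pauli) (runs : ℕ)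
    (ρ : Matrix (Fin n → Bool) (Fin n → Bool) ℂ) :
    ∑ o : Fin 6 → Fin (j + 1) → Bool,
      (if (swapTestExperiment j P runs).readout o then (-1 : ℝ) else 1) *
      (swapTest j P).prob ρ o = (pauliString P * ρ ^ (j + 1)).trace.re := by
  refine (Finset.sum_congr rfl fun o _ =>
    congrArg (· * _) (readout_swapTestExperiment j P runs o)).trans ?_
  refine sum_boolSign_mul_prob_swapTest j P ρ _ _ fun x => ?_
  simp only [Bool.xor_true]
  exact trace_swapTestOp_not j P ρ x

theorem length_filterMap_swapGate_le {n m : ℕ} (f : Fin m → Fin m) (l : List (Fin m)) :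
    (((l.filterMap (swapGate (n := n) f)).map Gate.cswaps)).sum ≤ l.length := by
  induction l with
  | nil => simp
  | cons i l ih =>
    rw [List.filterMap_cons, swapGate]
    split_ifs
    · simp only [List.map_cons, List.sum_cons, Gate.cswaps, List.length_cons]
      omega
    · simp only [List.length_cons]
      omega

theorem cheap_swapTestExperiment {n : ℕ} (j : ℕ) (P : Fin n → Pauli) (runs : ℕ) {C : ℕ}
    (hC : 6 ≤ C) : (swapTestExperiment j P runs).Cheap C := by
  refine ⟨hC, ?_, ?_⟩
  · change j + 1 ≤ C * (j + 1)
    exact Nat.le_mul_of_pos_left _ (by omega)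
  · have h1 : ∀ a m (U : Matrix.unitaryGroup Bool ℂ),
        ((oneLayer U : Layer n a m).gates.map Gate.cswaps).sum = 0 := fun a m U =>
      List.sum_eq_zero fun x hx => by
        simp only [oneLayer, List.map_map, List.mem_map] at hx
        obtain ⟨_, _, rfl⟩ := hx; rfl
    have h2 : ∀ a m, ((measLayer : Layer n a m).gates.map Gate.cswaps).sum = 0 := fun a m =>
      List.sum_eq_zero fun x hx => by
        simp only [measLayer, List.map_map, List.mem_map] at hx
        obtain ⟨_, _, rfl⟩ := hx; rfl
    have h3 : ((pauliLayer P : Layer n (j + 1) (j + 1)).gates.map Gate.cswaps).sum = 0 := rfl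
    have h4 : ∀ f hf, ((swapLayer f hf : Layer n (j + 1) (j + 1)).gates.map Gate.cswaps).sum
        ≤ j + 1 := fun f hf => by
      have := length_filterMap_swapGate_le (n := n) f (List.finRange (j + 1))
      rwa [List.length_finRange] at this
    have h5 : (swapTest j P).cswaps ≤ 2 * (j + 1) := by
      simp only [swapTest, Circuit.cswaps, h1, h2, h3, zero_add]
      have e1 := h4 _ (sub_involutive_fin j)
      have e2 := h4 _ (neg_involutive_fin j)
      refine Finset.sup_le fun _ _ => ?_
      refine (Nat.add_le_add e1 (Finset.sup_le fun _ _ => Nat.add_le_add e2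
        (Finset.sup_le fun _ _ => Finset.sup_le fun _ _ => Finset.sup_le fun _ _ =>
          (Finset.sup_le fun _ _ => le_rfl) ) )).trans ?_
      omega
    exact h5.trans (Nat.mul_le_mul_right _ (by omega))

end

/-! ### Response of the extended estimates to errors, and sufficiency. -/

section
open Finset

theorem trace_mul_pow_eq_re {n : ℕ} {M ρ : Matrix (Fin n → Bool) (Fin n → Bool) ℂ}
    (hM : M.IsHermitian) (hρ : IsState ρ) (j : ℕ) :
    (M * ρ ^ j).trace = ((M * ρ ^ j).trace.re : ℂ) := by
  obtain ⟨lam, mu, -, -, -, -, h, -⟩ := exists_spectral_data hM hρ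
  rw [h j, Complex.ofReal_re]

theorem trace_pow_eq_re {n : ℕ} {ρ : Matrix (Fin n → Bool) (Fin n → Bool) ℂ}
    (hρ : IsState ρ) (j : ℕ) : (ρ ^ j).trace = ((ρ ^ j).trace.re : ℂ) := by
  obtain ⟨lam, mu, -, -, -, -, -, h⟩ := exists_spectral_data Matrix.isHermitian_zero hρ
  rw [h j, Complex.ofReal_re]

theorem norm_sub_trace_mul_pow {n : ℕ} {M ρ : Matrix (Fin n → Bool) (Fin n → Bool) ℂ}
    (hM : M.IsHermitian) (hρ : IsState ρ) (j : ℕ) (q : ℝ) :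
    ‖(q : ℂ) - (M * ρ ^ j).trace‖ = |q - (M * ρ ^ j).trace.re| := by
  rw [trace_mul_pow_eq_re hM hρ, ← Complex.ofReal_sub, Complex.norm_real, Real.norm_eq_abs,
    Complex.ofReal_re]

theorem norm_sub_trace_pow {n : ℕ} {ρ : Matrix (Fin n → Bool) (Fin n → Bool) ℂ}
    (hρ : IsState ρ) (j : ℕ) (q : ℝ) :
    ‖(q : ℂ) - (ρ ^ j).trace‖ = |q - (ρ ^ j).trace.re| := by
  rw [trace_pow_eq_re hρ, ← Complex.ofReal_sub, Complex.norm_real, Real.norm_eq_abs,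
    Complex.ofReal_re]

theorem extendEst_eq_sum (t : ℕ) (Q QM : ℕ → ℝ) (i : ℕ) (hi : 1 ≤ i) :
    extendEst t Q QM i = ∑ j ∈ Icc 1 t, extendEst t Q (Pi.single j 1) i * QM j := by
  induction i using Nat.strong_induction_on with
  | _ i ih =>
    rcases le_or_gt i t with h | h
    · simp only [extendEst_of_le h]
      rw [Finset.sum_eq_single i]
      · simp
      · intro j _ hj; simp [Pi.single_eq_of_ne hj.symm]
      · intro h'; exact absurd (Finset.mem_Icc.2 ⟨hi, h⟩) h'
    · simp only [extendEst_of_lt h, Finset.sum_mul]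
      rw [Finset.sum_comm]
      refine Finset.sum_congr rfl fun l hl => ?_
      have := Finset.mem_range.1 hl
      rw [ih (i - (l + 1)) (by omega) (by omega), Finset.mul_sum]
      exact Finset.sum_congr rfl fun j _ => by ring

theorem sum_Icc_inv_factorial_le (t : ℕ) :
    ∑ l ∈ Icc 1 t, 1 / (l.factorial : ℝ) ≤ Real.exp 1 - 1 := by
  have h := Real.sum_le_exp_of_nonneg zero_le_one (t + 1)
  rw [Finset.sum_range_succ'] at h
  rw [sum_Icc_one_eq_sum_range]
  simp only [one_pow, Nat.factorial_zero, Nat.cast_one, div_one] at h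
  linarith

/-- For accurate estimates `Q`, the error of the extended estimates is an affine function with
small coefficients of the errors of the estimates up to the effective rank. -/
theorem exists_affine_response {n : ℕ} {M ρ : Matrix (Fin n → Bool) (Fin n → Bool) ℂ}
    (hM : M.IsHermitian) (hρ : IsState ρ) {k t : ℕ} {ε : ℝ} (hε : 0 < ε)
    (hεm : ε ≤ opNormInf M)
    (hΛ : ρ.rank ≤ ⌊Real.log (2 * k * opNormInf M / ε)⌋₊ ∨
      5 ≤ Real.log (2 * k * opNormInf M / ε))
    (ht : t = effRank ρ.rank k (opNormInf M) ε) (ht1 : 1 ≤ t) {Q : ℕ → ℝ} (hQ1 : Q 1 = 1)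
    (hQ : ∀ j, 2 ≤ j → j ≤ t → ClosePow ρ j (powTol k t (opNormInf M) ε) (Q j))
    {i : ℕ} (hi : 1 ≤ i) (hik : i ≤ k) :
    ∃ (g : ℕ → ℝ) (G bias : ℝ), 1 ≤ G ∧ G ≤ 4 ∧ ∑ j ∈ Icc 1 t, |g j| ≤ G ∧
      |bias| ≤ ε - G * (ε / 4) ∧ ∀ QM : ℕ → ℝ, extendEst t Q QM i - (M * ρ ^ i).trace.re
        = bias + ∑ j ∈ Icc 1 t, g j * (QM j - (M * ρ ^ j).trace.re) := by
  set m := opNormInf M with hm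
  set η := powTol k t m ε with hη
  set T : ℕ → ℝ := fun j => (M * ρ ^ j).trace.re with hT
  -- For fixed Q the extension is linear in QM, and g is its response to a unit impulse. The bias is
  -- the error left when the first t values are exact.
  set g : ℕ → ℝ := fun j => extendEst t Q (Pi.single j 1) i with hg
  have hlin : ∀ QM : ℕ → ℝ, extendEst t Q QM i - T i = (extendEst t Q T i - T i)
      + ∑ j ∈ Icc 1 t, g j * (QM j - T j) := by
    intro QM
    rw [extendEst_eq_sum t Q QM i hi, extendEst_eq_sum t Q T i hi]
    simp only [mul_sub, Finset.sum_sub_distrib, hg]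
    ring
  rcases le_or_gt i t with hit | hit
  · refine ⟨g, 1, extendEst t Q T i - T i, le_rfl, by norm_num, ?_, ?_, hlin⟩
    · simp only [hg, extendEst_of_le hit]
      rw [Finset.sum_eq_single i]
      · simp
      · intro j _ hj; simp [Pi.single_eq_of_ne hj.symm]
      · intro h'; exact absurd (Finset.mem_Icc.2 ⟨hi, hit⟩) h'
    · rw [extendEst_of_le hit, sub_self, abs_zero]; linarith
  · obtain ⟨lam, mu, h0, hsum, hr, hmu, htr, htr'⟩ := exists_spectral_data hM hρ
    have h0' : ∀ a ∈ (univ : Finset (Fin n → Bool)), 0 ≤ lam a := fun a _ => h0 a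
    have hTe : ∀ j, T j = ∑ a, mu a * lam a ^ j := fun j => by
      rw [hT]; simp only; rw [htr j, Complex.ofReal_re]
    obtain ⟨τ, hτ, htη, hgain⟩ := exists_gain univ lam h0' hsum hε hεm hr hρ.one_le_rank hΛ ht
      (hit.trans_le hik)
    have hm0 : 0 ≤ m := opNormInf_nonneg M
    have hη0 : 0 ≤ η := powTol_nonneg k t hm0 hε.le
    have hD := sum_abs_newtonGirard_sub_le univ lam h0' hsum (t := t) Q hQ1 hη0 htη
      fun j h1 h2 => by
        have := hQ j h1 h2
        rw [ClosePow, norm_sub_trace_pow hρ, htr', Complex.ofReal_re] at this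
        exact this.le
    have hG : ∑ l ∈ Icc 1 t, elemSymm univ lam l ≤ Real.exp 1 - 1 := by
      refine le_trans (Finset.sum_le_sum fun l _ => ?_) (sum_Icc_inv_factorial_le t)
      have := elemSymm_le univ lam h0' l
      rwa [hsum, one_pow] at this
    set D := η * (1 + t * η) * newtonSum t with hDdef
    set amp := (1 + D + elemSymm univ lam (t + 1)) ^ k with hamp
    have hD0 : 0 ≤ D := by have := newtonSum_nonneg t; positivity
    have hamp1 : 1 ≤ amp := one_le_pow₀ (by
      have := elemSymm_nonneg univ lam h0' (t + 1); linarith)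
    have hτ0 : 0 ≤ τ := by
      rcases hτ with h | h
      · exact h.2
      · exact le_trans (by positivity) h
    have hbias : |extendEst t Q T i - T i| ≤ (τ + k * D) * m * amp := by
      have := abs_extendEst_sub_le univ lam mu h0' hsum hm0 (fun a _ => hmu a) ht1 Q T
        (e0 := 0) (fun j _ _ => by rw [hTe, sub_self, abs_zero]) hG hD hτ hi hik
      rwa [mul_zero, zero_add, ← hTe] at this
    have hgsum : ∑ j ∈ Icc 1 t, |g j| ≤ (Real.exp 1 - 1) * amp := by
      -- The zero observable with data sign(g_j): its true values vanish, so the error bound with e0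
      -- = 1 is a bound for ∑ |g_j|.
      have := abs_extendEst_sub_le univ lam (fun _ => 0) h0' hsum le_rfl (m := 0)
        (fun a _ => by simp) ht1 Q (fun j => SignType.sign (g j))
        (e0 := 1) (fun j _ _ => by
          rcases lt_trichotomy (g j) 0 with h | h | h <;> simp [h]) hG hD hτ hi hik
      rw [extendEst_eq_sum _ _ _ _ hi] at this
      simp only [zero_mul, Finset.sum_const_zero, sub_zero, mul_one, mul_zero, add_zero] at this
      refine le_trans (le_of_eq ?_) ((le_abs_self _).trans this)
      refine Finset.sum_congr rfl fun j _ => ?_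
      rw [mul_comm]
      exact (sign_mul_self (g j)).symm
    have he := Real.exp_one_gt_d9
    have hF : 0 ≤ (τ + k * D) * m * amp := by positivity
    -- With G = (e - 1) amp, this gives both the bound on the bias and, as the second term is
    -- nonnegative, G ≤ 4.
    have hsplit : (Real.exp 1 - 1) * amp * (ε / 4) + (τ + k * D) * m * amp ≤ ε := by
      refine le_trans (le_of_eq ?_) hgain
      ring
    refine ⟨g, (Real.exp 1 - 1) * amp, extendEst t Q T i - T i, by nlinarith, ?_, hgsum, ?_, hlin⟩
    · by_contra h
      push Not at h
      nlinarith
    · linarith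

theorem one_le_effRank {n : ℕ} {ρ : Matrix (Fin n → Bool) (Fin n → Bool) ℂ} (hρ : IsState ρ)
    {k t : ℕ} {m ε : ℝ}
    (hΛ : ρ.rank ≤ ⌊Real.log (2 * k * m / ε)⌋₊ ∨ 5 ≤ Real.log (2 * k * m / ε))
    (ht : t = effRank ρ.rank k m ε) : 1 ≤ t := by
  have hr1 := hρ.one_le_rank
  rw [ht, effRank]
  rcases hΛ with h | h
  · exact le_min hr1 (hr1.trans h)
  · exact le_min hr1 (Nat.le_floor (by push_cast; linarith))

/-- Sufficiency of the accuracies `ε / 4` and `powTol` up to the effective rank. -/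
theorem norm_extendEst_sub_le {n : ℕ} {M ρ : Matrix (Fin n → Bool) (Fin n → Bool) ℂ}
    (hM : M.IsHermitian) (hρ : IsState ρ) {k t : ℕ} {ε : ℝ} (hε : 0 < ε)
    (hεm : ε ≤ opNormInf M)
    (hΛ : ρ.rank ≤ ⌊Real.log (2 * k * opNormInf M / ε)⌋₊ ∨
      5 ≤ Real.log (2 * k * opNormInf M / ε))
    (ht : t = effRank ρ.rank k (opNormInf M) ε) {Q QM : ℕ → ℝ} (hQ1 : Q 1 = 1)
    (hQM : ∀ j, 1 ≤ j → j ≤ t → CloseObs M ρ j (ε / 4) (QM j))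
    (hQ : ∀ j, 2 ≤ j → j ≤ t → ClosePow ρ j (powTol k t (opNormInf M) ε) (Q j))
    {i : ℕ} (hi : 1 ≤ i) (hik : i ≤ k) :
    ‖(extendEst t Q QM i : ℂ) - (M * ρ ^ i).trace‖ ≤ ε := by
  obtain ⟨g, G, bias, -, -, hg, hb, hlin⟩ := exists_affine_response hM hρ hε hεm hΛ ht
    (one_le_effRank hρ hΛ ht) hQ1 hQ hi hik
  rw [norm_sub_trace_mul_pow hM hρ, hlin]
  have h1 : |∑ j ∈ Icc 1 t, g j * (QM j - (M * ρ ^ j).trace.re)| ≤ G * (ε / 4) := by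
    refine (Finset.abs_sum_le_sum_abs _ _).trans ?_
    calc _ ≤ ∑ j ∈ Icc 1 t, |g j| * (ε / 4) := Finset.sum_le_sum fun j hj => by
          have hj := Finset.mem_Icc.1 hj
          have := hQM j hj.1 hj.2
          rw [CloseObs, norm_sub_trace_mul_pow hM hρ] at this
          rw [abs_mul]
          gcongr
      _ ≤ _ := by rw [← Finset.sum_mul]; gcongr
  have := abs_add_le bias (∑ j ∈ Icc 1 t, g j * (QM j - (M * ρ ^ j).trace.re))
  linarith

end

/-! ### Concentration of empirical means -/

section
open Finset MeasureTheory

/-- Hoeffding's lemma for a variable with values `±1`. -/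
theorem two_point_mgf_le {μ : ℝ} (h1 : -1 ≤ μ) (h2 : μ ≤ 1) (c : ℝ) :
    (1 + μ) / 2 * Real.exp c + (1 - μ) / 2 * Real.exp (-c) ≤ Real.exp (c * μ + c ^ 2 / 2) := by
  set ν : Measure Bool := ENNReal.ofReal ((1 + μ) / 2) • Measure.dirac true
    + ENNReal.ofReal ((1 - μ) / 2) • Measure.dirac false with hν
  have hprob : IsProbabilityMeasure ν := ⟨by
    rw [hν, Measure.add_apply, Measure.smul_apply, Measure.smul_apply, measure_univ, measure_univ,
      smul_eq_mul, smul_eq_mul, mul_one, mul_one, ← ENNReal.ofReal_add (by linarith) (by linarith)]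
    rw [show (1 + μ) / 2 + (1 - μ) / 2 = 1 by ring, ENNReal.ofReal_one]⟩
  have hint : ∀ f : Bool → ℝ, ∫ b, f b ∂ν = (1 + μ) / 2 * f true + (1 - μ) / 2 * f false := by
    intro f
    have hi : ∀ (x : ℝ) (b : Bool), Integrable f (ENNReal.ofReal x • Measure.dirac b) :=
      fun x b => (Integrable.of_finite (μ := Measure.dirac b)).smul_measure ENNReal.ofReal_ne_top
    rw [hν, integral_add_measure (hi _ _) (hi _ _), integral_smul_measure,
      integral_smul_measure, integral_dirac, integral_dirac,
      ENNReal.toReal_ofReal (by linarith), ENNReal.toReal_ofReal (by linarith), smul_eq_mul,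
      smul_eq_mul]
  set X : Bool → ℝ := fun b => if b then 1 else -1 with hX
  have hmean : ∫ b, X b ∂ν = μ := by rw [hint]; simp only [hX]; norm_num; ring
  have hsub := ProbabilityTheory.hasSubgaussianMGF_of_mem_Icc (μ := ν) (X := X) (a := -1) (b := 1)
    (measurable_of_finite X).aemeasurable
    (Filter.Eventually.of_forall fun b => by cases b <;> simp [hX])
  have hle := hsub.mgf_le c
  rw [hmean, ProbabilityTheory.mgf, hint] at hle
  simp only [hX] at hle
  -- The variance proxy of [-1, 1] is the square of half its length.
  have hn : (((‖(1 : ℝ) - -1‖₊ / 2) ^ 2 : NNReal) : ℝ) = 1 := by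
    push_cast; norm_num
  rw [hn] at hle
  have e : Real.exp (c * μ + c ^ 2 / 2) = Real.exp (1 * c ^ 2 / 2) * Real.exp (c * μ) := by
    rw [← Real.exp_add]; ring_nf
  have e1 : Real.exp c = Real.exp (c * (1 - μ)) * Real.exp (c * μ) := by
    rw [← Real.exp_add]; ring_nf
  have e2 : Real.exp (-c) = Real.exp (c * (-1 - μ)) * Real.exp (c * μ) := by
    rw [← Real.exp_add]; ring_nf
  rw [e]
  have hp := Real.exp_pos (c * μ)
  have := mul_le_mul_of_nonneg_right hle hp.le
  refine le_trans (le_of_eq ?_) this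
  rw [e1, e2]
  simp only [if_true, Bool.false_eq_true, if_false]
  ring

theorem sum_prod_eq_prod_sum {ι : Type*} [Fintype ι] [DecidableEq ι] {Ω : ι → Type*}
    [∀ i, Fintype (Ω i)] (f : ∀ i, Ω i → ℝ) :
    ∑ d : ∀ i, Ω i, ∏ i, f i (d i) = ∏ i, ∑ x, f i x := by
  rw [Finset.prod_univ_sum, Fintype.piFinset_univ]

/-- The runs of an experiment have a probability distribution with readouts of mean `μ`. -/
structure Experiment.HasMean {n j : ℕ} (E : Experiment n j)
    (ρ : Matrix (Fin n → Bool) (Fin n → Bool) ℂ) (μ : ℝ) : Prop where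
  nonneg : ∀ o, 0 ≤ E.circuit.prob ρ o
  sum_eq : ∑ o, E.circuit.prob ρ o = 1
  mean_eq : ∑ o, (if E.readout o then (-1 : ℝ) else 1) * E.circuit.prob ρ o = μ

theorem Experiment.HasMean.prob_nonneg {n j : ℕ} {E : Experiment n j}
    {ρ : Matrix (Fin n → Bool) (Fin n → Bool) ℂ} {μ : ℝ} (h : E.HasMean ρ μ) (d : E.Data) :
    0 ≤ E.prob ρ d :=
  Finset.prod_nonneg fun _ _ => h.nonneg _

theorem Experiment.HasMean.sum_prob {n j : ℕ} {E : Experiment n j}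
    {ρ : Matrix (Fin n → Bool) (Fin n → Bool) ℂ} {μ : ℝ} (h : E.HasMean ρ μ) :
    ∑ d, E.prob ρ d = 1 := by
  have := sum_prod_eq_prod_sum (fun _ : Fin E.runs => E.circuit.prob ρ)
  simp only [Experiment.prob]
  rw [this]
  simp [h.sum_eq]

theorem Experiment.HasMean.mgf_le {n j : ℕ} {E : Experiment n j}
    {ρ : Matrix (Fin n → Bool) (Fin n → Bool) ℂ} {μ : ℝ} (h : E.HasMean ρ μ)
    (hruns : 0 < E.runs) (b : ℝ) :
    ∑ d, E.prob ρ d * Real.exp (b * (E.mean d - μ)) ≤ Real.exp (b ^ 2 / (2 * E.runs)) := by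
  have hr : (0 : ℝ) < E.runs := by exact_mod_cast hruns
  set X : (Fin E.depth → Fin E.ancillas → Bool) → ℝ := fun o =>
    if E.readout o then (-1 : ℝ) else 1 with hX
  set c := b / E.runs with hc
  have e : ∀ d, E.prob ρ d * Real.exp (b * (E.mean d - μ))
      = ∏ s, E.circuit.prob ρ (d s) * Real.exp (c * (X (d s) - μ)) := by
    intro d
    rw [Finset.prod_mul_distrib, ← Real.exp_sum, Experiment.prob, ← Finset.mul_sum,
      Finset.sum_sub_distrib, Finset.sum_const, card_univ, Fintype.card_fin, nsmul_eq_mul]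
    congr 2
    rw [Experiment.mean, hc]
    field_simp
    rfl
  simp_rw [e]
  rw [sum_prod_eq_prod_sum (fun _ : Fin E.runs => fun o =>
    E.circuit.prob ρ o * Real.exp (c * (X o - μ)))]
  rw [Finset.prod_const, card_univ, Fintype.card_fin]
  set p := E.circuit.prob ρ with hp
  have hsingle : ∑ o, p o * Real.exp (c * (X o - μ)) ≤ Real.exp (c ^ 2 / 2) := by
    have hexp : ∀ o, Real.exp (c * X o) = (1 + X o) / 2 * Real.exp c
        + (1 - X o) / 2 * Real.exp (-c) := by
      intro o
      simp only [hX]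
      split_ifs <;> norm_num
    have hμ1 : -1 ≤ μ ∧ μ ≤ 1 := by
      have hX1 : ∀ o, -p o ≤ X o * p o ∧ X o * p o ≤ p o := fun o => by
        have : 0 ≤ p o := h.nonneg o
        simp only [hX]
        split_ifs <;> constructor <;> linarith
      have l1 := Finset.sum_le_sum fun o (_ : o ∈ univ) => (hX1 o).1
      have l2 := Finset.sum_le_sum fun o (_ : o ∈ univ) => (hX1 o).2
      rw [Finset.sum_neg_distrib] at l1
      rw [← h.mean_eq]
      exact ⟨by rw [h.sum_eq] at l1; exact l1, l2.trans h.sum_eq.le⟩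
    have h1 : ∑ o, p o * Real.exp (c * X o) ≤ Real.exp (c * μ + c ^ 2 / 2) := by
      refine le_trans (le_of_eq ?_) (two_point_mgf_le hμ1.1 hμ1.2 c)
      have e3 : ∀ o, p o * Real.exp (c * X o) = (p o + X o * p o) * (Real.exp c / 2)
          + (p o - X o * p o) * (Real.exp (-c) / 2) := fun o => by rw [hexp]; ring
      simp_rw [e3]
      rw [Finset.sum_add_distrib, ← Finset.sum_mul, ← Finset.sum_mul, Finset.sum_add_distrib,
        Finset.sum_sub_distrib, h.sum_eq, h.mean_eq]
      ring
    have e4 : ∀ o, p o * Real.exp (c * (X o - μ))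
        = p o * Real.exp (c * X o) * Real.exp (-(c * μ)) := fun o => by
      rw [mul_assoc, ← Real.exp_add]; ring_nf
    simp_rw [e4]
    rw [← Finset.sum_mul]
    calc _ ≤ Real.exp (c * μ + c ^ 2 / 2) * Real.exp (-(c * μ)) := by gcongr
      _ = _ := by rw [← Real.exp_add]; ring_nf
  calc _ ≤ Real.exp (c ^ 2 / 2) ^ E.runs := by
        gcongr
        exact Finset.sum_nonneg fun o _ => mul_nonneg (h.nonneg o) (Real.exp_pos _).le
    _ = _ := by
        rw [← Real.exp_nat_mul, hc]
        congr 1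
        field_simp

theorem mgf_prod_le {ι : Type*} [Fintype ι] [DecidableEq ι] {Ω : ι → Type*}
    [∀ i, Fintype (Ω i)] (w Z : ∀ i, Ω i → ℝ) (B : ι → ℝ) (hw : ∀ i x, 0 ≤ w i x)
    (h : ∀ i, ∑ x, w i x * Real.exp (Z i x) ≤ Real.exp (B i)) :
    ∑ d : ∀ i, Ω i, (∏ i, w i (d i)) * Real.exp (∑ i, Z i (d i)) ≤ Real.exp (∑ i, B i) := by
  have e : ∀ d : ∀ i, Ω i, (∏ i, w i (d i)) * Real.exp (∑ i, Z i (d i))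
      = ∏ i, w i (d i) * Real.exp (Z i (d i)) := fun d => by
    rw [Real.exp_sum, Finset.prod_mul_distrib]
  simp_rw [e]
  rw [sum_prod_eq_prod_sum (fun i x => w i x * Real.exp (Z i x)), Real.exp_sum]
  exact Finset.prod_le_prod (fun i _ => Finset.sum_nonneg fun x _ =>
    mul_nonneg (hw i x) (Real.exp_pos _).le) fun i _ => h i

open Classical in
/-- Chernoff bound for finite distributions. -/
theorem sum_ite_le_of_mgf_le {Ω : Type*} [Fintype Ω] (w Z : Ω → ℝ) (hw : ∀ x, 0 ≤ w x) {V v : ℝ}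
    (hV : 0 < V) (hv : 0 ≤ v) (h : ∀ l : ℝ, ∑ x, w x * Real.exp (l * Z x) ≤ Real.exp (l ^ 2 * V / 2)) :
    ∑ x, (if v ≤ |Z x| then w x else 0) ≤ 2 * Real.exp (-(v ^ 2 / (2 * V))) := by
  have hl : 0 ≤ v / V := by positivity
  -- Two-sided exponential Markov bound at the optimal parameter v / V.
  have hpt : ∀ x, (if v ≤ |Z x| then w x else 0) ≤ Real.exp (-(v / V * v)) *
      (w x * Real.exp (v / V * Z x) + w x * Real.exp (-(v / V) * Z x)) := by
    intro x
    have p1 := mul_nonneg (hw x) (Real.exp_pos (v / V * Z x)).le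
    have p2 := mul_nonneg (hw x) (Real.exp_pos (-(v / V) * Z x)).le
    split_ifs with hx
    · have hE : 1 ≤ Real.exp (-(v / V * v)) * (Real.exp (v / V * Z x) + Real.exp (-(v / V) * Z x)) := by
        rw [mul_add, ← Real.exp_add, ← Real.exp_add]
        have q1 := Real.exp_pos (-(v / V * v) + v / V * Z x)
        have q2 := Real.exp_pos (-(v / V * v) + -(v / V) * Z x)
        rcases le_abs.1 hx with h' | h'
        · have : 1 ≤ Real.exp (-(v / V * v) + v / V * Z x) := Real.one_le_exp (by nlinarith)
          linarith
        · have : 1 ≤ Real.exp (-(v / V * v) + -(v / V) * Z x) := Real.one_le_exp (by nlinarith)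
          linarith
      calc w x = w x * 1 := (mul_one _).symm
        _ ≤ w x * (Real.exp (-(v / V * v)) *
            (Real.exp (v / V * Z x) + Real.exp (-(v / V) * Z x))) :=
          mul_le_mul_of_nonneg_left hE (hw x)
        _ = _ := by ring
    · positivity
  refine (Finset.sum_le_sum fun x _ => hpt x).trans ?_
  rw [← Finset.mul_sum, Finset.sum_add_distrib]
  have h1 := h (v / V)
  have h2 := h (-(v / V))
  rw [neg_sq] at h2
  calc _ ≤ Real.exp (-(v / V * v)) * (Real.exp ((v / V) ^ 2 * V / 2)
        + Real.exp ((v / V) ^ 2 * V / 2)) := by gcongr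
    _ = 2 * (Real.exp (-(v / V * v)) * Real.exp ((v / V) ^ 2 * V / 2)) := by ring
    _ = _ := by
      rw [← Real.exp_add]
      congr 2
      field_simp
      ring

end

/-! ### Finite weighted spaces and the probabilities of a procedure -/

section
open Finset

open Classical in
/-- The weight of the points that satisfy `s`. -/
noncomputable def weightOf {Ω : Type*} [Fintype Ω] (w : Ω → ℝ) (s : Ω → Prop) : ℝ :=
  ∑ x, if s x then w x else 0

section
variable {Ω Ω' : Type*} [Fintype Ω] [Fintype Ω']

theorem weightOf_mono {w : Ω → ℝ} (hw : ∀ x, 0 ≤ w x) {s s' : Ω → Prop} (h : ∀ x, s x → s' x) :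
    weightOf w s ≤ weightOf w s' := by
  refine Finset.sum_le_sum fun x _ => ?_
  by_cases hs : s x
  · rw [if_pos hs, if_pos (h x hs)]
  · rw [if_neg hs]
    split_ifs
    exacts [hw x, le_rfl]

theorem weightOf_or_le {w : Ω → ℝ} (hw : ∀ x, 0 ≤ w x) (s s' : Ω → Prop) :
    weightOf w (fun x => s x ∨ s' x) ≤ weightOf w s + weightOf w s' := by
  rw [weightOf, weightOf, weightOf, ← Finset.sum_add_distrib]
  refine Finset.sum_le_sum fun x _ => ?_
  have := hw x
  by_cases h1 : s x <;> by_cases h2 : s' x <;> simp [h1, h2, this]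

theorem weightOf_exists_le {ι : Type*} {w : Ω → ℝ} (hw : ∀ x, 0 ≤ w x) (I : Finset ι)
    (s : ι → Ω → Prop) :
    weightOf w (fun x => ∃ i ∈ I, s i x) ≤ ∑ i ∈ I, weightOf w (s i) := by
  classical
  induction I using Finset.induction_on with
  | empty => simp [weightOf]
  | insert i I hi ih =>
    rw [Finset.sum_insert hi]
    refine (weightOf_mono hw fun x hx => ?_).trans
      ((weightOf_or_le hw (s i) fun x => ∃ i ∈ I, s i x).trans (by linarith))
    obtain ⟨l, hl, hs⟩ := hx
    rcases Finset.mem_insert.1 hl with rfl | hl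
    · exact Or.inl hs
    · exact Or.inr ⟨l, hl, hs⟩

theorem one_sub_le_weightOf {w : Ω → ℝ} (hw : ∀ x, 0 ≤ w x) (h1 : ∑ x, w x = 1)
    {s bad : Ω → Prop} {δ : ℝ} (h : ∀ x, ¬ bad x → s x) (hb : weightOf w bad ≤ δ) :
    1 - δ ≤ weightOf w s := by
  have h2 := weightOf_or_le hw s bad
  have h3 : weightOf w (fun x => s x ∨ bad x) = 1 := by
    rw [← h1, weightOf]
    exact Finset.sum_congr rfl fun x _ => if_pos ((em (bad x)).symm.imp_left (h x))
  linarith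

/-- Conditioning on the second component. It allows the event on the first one to depend on y, as it
does when the response coefficients come from the estimated traces of powers. -/
theorem weightOf_mul_le {w : Ω → ℝ} {w' : Ω' → ℝ} (hw' : ∀ y, 0 ≤ w' y) (h1 : ∑ y, w' y = 1)
    (s : Ω × Ω' → Prop) {δ : ℝ} (h : ∀ y, weightOf w (fun x => s (x, y)) ≤ δ) :
    weightOf (fun d : Ω × Ω' => w d.1 * w' d.2) s ≤ δ := by
  rw [weightOf, Fintype.sum_prod_type_right]
  calc _ = ∑ y, w' y * weightOf w (fun x => s (x, y)) := by
        refine Finset.sum_congr rfl fun y _ => ?_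
        rw [weightOf, Finset.mul_sum]
        refine Finset.sum_congr rfl fun x _ => ?_
        split_ifs <;> ring
    _ ≤ ∑ y, w' y * δ := Finset.sum_le_sum fun y _ => mul_le_mul_of_nonneg_left (h y) (hw' y)
    _ = δ := by rw [← Finset.sum_mul, h1, one_mul]

theorem weightOf_mul_snd {w : Ω → ℝ} {w' : Ω' → ℝ} (h1 : ∑ x, w x = 1) (s : Ω' → Prop) :
    weightOf (fun d : Ω × Ω' => w d.1 * w' d.2) (fun d => s d.2) = weightOf w' s := by
  rw [weightOf, Fintype.sum_prod_type_right, weightOf]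
  refine Finset.sum_congr rfl fun y _ => ?_
  split_ifs
  · dsimp only
    rw [← Finset.sum_mul, h1, one_mul]
  · simp

theorem weightOf_le_of_mgf_le (w Z : Ω → ℝ) (hw : ∀ x, 0 ≤ w x) {V v : ℝ} (hV : 0 < V)
    (hv : 0 ≤ v) (h : ∀ l : ℝ, ∑ x, w x * Real.exp (l * Z x) ≤ Real.exp (l ^ 2 * V / 2)) :
    weightOf w (fun x => v ≤ |Z x|) ≤ 2 * Real.exp (-(v ^ 2 / (2 * V))) :=
  sum_ite_le_of_mgf_le w Z hw hV hv h

end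

theorem sum_sq_le_sq_sum_abs {ι : Type*} (s : Finset ι) (g : ι → ℝ) :
    ∑ i ∈ s, g i ^ 2 ≤ (∑ i ∈ s, |g i|) ^ 2 := by
  rw [sq (∑ i ∈ s, |g i|), Finset.sum_mul]
  refine Finset.sum_le_sum fun i hi => ?_
  rw [← sq_abs, sq]
  exact mul_le_mul_of_nonneg_left
    (Finset.single_le_sum (f := fun i => |g i|) (fun _ _ => abs_nonneg _) hi) (abs_nonneg _)

/-- The exponential moments of a linear combination of the means of independent experiments. -/
theorem mgf_linear_comb_le {ι : Type*} [Fintype ι] [DecidableEq ι] {n R : ℕ} {m : ι → ℕ}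
    (E : ∀ i, Experiment n (m i)) {ρ : Matrix (Fin n → Bool) (Fin n → Bool) ℂ} {μ : ι → ℝ}
    (hE : ∀ i, (E i).HasMean ρ (μ i)) (hruns : ∀ i, (E i).runs = R) (hR : 0 < R) (b : ι → ℝ) :
    ∑ d : ∀ i, (E i).Data, (∏ i, (E i).prob ρ (d i)) *
      Real.exp (∑ i, b i * ((E i).mean (d i) - μ i)) ≤ Real.exp ((∑ i, b i ^ 2) / (2 * R)) := by
  rw [Finset.sum_div]
  refine mgf_prod_le (fun i => (E i).prob ρ) (fun i x => b i * ((E i).mean x - μ i)) _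
    (fun i => (hE i).prob_nonneg) fun i => ?_
  exact ((hE i).mgf_le (by rw [hruns]; exact hR) (b i)).trans (by rw [hruns])

namespace Procedure

variable {n N t : ℕ} (A : Procedure n N t) (ρ : Matrix (Fin n → Bool) (Fin n → Bool) ℂ)

noncomputable def obsWeight (d : (α : Fin N) → (j : Fin t) → (A.obs α j).Data) : ℝ :=
  ∏ α, ∏ j, (A.obs α j).prob ρ (d α j)

noncomputable def powWeight (d : (j : Fin t) → (A.pow j).Data) : ℝ :=
  ∏ j, (A.pow j).prob ρ (d j)

variable {A ρ} {μ : Fin N → Fin t → ℝ} {ν : Fin t → ℝ}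

theorem obsWeight_nonneg (h : ∀ α j, (A.obs α j).HasMean ρ (μ α j)) (d) :
    0 ≤ A.obsWeight ρ d :=
  Finset.prod_nonneg fun α _ => Finset.prod_nonneg fun j _ => (h α j).prob_nonneg _

theorem powWeight_nonneg (h : ∀ j, (A.pow j).HasMean ρ (ν j)) (d) : 0 ≤ A.powWeight ρ d :=
  Finset.prod_nonneg fun j _ => (h j).prob_nonneg _

theorem sum_obsWeight (h : ∀ α j, (A.obs α j).HasMean ρ (μ α j)) : ∑ d, A.obsWeight ρ d = 1 := by
  simp only [obsWeight]
  rw [sum_prod_eq_prod_sum (fun α (d : (j : Fin t) → (A.obs α j).Data) =>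
    ∏ j, (A.obs α j).prob ρ (d j))]
  refine Finset.prod_eq_one fun α _ => ?_
  rw [sum_prod_eq_prod_sum (fun j (d : (A.obs α j).Data) => (A.obs α j).prob ρ d)]
  exact Finset.prod_eq_one fun j _ => (h α j).sum_prob

theorem sum_powWeight (h : ∀ j, (A.pow j).HasMean ρ (ν j)) : ∑ d, A.powWeight ρ d = 1 := by
  simp only [powWeight]
  rw [sum_prod_eq_prod_sum (fun j (d : (A.pow j).Data) => (A.pow j).prob ρ d)]
  exact Finset.prod_eq_one fun j _ => (h j).sum_prob

theorem one_sub_le_pr (hobs : ∀ α j, (A.obs α j).HasMean ρ (μ α j))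
    (hpow : ∀ j, (A.pow j).HasMean ρ (ν j)) {good bad : A.Data → Prop} {δ : ℝ}
    (h : ∀ d, ¬ bad d → good d)
    (hb : weightOf (fun d : A.Data => A.obsWeight ρ d.1 * A.powWeight ρ d.2) bad ≤ δ) :
    1 - δ ≤ A.pr ρ good := by
  refine one_sub_le_weightOf
    (fun d => mul_nonneg (obsWeight_nonneg hobs _) (powWeight_nonneg hpow _)) ?_ h hb
  rw [Fintype.sum_prod_type_right]
  simp_rw [← Finset.sum_mul]
  rw [sum_obsWeight hobs]
  simp [sum_powWeight hpow]

/-- The variance proxy is ∑ a_α² ∑ g_j² / R ≤ (G c)² / R. The double sum is treated as one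
sub-Gaussian variable, so the probability bound depends on neither t nor the number of Pauli
strings. -/
theorem weightOf_obs_le (hobs : ∀ α j, (A.obs α j).HasMean ρ (μ α j)) {R : ℕ} (hR : 0 < R)
    (hruns : ∀ α j, (A.obs α j).runs = R) (a : Fin N → ℝ) (g : Fin t → ℝ) {c G v : ℝ}
    (hc : 0 < c) (hG : 0 < G) (hv : 0 ≤ v) (ha : ∑ α, |a α| ≤ c) (hg : ∑ j, |g j| ≤ G) :
    weightOf (A.obsWeight ρ)
      (fun d => v ≤ |∑ j, g j * ∑ α, a α * ((A.obs α j).mean (d α j) - μ α j)|)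
      ≤ 2 * Real.exp (-(v ^ 2 * R / (2 * (G * c) ^ 2))) := by
  have hR' : (0 : ℝ) < R := by exact_mod_cast hR
  have key := weightOf_le_of_mgf_le (A.obsWeight ρ)
    (fun d => ∑ j, g j * ∑ α, a α * ((A.obs α j).mean (d α j) - μ α j))
    (obsWeight_nonneg hobs) (V := (G * c) ^ 2 / R) (v := v) (by positivity) hv fun l => ?_
  · refine key.trans (le_of_eq ?_)
    congr 3
    field_simp
  have e : ∀ d : (α : Fin N) → (j : Fin t) → (A.obs α j).Data,
      l * ∑ j, g j * ∑ α, a α * ((A.obs α j).mean (d α j) - μ α j)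
      = ∑ α, ∑ j, (l * (a α * g j)) * ((A.obs α j).mean (d α j) - μ α j) := by
    intro d
    simp_rw [Finset.mul_sum]
    rw [Finset.sum_comm]
    refine Finset.sum_congr rfl fun α _ => Finset.sum_congr rfl fun j _ => by ring
  simp_rw [e]
  refine (mgf_prod_le (fun α (d : (j : Fin t) → (A.obs α j).Data) => ∏ j, (A.obs α j).prob ρ (d j))
    (fun α d => ∑ j, (l * (a α * g j)) * ((A.obs α j).mean (d j) - μ α j))
    (fun α => (∑ j, (l * (a α * g j)) ^ 2) / (2 * R))
    (fun α d => Finset.prod_nonneg fun j _ => (hobs α j).prob_nonneg _)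
    (fun α => mgf_linear_comb_le (A.obs α) (hobs α) (hruns α) hR _)).trans ?_
  rw [Real.exp_le_exp, ← Finset.sum_div]
  have h1 : ∑ α, ∑ j, (l * (a α * g j)) ^ 2 = l ^ 2 * ((∑ α, a α ^ 2) * ∑ j, g j ^ 2) := by
    rw [Finset.sum_mul_sum, Finset.mul_sum]
    refine Finset.sum_congr rfl fun α _ => ?_
    rw [Finset.mul_sum]
    exact Finset.sum_congr rfl fun j _ => by ring
  have h2 : ∑ α, a α ^ 2 ≤ c ^ 2 := (sum_sq_le_sq_sum_abs _ a).trans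
    (pow_le_pow_left₀ (Finset.sum_nonneg fun _ _ => abs_nonneg _) ha 2)
  have h3 : ∑ j, g j ^ 2 ≤ G ^ 2 := (sum_sq_le_sq_sum_abs _ g).trans
    (pow_le_pow_left₀ (Finset.sum_nonneg fun _ _ => abs_nonneg _) hg 2)
  rw [h1]
  calc l ^ 2 * ((∑ α, a α ^ 2) * ∑ j, g j ^ 2) / (2 * R)
      ≤ l ^ 2 * (c ^ 2 * G ^ 2) / (2 * R) := by
        gcongr
    _ = l ^ 2 * ((G * c) ^ 2 / R) / 2 := by field_simp

theorem weightOf_pow_le (hpow : ∀ j, (A.pow j).HasMean ρ (ν j)) {R : ℕ} (hR : 0 < R)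
    (hruns : ∀ j, (A.pow j).runs = R) (j : Fin t) {v : ℝ} (hv : 0 ≤ v) :
    weightOf (A.powWeight ρ) (fun d => v ≤ |(A.pow j).mean (d j) - ν j|)
      ≤ 2 * Real.exp (-(v ^ 2 * R / 2)) := by
  have hR' : (0 : ℝ) < R := by exact_mod_cast hR
  have key := weightOf_le_of_mgf_le (A.powWeight ρ) (fun d => (A.pow j).mean (d j) - ν j)
    (powWeight_nonneg hpow) (V := 1 / R) (v := v) (by positivity) hv fun l => ?_
  · refine key.trans (le_of_eq ?_)
    congr 3
    field_simp
  have h := mgf_linear_comb_le A.pow hpow hruns hR (Pi.single j l)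
  have e : ∀ d : (j : Fin t) → (A.pow j).Data,
      ∑ i, (Pi.single j l : Fin t → ℝ) i * ((A.pow i).mean (d i) - ν i)
      = l * ((A.pow j).mean (d j) - ν j) := by
    intro d
    rw [Finset.sum_eq_single j]
    · simp
    · intro i _ hi; simp [Pi.single_eq_of_ne hi]
    · simp
  have e2 : ∑ i, (Pi.single j l : Fin t → ℝ) i ^ 2 = l ^ 2 := by
    rw [Finset.sum_eq_single j]
    · simp
    · intro i _ hi; simp [Pi.single_eq_of_ne hi]
    · simp
  simp_rw [e, e2] at h
  refine h.trans (le_of_eq ?_)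
  congr 1
  field_simp

end Procedure

end

/-! ### The estimation procedure -/

section
open Finset

/-- Swap tests with the Pauli strings `P α` and with the identity. -/
noncomputable def swapProcedure {n N : ℕ} (t : ℕ) (P : Fin N → Fin n → Pauli) (R R' : ℕ) :
    Procedure n N t where
  obs α j := swapTestExperiment j (P α) R
  pow j := swapTestExperiment j (fun _ => .I) R'

theorem hasMean_swapTestExperiment {n : ℕ} (j : ℕ) (P : Fin n → Pauli) (R : ℕ)
    {ρ : Matrix (Fin n → Bool) (Fin n → Bool) ℂ} (hρ : IsState ρ) :
    (swapTestExperiment j P R).HasMean ρ (pauliString P * ρ ^ (j + 1)).trace.re where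
  nonneg := prob_swapTest_nonneg j P hρ
  sum_eq := sum_prob_swapTest j P hρ
  mean_eq := sum_readout_mul_prob_swapTest j P R ρ

theorem Procedure.sum_mul_estObs_sub {n N t : ℕ} (A : Procedure n N t) (a : Fin N → ℝ)
    (P : Fin N → Fin n → Pauli) (ρ : Matrix (Fin n → Bool) (Fin n → Bool) ℂ) (g : ℕ → ℝ)
    (d : A.Data) :
    ∑ j ∈ Icc 1 t, g j * (A.estObs a d j - (pauliSum a P * ρ ^ j).trace.re)
      = ∑ j : Fin t, g (j + 1) * ∑ α, a α * ((A.obs α j).mean (d.1 α j)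
        - (pauliString (P α) * ρ ^ ((j : ℕ) + 1)).trace.re) := by
  rw [sum_Icc_one_eq_sum_range, Finset.sum_range]
  refine Finset.sum_congr rfl fun j _ => ?_
  congr 1
  have e1 : A.estObs a d (j + 1) = ∑ α, a α * (A.obs α j).mean (d.1 α j) := by
    rw [Procedure.estObs, dif_pos ⟨by omega, by omega⟩]
    rfl
  have e2 : (pauliSum a P * ρ ^ ((j : ℕ) + 1)).trace.re
      = ∑ α, a α * (pauliString (P α) * ρ ^ ((j : ℕ) + 1)).trace.re := by
    rw [pauliSum, Finset.sum_mul, Matrix.trace_sum, Complex.re_sum]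
    refine Finset.sum_congr rfl fun α _ => ?_
    rw [Matrix.smul_mul, Matrix.trace_smul, smul_eq_mul, Complex.re_ofReal_mul]
  rw [e1, e2, ← Finset.sum_sub_distrib]
  exact Finset.sum_congr rfl fun α _ => by ring

/-- The factor 4 in 4c is the bound on G. The exponent is ε² R / (512 c²), so R is 512 (c²/ε²)
ln(4/x) rounded up. As ln 4 ≤ 2, the total constant is at most 512 · 3 + 1. -/
theorem exists_runs_obs {ε c x : ℝ} (hε : 0 < ε) (hc : ε ≤ c) (hx : 0 < x) (hx1 : x ≤ 1) :
    ∃ R : ℕ, 0 < R ∧ 2 * Real.exp (-((ε / 4) ^ 2 * R / (2 * (4 * c) ^ 2))) ≤ x / 2 ∧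
      (R : ℝ) ≤ 2000 * (c ^ 2 / ε ^ 2) * max 1 (Real.log (1 / x)) := by
  have hc0 : 0 < c := hε.trans_le hc
  have hlog4 : Real.log 4 ≤ 2 := by
    rw [show (4 : ℝ) = 2 ^ 2 by norm_num, Real.log_pow]
    have := Real.log_two_lt_d9
    push_cast; linarith
  have hlogx : 0 ≤ Real.log (1 / x) := Real.log_nonneg (by rw [le_div_iff₀ hx]; linarith)
  have hlog4' : 0 < Real.log 4 := Real.log_pos (by norm_num)
  have hL : Real.log (4 / x) = Real.log 4 + Real.log (1 / x) := by
    rw [← Real.log_mul (by norm_num) (by positivity)]; ring_nf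
  set y := 512 * (c ^ 2 / ε ^ 2) * Real.log (4 / x) with hy
  have hyp : 0 < y := by rw [hy, hL]; positivity
  have hmx : (1 : ℝ) ≤ max 1 (Real.log (1 / x)) := le_max_left _ _
  have hmx' : Real.log (1 / x) ≤ max 1 (Real.log (1 / x)) := le_max_right _ _
  set mx := max 1 (Real.log (1 / x))
  have hce : 1 ≤ c ^ 2 / ε ^ 2 := by
    rw [one_le_div (by positivity)]
    exact pow_le_pow_left₀ hε.le hc 2
  refine ⟨⌈y⌉₊, Nat.ceil_pos.2 hyp, ?_, ?_⟩
  · have h1 : Real.log (4 / x) ≤ (ε / 4) ^ 2 * ⌈y⌉₊ / (2 * (4 * c) ^ 2) := by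
      calc Real.log (4 / x) = (ε / 4) ^ 2 * y / (2 * (4 * c) ^ 2) := by
            rw [hy]; field_simp; ring
        _ ≤ _ := by gcongr; exact Nat.le_ceil y
    calc _ ≤ 2 * Real.exp (-Real.log (4 / x)) := by gcongr
      _ = x / 2 := by
        rw [Real.exp_neg, Real.exp_log (by positivity)]
        field_simp; norm_num
  · have h2 : Real.log (4 / x) ≤ 3 * mx := by rw [hL]; linarith
    have h3 : 1 ≤ c ^ 2 / ε ^ 2 * mx := one_le_mul_of_one_le_of_one_le hce hmx
    calc (⌈y⌉₊ : ℝ) ≤ y + 1 := (Nat.ceil_lt_add_one hyp.le).le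
      _ ≤ 512 * (c ^ 2 / ε ^ 2) * (3 * mx) + c ^ 2 / ε ^ 2 * mx := by
          rw [hy]; gcongr
      _ ≤ 2000 * (c ^ 2 / ε ^ 2) * mx := by nlinarith

theorem exists_runs_pow {ε m L δ : ℝ} {k t : ℕ} (hε : 0 < ε) (hm : ε ≤ m) (hδ : 0 < δ) (hδ1 : δ < 1)
    (hk : 1 ≤ k) (ht : 1 ≤ t) (htL : (t : ℝ) ≤ L) :
    ∃ R : ℕ, (2 ≤ t → 0 < R ∧
        2 * Real.exp (-(powTol k t m ε ^ 2 * R / 2)) ≤ δ / (2 * t)) ∧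
      (R : ℝ) ≤ 2000 * (k ^ 2 * m ^ 2 / ε ^ 2) * L ^ 5 * max 1 (Real.log (1 / δ)) := by
  have hm0 : 0 < m := hε.trans_le hm
  have hk0 : (1 : ℝ) ≤ k := by exact_mod_cast hk
  have ht0 : (1 : ℝ) ≤ t := by exact_mod_cast ht
  have hL1 : 1 ≤ L := ht0.trans htL
  rcases Nat.lt_or_ge t 2 with h | h
  -- For t = 1 there is no trace of a power to estimate.
  · exact ⟨0, fun h' => absurd h' (by omega), by
      rw [Nat.cast_zero]
      have : 0 ≤ max 1 (Real.log (1 / δ)) := zero_le_one.trans (le_max_left _ _)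
      positivity⟩
  have ht2 : (2 : ℝ) ≤ t := by exact_mod_cast h
  have hlt : 0 < Real.log t := Real.log_pos (by linarith)
  have hltL : Real.log t ≤ L := (Real.log_le_self (by linarith)).trans htL
  have hη : 0 < powTol k t m ε := by rw [powTol]; positivity
  have hlog4 : Real.log 4 ≤ 2 := by
    rw [show (4 : ℝ) = 2 ^ 2 by norm_num, Real.log_pow]
    have := Real.log_two_lt_d9
    push_cast; linarith
  have hlog4' : 0 < Real.log 4 := Real.log_pos (by norm_num)
  have hlogδ : 0 ≤ Real.log (1 / δ) := Real.log_nonneg (by rw [le_div_iff₀ hδ]; linarith)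
  have hlog : Real.log (4 * t / δ) = Real.log 4 + Real.log t + Real.log (1 / δ) := by
    rw [← Real.log_mul (by norm_num) (by positivity),
      ← Real.log_mul (by positivity) (by positivity)]
    ring_nf
  have hmx : (1 : ℝ) ≤ max 1 (Real.log (1 / δ)) := le_max_left _ _
  have hmx' : Real.log (1 / δ) ≤ max 1 (Real.log (1 / δ)) := le_max_right _ _
  set mx := max 1 (Real.log (1 / δ))
  set y := 2 / powTol k t m ε ^ 2 * Real.log (4 * t / δ) with hy
  have hyp : 0 < y := by rw [hy, hlog]; positivity
  refine ⟨⌈y⌉₊, fun _ => ⟨Nat.ceil_pos.2 hyp, ?_⟩, ?_⟩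
  · have h1 : Real.log (4 * t / δ) ≤ powTol k t m ε ^ 2 * ⌈y⌉₊ / 2 := by
      calc Real.log (4 * t / δ) = powTol k t m ε ^ 2 * y / 2 := by
            rw [hy]; field_simp
        _ ≤ _ := by gcongr; exact Nat.le_ceil y
    calc _ ≤ 2 * Real.exp (-Real.log (4 * t / δ)) := by gcongr
      _ = δ / (2 * t) := by
        rw [Real.exp_neg, Real.exp_log (by positivity)]
        field_simp; norm_num
  · set K := (k : ℝ) ^ 2 * m ^ 2 / ε ^ 2 with hK
    have hK1 : 1 ≤ K := by
      rw [hK, one_le_div (by positivity), ← mul_pow]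
      exact pow_le_pow_left₀ hε.le (by nlinarith) 2
    have h2 : Real.log (4 * t / δ) ≤ 4 * (L * mx) := by
      have : 1 * mx ≤ L * mx := by gcongr
      have : L * 1 ≤ L * mx := by gcongr
      rw [hlog]; nlinarith
    -- The squared tolerance contributes t² ln² t ≤ L⁴, and the logarithm of the union bound one
    -- more L; hence the exponent 5.
    have h3 : 2 / powTol k t m ε ^ 2 ≤ 8 * K * (L ^ 2 * L ^ 2) := by
      calc 2 / powTol k t m ε ^ 2 = 8 * K * ((t : ℝ) ^ 2 * Real.log t ^ 2) := by
            rw [hK, powTol]; field_simp; norm_num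
        _ ≤ _ := by gcongr
    have hlog0 : 0 ≤ Real.log (4 * t / δ) := by rw [hlog]; positivity
    have h4 : 1 ≤ K * L ^ 5 * mx := one_le_mul_of_one_le_of_one_le
      (one_le_mul_of_one_le_of_one_le hK1 (one_le_pow₀ hL1)) hmx
    calc (⌈y⌉₊ : ℝ) ≤ y + 1 := (Nat.ceil_lt_add_one hyp.le).le
      _ ≤ (8 * K * (L ^ 2 * L ^ 2)) * (4 * (L * mx)) + K * L ^ 5 * mx := by
          rw [hy]; gcongr
      _ = 33 * (K * L ^ 5 * mx) := by ring
      _ ≤ 2000 * (K * L ^ 5 * mx) := by linarith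
      _ = _ := by ring

/-- The weight of the outcomes of the swap tests. -/
noncomputable def swapWeight {n N : ℕ} (t : ℕ) (P : Fin N → Fin n → Pauli) (R R' : ℕ)
    (ρ : Matrix (Fin n → Bool) (Fin n → Bool) ℂ) (d : (swapProcedure t P R R').Data) : ℝ :=
  (swapProcedure t P R R').obsWeight ρ d.1 * (swapProcedure t P R R').powWeight ρ d.2

section
variable {n N : ℕ} {t : ℕ} {P : Fin N → Fin n → Pauli} {R R' : ℕ}
  {ρ : Matrix (Fin n → Bool) (Fin n → Bool) ℂ}

theorem hasMean_obs (hρ : IsState ρ) (α : Fin N) (j : Fin t) :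
    ((swapProcedure t P R R').obs α j).HasMean ρ
      (pauliString (P α) * ρ ^ ((j : ℕ) + 1)).trace.re :=
  hasMean_swapTestExperiment j (P α) R hρ

theorem hasMean_pow (hρ : IsState ρ) (j : Fin t) :
    ((swapProcedure t P R R').pow j).HasMean ρ (ρ ^ ((j : ℕ) + 1)).trace.re := by
  have h := hasMean_swapTestExperiment j (fun _ : Fin n => Pauli.I) R' hρ
  rwa [pauliString_I, one_mul] at h

theorem swapWeight_nonneg (hρ : IsState ρ) (d) : 0 ≤ swapWeight t P R R' ρ d :=
  mul_nonneg (Procedure.obsWeight_nonneg (hasMean_obs hρ) _)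
    (Procedure.powWeight_nonneg (hasMean_pow hρ) _)

theorem one_sub_le_pr_swapProcedure (hρ : IsState ρ) {good bad : (swapProcedure t P R R').Data → Prop}
    {δ : ℝ} (h : ∀ d, ¬ bad d → good d) (hb : weightOf (swapWeight t P R R' ρ) bad ≤ δ) :
    1 - δ ≤ (swapProcedure t P R R').pr ρ good :=
  Procedure.one_sub_le_pr (hasMean_obs hρ) (hasMean_pow hρ) h hb

/-- The failure probability of a linear combination of the estimates of `Tr (M ρ ^ j)`. -/
theorem weightOf_estObs_le (hρ : IsState ρ) (hR : 0 < R) {a : Fin N → ℝ} {c ε : ℝ}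
    (hε : 0 < ε) (hc : 0 < c) (ha : ∑ α, |a α| ≤ c) {g : ℕ → ℝ} (hg : ∑ j ∈ Icc 1 t, |g j| ≤ 4)
    (y : (j : Fin t) → ((swapProcedure t P R R').pow j).Data) :
    weightOf ((swapProcedure t P R R').obsWeight ρ) (fun x => ε / 4 ≤
      |∑ j ∈ Icc 1 t, g j * ((swapProcedure t P R R').estObs a (x, y) j
        - (pauliSum a P * ρ ^ j).trace.re)|)
      ≤ 2 * Real.exp (-((ε / 4) ^ 2 * R / (2 * (4 * c) ^ 2))) := by
  simp_rw [Procedure.sum_mul_estObs_sub]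
  refine Procedure.weightOf_obs_le (hasMean_obs hρ) hR (fun _ _ => rfl) a
    (fun j => g (j + 1)) hc (by norm_num) (by positivity) ha ?_
  rwa [sum_Icc_one_eq_sum_range, Finset.sum_range] at hg

theorem weightOf_not_closeObs_le (hρ : IsState ρ) (hR : 0 < R) {a : Fin N → ℝ} {c ε : ℝ}
    (hε : 0 < ε) (hc : 0 < c) (ha : ∑ α, |a α| ≤ c) {j : ℕ} (hj : 1 ≤ j) (hjt : j ≤ t) :
    weightOf (swapWeight t P R R' ρ) (fun d =>
      ¬ CloseObs (pauliSum a P) ρ j (ε / 4) ((swapProcedure t P R R').estObs a d j))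
      ≤ 2 * Real.exp (-((ε / 4) ^ 2 * R / (2 * (4 * c) ^ 2))) := by
  refine weightOf_mul_le (Procedure.powWeight_nonneg (hasMean_pow hρ))
    (Procedure.sum_powWeight (hasMean_pow hρ)) _ fun y => ?_
  refine (weightOf_mono (Procedure.obsWeight_nonneg (hasMean_obs hρ)) fun x hx => ?_).trans
    (weightOf_estObs_le hρ hR hε hc ha (g := Pi.single j 1) ?_ y)
  · rw [CloseObs, norm_sub_trace_mul_pow (isHermitian_pauliSum a P) hρ, not_lt] at hx
    rw [Finset.sum_eq_single_of_mem j (Finset.mem_Icc.2 ⟨hj, hjt⟩)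
      fun i _ hi => by rw [Pi.single_eq_of_ne hi, zero_mul]]
    simpa using hx
  · rw [Finset.sum_eq_single_of_mem j (Finset.mem_Icc.2 ⟨hj, hjt⟩)
      fun i _ hi => by rw [Pi.single_eq_of_ne hi, abs_zero]]
    simp

theorem weightOf_not_closePow_le (hρ : IsState ρ) (hR' : 0 < R') {η : ℝ} (hη : 0 ≤ η) {j : ℕ}
    (hj : 2 ≤ j) (hjt : j ≤ t) :
    weightOf (swapWeight t P R R' ρ) (fun d =>
      ¬ ClosePow ρ j η ((swapProcedure t P R R').estPow d j))
      ≤ 2 * Real.exp (-(η ^ 2 * R' / 2)) := by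
  obtain ⟨l, rfl⟩ : ∃ l, j = l + 1 := ⟨j - 1, by omega⟩
  have hb := Procedure.weightOf_pow_le (A := swapProcedure t P R R') (hasMean_pow hρ) hR'
    (fun _ => rfl) ⟨l, by omega⟩ hη
  refine le_trans (weightOf_mono (swapWeight_nonneg hρ) fun d hd => ?_)
    ((weightOf_mul_snd (Procedure.sum_obsWeight (hasMean_obs hρ)) _).trans_le hb)
  rw [ClosePow, norm_sub_trace_pow hρ, not_lt, Procedure.estPow, if_neg (by omega),
    dif_pos ⟨by omega, hjt⟩] at hd
  exact hd

theorem weightOf_exists_not_closePow_le (hρ : IsState ρ) {η z : ℝ} (hη : 0 ≤ η) (hz : 0 ≤ z)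
    (hR' : 2 ≤ t → 0 < R' ∧ 2 * Real.exp (-(η ^ 2 * R' / 2)) ≤ z) :
    weightOf (swapWeight t P R R' ρ) (fun d => ∃ j ∈ Icc 2 t,
      ¬ ClosePow ρ j η ((swapProcedure t P R R').estPow d j)) ≤ t * z := by
  refine (weightOf_exists_le (swapWeight_nonneg hρ) _ _).trans ?_
  calc _ ≤ ∑ j ∈ Icc 2 t, z := Finset.sum_le_sum fun j hj => by
        obtain ⟨h1, h2⟩ := Finset.mem_Icc.1 hj
        obtain ⟨h3, h4⟩ := hR' (h1.trans h2)
        exact (weightOf_not_closePow_le hρ h3 hη h1 h2).trans h4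
    _ ≤ t * z := by
        rw [Finset.sum_const, Nat.card_Icc, nsmul_eq_mul]
        gcongr
        omega

/-- Union bound over the traces of powers only. Once these are good, their outcomes are frozen and
the failure becomes a deviation of a single linear combination of the remaining means. -/
theorem weightOf_not_extendEst_le (hρ : IsState ρ) (hR : 0 < R) {a : Fin N → ℝ} {c ε : ℝ} {k : ℕ}
    (hε : 0 < ε) (hc : 0 < c) (ha : ∑ α, |a α| ≤ c) (hεm : ε ≤ opNormInf (pauliSum a P))
    (hΛ : ρ.rank ≤ ⌊Real.log (2 * k * opNormInf (pauliSum a P) / ε)⌋₊ ∨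
      5 ≤ Real.log (2 * k * opNormInf (pauliSum a P) / ε))
    (ht : t = effRank ρ.rank k (opNormInf (pauliSum a P)) ε) {x z : ℝ} (hz : 0 ≤ z)
    (hx : 2 * Real.exp (-((ε / 4) ^ 2 * R / (2 * (4 * c) ^ 2))) ≤ x)
    (hR' : 2 ≤ t → 0 < R' ∧
      2 * Real.exp (-(powTol k t (opNormInf (pauliSum a P)) ε ^ 2 * R' / 2)) ≤ z)
    {i : ℕ} (hi : 1 ≤ i) (hik : i ≤ k) :
    weightOf (swapWeight t P R R' ρ) (fun d =>
      ¬ ‖(extendEst t ((swapProcedure t P R R').estPow d) ((swapProcedure t P R R').estObs a d) i : ℂ)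
        - (pauliSum a P * ρ ^ i).trace‖ ≤ ε) ≤ t * z + x := by
  set η := powTol k t (opNormInf (pauliSum a P)) ε with hηdef
  have hη : 0 ≤ η := powTol_nonneg k t (opNormInf_nonneg _) hε.le
  have hM := isHermitian_pauliSum a P
  set powBad : (swapProcedure t P R R').Data → Prop := fun d => ∃ j ∈ Icc 2 t,
      ¬ ClosePow ρ j η ((swapProcedure t P R R').estPow d j) with hpowBad
  set bad : (swapProcedure t P R R').Data → Prop := fun d =>
      ¬ ‖(extendEst t ((swapProcedure t P R R').estPow d) ((swapProcedure t P R R').estObs a d) i : ℂ)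
        - (pauliSum a P * ρ ^ i).trace‖ ≤ ε with hbad
  have h2 : weightOf (swapWeight t P R R' ρ) (fun d => ¬ powBad d ∧ bad d) ≤ x := by
    refine weightOf_mul_le (Procedure.powWeight_nonneg (hasMean_pow hρ))
      (Procedure.sum_powWeight (hasMean_pow hρ)) _ fun y => ?_
    -- Whether the powers are good depends on y alone, so the choice of x₀ is immaterial; the
    -- `change` below uses the same fact.
    by_cases hy : ∃ x₀, ¬ powBad (x₀, y)
    · obtain ⟨x₀, hy⟩ := hy
      obtain ⟨g, G, bias, hG1, hG4, hg, hb, hlin⟩ := exists_affine_response hM hρ hε hεm hΛ ht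
        (one_le_effRank hρ hΛ ht) (Q := (swapProcedure t P R R').estPow (x₀, y)) (if_pos rfl)
        (fun j hj hjt => by
          by_contra h
          exact hy ⟨j, Finset.mem_Icc.2 ⟨hj, hjt⟩, h⟩) hi hik
      refine (weightOf_mono (Procedure.obsWeight_nonneg (hasMean_obs hρ)) fun x' hx' => ?_).trans
        ((weightOf_estObs_le hρ hR hε hc ha (hg.trans hG4) y).trans hx)
      have h := hx'.2
      simp only [hbad] at h
      rw [norm_sub_trace_mul_pow hM hρ, not_le] at h
      change ε < |extendEst t ((swapProcedure t P R R').estPow (x₀, y)) _ i - _| at h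
      rw [hlin] at h
      have := abs_add_le bias (∑ j ∈ Icc 1 t, g j *
        ((swapProcedure t P R R').estObs a (x', y) j - (pauliSum a P * ρ ^ j).trace.re))
      -- The bias is at most ε - Gε/4, so the deviation exceeds Gε/4, which is at least ε/4 because
      -- G ≥ 1.
      nlinarith
    · push Not at hy
      refine le_trans (le_of_eq ?_) ((mul_pos two_pos (Real.exp_pos _)).le.trans hx)
      exact Finset.sum_eq_zero fun x' _ => if_neg fun h => h.1 (hy x')
  calc _ ≤ weightOf (swapWeight t P R R' ρ) (fun d => powBad d ∨ (¬ powBad d ∧ bad d)) :=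
        weightOf_mono (swapWeight_nonneg hρ) fun d hd => by
          by_cases h : powBad d
          exacts [Or.inl h, Or.inr ⟨h, hd⟩]
    _ ≤ _ := (weightOf_or_le (swapWeight_nonneg hρ) _ _).trans
        (add_le_add (weightOf_exists_not_closePow_le hρ hη hz hR') h2)

theorem resources_swapProcedure {C : ℕ} (hC : 6 ≤ C) {B B' : ℝ}
    (hB : 1 ≤ t → (N : ℝ) * R ≤ B) (hB' : 1 ≤ t → (R' : ℝ) ≤ B') :
    (swapProcedure t P R R').Resources C B B' := by
  refine ⟨fun α j => cheap_swapTestExperiment j (P α) R hC,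
    fun j => cheap_swapTestExperiment j _ R' hC, fun j => ?_, fun j => hB' j.pos⟩
  refine le_trans (le_of_eq ?_) (hB j.pos)
  change ((∑ α : Fin N, R : ℕ) : ℝ) = _
  simp

end
end

/-! ### The theorem: numbers of runs and union bounds. -/

theorem corollary3 :
    ∃ C p : ℕ, ∀ (n N : ℕ) (a : Fin N → ℝ) (P : Fin N → Fin n → Pauli)
      (M : Matrix (Fin n → Bool) (Fin n → Bool) ℂ) (c : ℝ) (r k t : ℕ) (ε δ : ℝ),
      M = pauliSum a P → ∑ α, |a α| ≤ c →
      0 < ε → ε ≤ opNormInf M → 0 < δ → δ < 1 →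
      (r ≤ ⌊Real.log (2 * k * opNormInf M / ε)⌋₊ ∨ 5 ≤ Real.log (2 * k * opNormInf M / ε)) →
      t = effRank r k (opNormInf M) ε →
      -- sufficiency of the accuracies `ε / 4` and `ε / (2 ‖M‖_∞ k t ln t)` up to the power `t`
      (∀ ρ : Matrix (Fin n → Bool) (Fin n → Bool) ℂ, IsState ρ → ρ.rank = r →
        ∀ Q QM : ℕ → ℝ, Q 1 = 1 →
          (∀ j, 1 ≤ j → j ≤ t → CloseObs M ρ j (ε / 4) (QM j)) →
          (∀ j, 2 ≤ j → j ≤ t → ClosePow ρ j (powTol k t (opNormInf M) ε) (Q j)) →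
          ∀ i, 1 ≤ i → i ≤ k → ‖(extendEst t Q QM i : ℂ) - (M * ρ ^ i).trace‖ ≤ ε) ∧
      -- resources for success probability at least `1 - δ` for each quantity
      (∃ A : Procedure n N t,
        A.Resources C
          (C * (c ^ 2 * N / ε ^ 2) * max 1 (Real.log (1 / δ)))
          (C * (k ^ 2 * opNormInf M ^ 2 / ε ^ 2)
            * Real.log (2 * k * opNormInf M / ε) ^ p * max 1 (Real.log (1 / δ))) ∧
        ∀ ρ : Matrix (Fin n → Bool) (Fin n → Bool) ℂ, IsState ρ → ρ.rank = r →
          (∀ j, 1 ≤ j → j ≤ t →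
            1 - δ ≤ A.pr ρ fun d => CloseObs M ρ j (ε / 4) (A.estObs a d j)) ∧
          (∀ j, 2 ≤ j → j ≤ t →
            1 - δ ≤ A.pr ρ fun d => ClosePow ρ j (powTol k t (opNormInf M) ε) (A.estPow d j)) ∧
          ∀ i, 1 ≤ i → i ≤ k →
            1 - δ ≤ A.pr ρ fun d =>
              ‖(extendEst t (A.estPow d) (A.estObs a d) i : ℂ) - (M * ρ ^ i).trace‖ ≤ ε) ∧
      -- resources for success probability at least `1 - δ` for all quantities simultaneously
      (∃ A : Procedure n N t,
        A.Resources C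
          (C * (c ^ 2 * N / ε ^ 2) * max 1 (Real.log (t / δ)))
          (C * (k ^ 2 * opNormInf M ^ 2 / ε ^ 2)
            * Real.log (2 * k * opNormInf M / ε) ^ p * max 1 (Real.log (1 / δ))) ∧
        ∀ ρ : Matrix (Fin n → Bool) (Fin n → Bool) ℂ, IsState ρ → ρ.rank = r →
          1 - δ ≤ A.pr ρ fun d =>
            (∀ j, 1 ≤ j → j ≤ t → CloseObs M ρ j (ε / 4) (A.estObs a d j)) ∧
            (∀ j, 2 ≤ j → j ≤ t → ClosePow ρ j (powTol k t (opNormInf M) ε) (A.estPow d j)) ∧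
            ∀ i, 1 ≤ i → i ≤ k →
              ‖(extendEst t (A.estPow d) (A.estObs a d) i : ℂ) - (M * ρ ^ i).trace‖ ≤ ε) := by
  refine ⟨2000, 5, ?_⟩
  intro n N a P M c r k t ε δ hM ha hε hεm hδ hδ1 hΛ ht
  subst hM
  have hmc : opNormInf (pauliSum a P) ≤ c := (opNormInf_pauliSum_le a P).trans ha
  have hεc : ε ≤ c := hεm.trans hmc
  have hc : 0 < c := hε.trans_le hεc
  have hηnonneg := powTol_nonneg k t (opNormInf_nonneg (pauliSum a P)) hε.le
  refine ⟨fun ρ hρ hr Q QM hQ1 hQM hQ i hi hik => ?_, ?_⟩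
  · subst hr
    exact norm_extendEst_sub_le (isHermitian_pauliSum a P) hρ hε hεm hΛ ht hQ1 hQM hQ hi hik
  rcases Nat.eq_zero_or_pos t with ht0 | ht1
  -- Effective rank 0 is impossible for a state, and the resource bounds over `Fin 0` are vacuous.
  · have hno : ∀ ρ : Matrix (Fin n → Bool) (Fin n → Bool) ℂ, IsState ρ → ρ.rank = r → False := by
      rintro ρ hρ rfl
      have := one_le_effRank hρ hΛ ht
      omega
    refine ⟨⟨swapProcedure t P 0 0, ?_, fun ρ hρ hr => (hno ρ hρ hr).elim⟩,
      ⟨swapProcedure t P 0 0, ?_, fun ρ hρ hr => (hno ρ hρ hr).elim⟩⟩ <;>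
    exact resources_swapProcedure (by norm_num) (fun h => by omega) (fun h => by omega)
  set L := Real.log (2 * k * opNormInf (pauliSum a P) / ε) with hL
  have htL : (t : ℝ) ≤ L := by
    have h1 : t ≤ ⌊L⌋₊ := ht.trans_le (min_le_right _ _)
    exact (Nat.le_floor_iff' (by omega)).1 h1
  have ht1' : (1 : ℝ) ≤ t := by exact_mod_cast ht1
  -- For k = 0 the logarithm of 0 is 0 by convention, contradicting 1 ≤ t ≤ L.
  have hk : 1 ≤ k := by
    rcases Nat.eq_zero_or_pos k with rfl | h
    · simp at hL
      linarith
    · exact h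
  obtain ⟨R', hR', hB'⟩ := exists_runs_pow hε hεm hδ hδ1 hk ht1 htL
  have hz : 0 ≤ δ / (2 * t) := by positivity
  have htz : t * (δ / (2 * t)) = δ / 2 := by field_simp
  have hzδ : δ / (2 * t) ≤ δ := div_le_self hδ.le (by linarith)
  have hBmul : ∀ (R : ℕ) (mx : ℝ), (R : ℝ) ≤ 2000 * (c ^ 2 / ε ^ 2) * mx →
      (N : ℝ) * R ≤ 2000 * (c ^ 2 * N / ε ^ 2) * mx := fun R mx h => by
    calc (N : ℝ) * R ≤ N * (2000 * (c ^ 2 / ε ^ 2) * mx) := by gcongr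
      _ = _ := by ring
  refine ⟨?_, ?_⟩
  · obtain ⟨R, hR, hRx, hB⟩ := exists_runs_obs hε hεc hδ hδ1.le
    refine ⟨swapProcedure t P R R', resources_swapProcedure (by norm_num)
      (fun _ => by exact_mod_cast hBmul R _ hB) (fun _ => by exact_mod_cast hB'), ?_⟩
    rintro ρ hρ rfl
    refine ⟨fun j hj hjt => ?_, fun j hj hjt => ?_, fun i hi hik => ?_⟩
    · exact one_sub_le_pr_swapProcedure hρ (fun d => not_not.1)
        ((weightOf_not_closeObs_le hρ hR hε hc ha hj hjt).trans (hRx.trans (by linarith)))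
    · obtain ⟨h1, h2⟩ := hR' (hj.trans hjt)
      exact one_sub_le_pr_swapProcedure hρ (fun d => not_not.1)
        ((weightOf_not_closePow_le hρ h1 hηnonneg hj hjt).trans (h2.trans hzδ))
    · refine one_sub_le_pr_swapProcedure hρ (fun d => not_not.1)
        ((weightOf_not_extendEst_le hρ hR hε hc ha hεm hΛ ht hz hRx hR' hi hik).trans ?_)
      rw [htz]; linarith
  -- Each of the t observable estimates may fail with probability δ/(2t), and the traces of powers
  -- together with δ/2. The bounds for all i follow deterministically and need no further union
  -- bound.
  · obtain ⟨R, hR, hRx, hB⟩ := exists_runs_obs (x := δ / t) hε hεc (by positivity)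
      ((div_le_self hδ.le ht1').trans hδ1.le)
    rw [one_div_div] at hB
    refine ⟨swapProcedure t P R R', resources_swapProcedure (by norm_num)
      (fun _ => by exact_mod_cast hBmul R _ hB) (fun _ => by exact_mod_cast hB'), ?_⟩
    rintro ρ hρ rfl
    refine one_sub_le_pr_swapProcedure hρ (bad := fun d =>
      (∃ j ∈ Finset.Icc 1 t, ¬ CloseObs (pauliSum a P) ρ j (ε / 4)
        ((swapProcedure t P R R').estObs a d j)) ∨
      ∃ j ∈ Finset.Icc 2 t, ¬ ClosePow ρ j (powTol k t (opNormInf (pauliSum a P)) ε)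
        ((swapProcedure t P R R').estPow d j)) (fun d hd => ?_) ?_
    · push Not at hd
      have h1 : ∀ j, 1 ≤ j → j ≤ t → CloseObs (pauliSum a P) ρ j (ε / 4)
          ((swapProcedure t P R R').estObs a d j) := fun j hj hjt =>
        hd.1 j (Finset.mem_Icc.2 ⟨hj, hjt⟩)
      have h2 : ∀ j, 2 ≤ j → j ≤ t → ClosePow ρ j (powTol k t (opNormInf (pauliSum a P)) ε)
          ((swapProcedure t P R R').estPow d j) := fun j hj hjt =>
        hd.2 j (Finset.mem_Icc.2 ⟨hj, hjt⟩)
      exact ⟨h1, h2, fun i hi hik => norm_extendEst_sub_le (isHermitian_pauliSum a P) hρ hε hεm hΛ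
        ht (if_pos rfl) h1 h2 hi hik⟩
    · refine (weightOf_or_le (swapWeight_nonneg hρ) _ _).trans ?_
      have h1 := weightOf_exists_not_closePow_le (P := P) (R := R) hρ hηnonneg hz hR'
      have h2 : weightOf (swapWeight t P R R' ρ) (fun d => ∃ j ∈ Finset.Icc 1 t,
          ¬ CloseObs (pauliSum a P) ρ j (ε / 4) ((swapProcedure t P R R').estObs a d j))
          ≤ δ / 2 := by
        refine (weightOf_exists_le (swapWeight_nonneg hρ) _ _).trans ?_
        calc _ ≤ ∑ j ∈ Finset.Icc 1 t, δ / t / 2 := Finset.sum_le_sum fun j hj => by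
              obtain ⟨hj1, hj2⟩ := Finset.mem_Icc.1 hj
              exact (weightOf_not_closeObs_le hρ hR hε hc ha hj1 hj2).trans hRx
          _ = δ / 2 := by
              rw [Finset.sum_const, Nat.card_Icc, nsmul_eq_mul]
              simp only [Nat.add_sub_cancel]
              field_simp
      rw [htz] at h1
      linarith
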